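/- Let $q$ be a prime power, let $k,\lambda$ be integers with $4<k<q+1$ and $\lambda>10$, and let $\mathcal D$ be a $4$-$(q+1,k,\lambda)$ design, i.e. a set of $q+1$ points together with a set of $k$-element subsets (blocks) such that any $4$ distinct points lie in exactly $\lambda$ blocks. Let $G\cong PSL(2,q)$ be a group of automorphisms of $\mathcal D$ that acts transitively on the flags of $\mathcal D$ (the pairs $(x,B)$ with $B$ a block and $x\in B$), and for a block $B$ let $G_B$ be its setwise stabiliser in $G$. Then $G_B$ is not isomorphic to $A_4$, $S_4$ or $A_5$; it is not isomorphic to $PGL(2,q_0)$ for any prime power $q_0$ and even integer $g>1$ with $q_0^g=q$; and it is not isomorphic to $PSL(2,q_0)$ for any prime power $q_0$ and integer $g\ge 1$ with $q_0^g=q$. In other words, there is no such design whose block stabiliser is one of these groups. -/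

import Mathlib

open scoped Pointwise

/-- A (simple) `t`-`(v,k,lam)` design on the finite point set `X`: `X` has `v` points, and the blocks
are `k`-element subsets of `X` such that every `t`-element subset of `X` is contained in exactly
`lam` blocks. -/
structure BlockDesign (X : Type*) [Finite X] (t v k lam : ℕ) where
  /-- the blocks, which are sets of points -/
  blocks : Set (Set X)
  card_points : Nat.card X = v
  card_block : ∀ B ∈ blocks, B.ncard = k
  card_blocks_through : ∀ T : Set X, T.ncard = t → {B ∈ blocks | T ⊆ B}.ncard = lam

namespace BlockDesign

variable {X : Type*} [Finite X] {t v k lam : ℕ}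

/-- The full automorphism group of a design: all permutations of the points that map the set of
blocks onto itself. -/
def autGroup (D : BlockDesign X t v k lam) : Subgroup (Equiv.Perm X) :=
  MulAction.stabilizer (Equiv.Perm X) D.blocks

/-- `g` is an automorphism iff it maps blocks, and only blocks, to blocks. -/
theorem mem_autGroup (D : BlockDesign X t v k lam) (g : Equiv.Perm X) :
    g ∈ D.autGroup ↔ ∀ B : Set X, g '' B ∈ D.blocks ↔ B ∈ D.blocks := by
  rw [autGroup, MulAction.mem_stabilizer_set]
  rfl

/-- A flag is an incident point-block pair. -/
def IsFlag (D : BlockDesign X t v k lam) (x : X) (B : Set X) : Prop :=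
  B ∈ D.blocks ∧ x ∈ B

/-- `G` is transitive on the flags of `D`. -/
def FlagTransitive (D : BlockDesign X t v k lam) (G : Subgroup (Equiv.Perm X)) : Prop :=
  ∀ (x : X) (B : Set X) (y : X) (C : Set X), D.IsFlag x B → D.IsFlag y C →
    ∃ g ∈ G, g x = y ∧ g '' B = C

end BlockDesign

/-- The setwise stabiliser in the permutation group `G` of a set `B` of points. -/
def setwiseStabilizer {X : Type*} (G : Subgroup (Equiv.Perm X)) (B : Set X) : Subgroup G :=
  MulAction.stabilizer G B

/-- `g` lies in the setwise stabiliser of `B` iff it maps `B` onto itself. -/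
theorem mem_setwiseStabilizer {X : Type*} (G : Subgroup (Equiv.Perm X)) (B : Set X) (g : G) :
    g ∈ setwiseStabilizer G B ↔ (g : Equiv.Perm X) '' B = B :=
  Iff.rfl

/-! The projective special linear group `G` has order `q (q ^ 2 - 1) / d`, with `d` the order of the
centre of `SL(2, q)`. Flag-transitivity makes the blocks a single `G`-orbit, and each block an orbit
of its stabiliser, so double counting gives the equation (`BlockDesign.FlagTransitive.parameter_eq`)
`lam (q - 2) d |G_B| = k (k - 1) (k - 2) (k - 3)`.

Since `G` is transitive on the `q + 1` points, its action is the one on the projective line over `F`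
(`LineModel.nonempty_of_isPretransitive`): a subgroup of index `q + 1` in `SL(2, q)` contains the
full stabiliser of a vector and therefore is the stabiliser of a line.

Suppose that `G_B` is `PSL(2, q₀)` or `PGL(2, q₀)`, where `q = q₀ ^ g`. Unipotent elements of `G_B`
have exactly one fixed point each, and these fixed points form a projective line over the small
field `K`. A point outside it has a stabiliser that is trivial or a maximal nonsplit torus
(`PlaneCover.stabilizer_trichotomy`). Hence `k` is `q₀ + 1`, `q₀ ^ 2 - q₀`, `q₀ ^ 3 - q₀`, or half
of the last, and the parameter equation says that a polynomial in `q₀` is divisible by `q₀ ^ g - 2`.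
Remainders modulo `q₀ ^ g - 2` exclude this when `lam > 10` (`subfield_block_false`). If `g = 1`,
the block is the whole line, against `k < q + 1`.

Suppose that `G_B` is `A₄`, `S₄` or `A₅`. Then `k` divides `12`, `24` or `60`, and the parameter
equation leaves finitely many `q`. Nearly all survivors have `q` and `lam` odd, where `2`-subgroups
that stabilise a `4`-set fix a block through it (`BlockDesign.exists_fixed_block`). If `q ≡ 1`
modulo `4`, involutions have fixed points, and flag stabilisers must have even order. If `q ≡ 3`
modulo `4`, involutions have no fixed points, so flag stabilisers have odd order; and every
four-group fixes a block through every point, so counting pairs of commuting involutions bounds `q`.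
The value `q = 89` for `A₅` is excluded because elements of order `4` would fix blocks. In
characteristic two an involution has a unique fixed point, which is also fixed by every element
conjugating the involution to one that commutes with it (`LineModel.smul_eq_of_commute_conj`); so
`A₄` would fix a point when `q = 32`, and flag stabilisers of even order in `A₅` would have order
divisible by `3` when `q` is `16` or `128`. -/

open scoped MatrixGroups

/-! ### Linear algebra of the plane -/

section Plane

variable {F : Type*} [Field F]

/-- The determinant of the pair of plane vectors `v`, `w`; it vanishes iff they are dependent. -/
def planeCross (v w : Fin 2 → F) : F := v 0 * w 1 - v 1 * w 0

theorem planeCross_self (v : Fin 2 → F) : planeCross v v = 0 := by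
  simp [planeCross, mul_comm]

theorem planeCross_swap (v w : Fin 2 → F) : planeCross w v = -planeCross v w := by
  simp [planeCross]; ring

theorem planeCross_smul_right (c : F) (v w : Fin 2 → F) :
    planeCross v (c • w) = c * planeCross v w := by
  simp [planeCross]; ring

theorem planeCross_smul_left (c : F) (v w : Fin 2 → F) :
    planeCross (c • v) w = c * planeCross v w := by
  simp [planeCross]; ring

theorem planeCross_mulVec (M : Matrix (Fin 2) (Fin 2) F) (v w : Fin 2 → F) :
    planeCross (M.mulVec v) (M.mulVec w) = M.det * planeCross v w := by
  simp [planeCross, Matrix.mulVec, dotProduct, Fin.sum_univ_two, Matrix.det_fin_two]; ring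

theorem exists_smul_of_planeCross_eq_zero {v w : Fin 2 → F} (hv : v ≠ 0)
    (h : planeCross v w = 0) : ∃ c : F, w = c • v := by
  unfold planeCross at h
  by_cases h0 : v 0 = 0
  · have h1 : v 1 ≠ 0 := by
      intro h1; apply hv; ext i; fin_cases i <;> simp [h0, h1]
    refine ⟨w 1 / v 1, ?_⟩
    ext i; fin_cases i
    · simp [h0] at h ⊢; simpa [h1] using h
    · simp [h1]
  · refine ⟨w 0 / v 0, ?_⟩
    ext i; fin_cases i
    · simp [h0]
    · simp; field_simp; linear_combination h

theorem planeCross_right_ne_zero {v w : Fin 2 → F} (h : planeCross v w ≠ 0) : w ≠ 0 := by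
  rintro rfl; simp [planeCross] at h

theorem eq_add_of_planeCross_ne_zero {v w : Fin 2 → F} (h : planeCross v w ≠ 0)
    (u : Fin 2 → F) :
    u = (planeCross u w / planeCross v w) • v + (planeCross v u / planeCross v w) • w := by
  unfold planeCross at *
  ext i; fin_cases i <;>
  simp only [Pi.add_apply, Pi.smul_apply, smul_eq_mul, Fin.zero_eta, Fin.mk_one] <;>
  rw [div_mul_eq_mul_div, div_mul_eq_mul_div, ← add_div, eq_div_iff h] <;> ring

theorem exists_planeCross_eq_one {v : Fin 2 → F} (hv : v ≠ 0) :
    ∃ w : Fin 2 → F, planeCross v w = 1 := by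
  by_cases h0 : v 0 = 0
  · have h1 : v 1 ≠ 0 := by
      intro h1; apply hv; ext i; fin_cases i <;> simp [h0, h1]
    exact ⟨![-(v 1)⁻¹, 0], by simp [planeCross, h1]⟩
  · exact ⟨![0, (v 0)⁻¹], by simp [planeCross, h0]⟩

theorem matrix_eq_of_mulVec_eq {v w : Fin 2 → F} (h : planeCross v w ≠ 0)
    {M N : Matrix (Fin 2) (Fin 2) F} (h1 : M.mulVec v = N.mulVec v)
    (h2 : M.mulVec w = N.mulVec w) : M = N := by
  have key : ∀ i, M i 0 = N i 0 ∧ M i 1 = N i 1 := by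
    intro i
    have e1 := congrFun h1 i
    have e2 := congrFun h2 i
    simp only [Matrix.mulVec, dotProduct, Fin.sum_univ_two] at e1 e2
    unfold planeCross at h
    constructor
    · apply mul_right_cancel₀ h; linear_combination w 1 * e1 - v 1 * e2
    · apply mul_right_cancel₀ h; linear_combination -w 0 * e1 + v 0 * e2
  ext i j
  fin_cases j
  · exact (key i).1
  · exact (key i).2

theorem det_eq_mul_of_eigenvectors {v w : Fin 2 → F} (h : planeCross v w ≠ 0)
    {M : Matrix (Fin 2) (Fin 2) F} {a b : F} (h1 : M.mulVec v = a • v)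
    (h2 : M.mulVec w = b • w) : M.det = a * b := by
  have := planeCross_mulVec M v w
  rw [h1, h2, planeCross_smul_left, planeCross_smul_right, ← mul_assoc] at this
  exact (mul_right_cancel₀ h this).symm

theorem eq_smul_one_of_eigenvectors {v w : Fin 2 → F} (h : planeCross v w ≠ 0)
    {M : Matrix (Fin 2) (Fin 2) F} {a : F} (h1 : M.mulVec v = a • v)
    (h2 : M.mulVec w = a • w) : M = a • (1 : Matrix (Fin 2) (Fin 2) F) :=
  matrix_eq_of_mulVec_eq h (by simp [h1, Matrix.smul_mulVec]) (by simp [h2, Matrix.smul_mulVec])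

/-- A matrix with three pairwise independent eigenvectors is scalar. -/
theorem eq_smul_one_of_three_eigenvectors {u v w : Fin 2 → F} (huv : planeCross u v ≠ 0)
    (hvw : planeCross v w ≠ 0) (huw : planeCross u w ≠ 0)
    {M : Matrix (Fin 2) (Fin 2) F} {a b c : F} (h1 : M.mulVec u = a • u)
    (h2 : M.mulVec v = b • v) (h3 : M.mulVec w = c • w) :
    M = a • (1 : Matrix (Fin 2) (Fin 2) F) := by
  have e1 := det_eq_mul_of_eigenvectors huv h1 h2
  have hw := eq_add_of_planeCross_ne_zero huv w
  set r := planeCross w v / planeCross u v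
  set s := planeCross u w / planeCross u v
  have hr : r ≠ 0 := div_ne_zero (by rw [planeCross_swap]; exact neg_ne_zero.2 hvw) huv
  have hs : s ≠ 0 := div_ne_zero huw huv
  have hM : M.mulVec w = r • a • u + s • b • v := by
    rw [hw, Matrix.mulVec_add, Matrix.mulVec_smul, Matrix.mulVec_smul, h1, h2]
  rw [h3, hw] at hM
  have ca : c = a := by
    have := congrArg (fun z => planeCross z v) hM
    simp only [planeCross, Pi.add_apply, Pi.smul_apply, smul_eq_mul] at this
    have h' : r * planeCross u v * (c - a) = 0 := by
      unfold planeCross; linear_combination this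
    rcases mul_eq_zero.1 h' with h' | h'
    · exact absurd h' (mul_ne_zero hr huv)
    · exact sub_eq_zero.1 h'
  have cb : c = b := by
    have := congrArg (fun z => planeCross u z) hM
    simp only [planeCross, Pi.add_apply, Pi.smul_apply, smul_eq_mul] at this
    have h' : s * planeCross u v * (c - b) = 0 := by
      unfold planeCross; linear_combination this
    rcases mul_eq_zero.1 h' with h' | h'
    · exact absurd h' (mul_ne_zero hs huv)
    · exact sub_eq_zero.1 h'
  exact eq_smul_one_of_eigenvectors huv h1 (by rw [h2, ← cb, ca])

/-- The transvection `u ↦ u + t (v ∧ u) v` in the direction of `v`. -/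
def planeTransvection (v : Fin 2 → F) (t : F) : Matrix (Fin 2) (Fin 2) F :=
  !![1 - t * v 1 * v 0, t * v 0 * v 0; -(t * v 1 * v 1), 1 + t * v 0 * v 1]

theorem planeTransvection_mulVec (v u : Fin 2 → F) (t : F) :
    (planeTransvection v t).mulVec u = u + (t * planeCross v u) • v := by
  ext i; fin_cases i <;>
  simp [planeTransvection, planeCross, Matrix.mulVec, dotProduct, Fin.sum_univ_two] <;> ring

theorem det_planeTransvection (v : Fin 2 → F) (t : F) : (planeTransvection v t).det = 1 := by
  simp [planeTransvection, Matrix.det_fin_two]; ring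

theorem planeTransvection_mul (v : Fin 2 → F) (s t : F) :
    planeTransvection v s * planeTransvection v t = planeTransvection v (s + t) := by
  ext i j; fin_cases i <;> fin_cases j <;>
  simp [planeTransvection, Matrix.mul_apply, Fin.sum_univ_two] <;> ring

theorem planeTransvection_zero (v : Fin 2 → F) : planeTransvection v 0 = 1 := by
  ext i j; fin_cases i <;> fin_cases j <;> simp [planeTransvection]

theorem planeTransvection_pow (v : Fin 2 → F) (t : F) (n : ℕ) :
    planeTransvection v t ^ n = planeTransvection v (n * t) := by
  induction n with
  | zero => simp [planeTransvection_zero]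
  | succ n ih => rw [pow_succ, ih, planeTransvection_mul]; push_cast; ring_nf

/-- Conjugating a transvection moves its direction. -/
theorem mul_planeTransvection (M : Matrix (Fin 2) (Fin 2) F) (v : Fin 2 → F) (t : F) :
    M * planeTransvection v (t * M.det) = planeTransvection (M.mulVec v) t * M := by
  ext i j
  fin_cases i <;> fin_cases j <;>
  simp [planeTransvection, Matrix.mul_apply, Fin.sum_univ_two, Matrix.mulVec, dotProduct,
    Matrix.det_fin_two] <;> ring

/-- A matrix of determinant one fixing `v` is a transvection in the direction of `v`. -/
theorem exists_eq_planeTransvection {v : Fin 2 → F} (hv : v ≠ 0) {M : Matrix (Fin 2) (Fin 2) F}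
    (hd : M.det = 1) (h : M.mulVec v = v) : ∃ t, M = planeTransvection v t := by
  obtain ⟨w, hw⟩ := exists_planeCross_eq_one hv
  have h1 := planeCross_mulVec M v w
  rw [h, hd, one_mul] at h1
  have h2 : planeCross v (M.mulVec w - w) = 0 := by
    simp only [planeCross, Pi.sub_apply] at *; linear_combination h1
  obtain ⟨t, ht⟩ := exists_smul_of_planeCross_eq_zero hv h2
  refine ⟨t, matrix_eq_of_mulVec_eq (v := v) (w := w) (by simp [hw]) ?_ ?_⟩
  · rw [h, planeTransvection_mulVec, planeCross_self]; simp
  · rw [planeTransvection_mulVec, hw, mul_one, ← ht]; simp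

/-- A matrix of determinant one carrying `v` to `w`. -/
theorem exists_det_one_mulVec_eq {v w : Fin 2 → F} (hv : v ≠ 0) (hw : w ≠ 0) :
    ∃ M : Matrix (Fin 2) (Fin 2) F, M.det = 1 ∧ M.mulVec v = w := by
  obtain ⟨v', hv'⟩ := exists_planeCross_eq_one hv
  obtain ⟨w', hw'⟩ := exists_planeCross_eq_one hw
  refine ⟨!![w 0, w' 0; w 1, w' 1] * !![v' 1, -v' 0; -v 1, v 0], ?_, ?_⟩
  · unfold planeCross at *
    rw [Matrix.det_mul, Matrix.det_fin_two_of, Matrix.det_fin_two_of]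
    linear_combination hv' * (w 0 * w' 1 - w 1 * w' 0) + hw'
  · unfold planeCross at *
    ext i; fin_cases i <;>
    simp [Matrix.mulVec, dotProduct, Fin.sum_univ_two, Matrix.mul_apply]
    · linear_combination w 0 * hv'
    · linear_combination w 1 * hv'

end Plane

/-! ### The action on the projective line -/

/-- An identification of a `G`-set `X` with (part of) the projective line over `F`, compatible with
an epimorphism `SL(2, F) → G` whose kernel consists of the scalar matrices. The line corresponding
to the point `x` is spanned by the vector `vec x`. -/
structure LineModel (F : Type*) [Field F] (G X : Type*) [Group G] [MulAction G X] where
  /-- the epimorphism from the special linear group -/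
  proj : SL(2, F) →* G
  proj_surjective : Function.Surjective proj
  proj_eq_one_iff : ∀ M : SL(2, F), proj M = 1 ↔
    ∃ c : F, (M : Matrix (Fin 2) (Fin 2) F) = c • (1 : Matrix (Fin 2) (Fin 2) F)
  /-- a vector spanning the line of a point -/
  vec : X → Fin 2 → F
  vec_ne_zero : ∀ x, vec x ≠ 0
  equivariant : ∀ (M : SL(2, F)) (x : X), ∃ c : F,
    (M : Matrix (Fin 2) (Fin 2) F).mulVec (vec x) = c • vec (proj M • x)
  cross_ne_zero : ∀ x y, x ≠ y → planeCross (vec x) (vec y) ≠ 0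

namespace LineModel

variable {F : Type*} [Field F] {G X : Type*} [Group G] [MulAction G X]

theorem exists_eigenvalue (m : LineModel F G X) {M : SL(2, F)} {x : X} (h : m.proj M • x = x) :
    ∃ c : F, (M : Matrix (Fin 2) (Fin 2) F).mulVec (m.vec x) = c • m.vec x := by
  have := m.equivariant M x
  rwa [h] at this

/-- A nontrivial element of `G` has at most two fixed points. -/
theorem eq_one_of_three_fixed (m : LineModel F G X) {g : G} {x y z : X} (hxy : x ≠ y)
    (hyz : y ≠ z) (hxz : x ≠ z) (hx : g • x = x) (hy : g • y = y) (hz : g • z = z) : g = 1 := by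
  obtain ⟨M, rfl⟩ := m.proj_surjective g
  obtain ⟨a, ha⟩ := m.exists_eigenvalue hx
  obtain ⟨b, hb⟩ := m.exists_eigenvalue hy
  obtain ⟨c, hc⟩ := m.exists_eigenvalue hz
  exact (m.proj_eq_one_iff M).2 ⟨a, eq_smul_one_of_three_eigenvectors (m.cross_ne_zero _ _ hxy)
    (m.cross_ne_zero _ _ hyz) (m.cross_ne_zero _ _ hxz) ha hb hc⟩

/-- An element of `G` interchanging two points is an involution. -/
theorem sq_eq_one_of_swap (m : LineModel F G X) {g : G} {x y : X} (hxy : x ≠ y)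
    (h1 : g • x = y) (h2 : g • y = x) : g * g = 1 := by
  obtain ⟨M, rfl⟩ := m.proj_surjective g
  obtain ⟨a, ha⟩ := m.equivariant M x
  obtain ⟨b, hb⟩ := m.equivariant M y
  rw [h1] at ha
  rw [h2] at hb
  rw [← map_mul, m.proj_eq_one_iff]
  refine ⟨a * b, eq_smul_one_of_eigenvectors (m.cross_ne_zero _ _ hxy) ?_ ?_⟩
  · rw [Matrix.SpecialLinearGroup.coe_mul, ← Matrix.mulVec_mulVec, ha, Matrix.mulVec_smul, hb,
      smul_smul]
  · rw [Matrix.SpecialLinearGroup.coe_mul, ← Matrix.mulVec_mulVec, hb, Matrix.mulVec_smul, ha,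
      smul_smul, mul_comm]

theorem eigenvalue_ne_zero {M : SL(2, F)} {v : Fin 2 → F} (hv : v ≠ 0) {c : F}
    (h : (M : Matrix (Fin 2) (Fin 2) F).mulVec v = c • v) : c ≠ 0 := by
  rintro rfl
  apply hv
  have := congrArg ((M⁻¹ : SL(2, F)) : Matrix (Fin 2) (Fin 2) F).mulVec h
  rw [Matrix.mulVec_mulVec, ← Matrix.SpecialLinearGroup.coe_mul, inv_mul_cancel] at this
  simpa using this

theorem eigenvalue_unique {M : Matrix (Fin 2) (Fin 2) F} {v : Fin 2 → F} (hv : v ≠ 0) {b c : F}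
    (hb : M.mulVec v = b • v) (hc : M.mulVec v = c • v) : b = c := by
  have h : (b - c) • v = 0 := by rw [sub_smul, ← hb, ← hc, sub_self]
  exact sub_eq_zero.1 ((smul_eq_zero.1 h).resolve_right hv)

/-- Elements of `SL(2, F)` with the same image in `G` differ by a sign, so only the square of an
eigenvalue is determined by the image. -/
theorem eigenvalue_sq_unique (m : LineModel F G X) {M N : SL(2, F)} {x : X} {b c : F}
    (hMN : m.proj M = m.proj N)
    (hb : (M : Matrix (Fin 2) (Fin 2) F).mulVec (m.vec x) = b • m.vec x)
    (hc : (N : Matrix (Fin 2) (Fin 2) F).mulVec (m.vec x) = c • m.vec x) : b ^ 2 = c ^ 2 := by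
  have h1 : m.proj (M⁻¹ * N) = 1 := by rw [map_mul, map_inv, hMN, inv_mul_cancel]
  obtain ⟨r, hr⟩ := (m.proj_eq_one_iff _).1 h1
  have hr2 : r ^ 2 = 1 := by
    have := (M⁻¹ * N).2
    rw [hr, Matrix.det_smul] at this
    simpa using this
  have hN : (N : Matrix (Fin 2) (Fin 2) F) = r • (M : Matrix (Fin 2) (Fin 2) F) := by
    have : N = M * (M⁻¹ * N) := by group
    rw [this, Matrix.SpecialLinearGroup.coe_mul M, hr]; simp
  have : c = r * b := by
    apply eigenvalue_unique (m.vec_ne_zero x) hc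
    rw [hN, Matrix.smul_mulVec, hb, smul_smul]
  rw [this, mul_pow, hr2, one_mul]

/-- The squared eigenvalue is a multiplicative character of a point stabiliser. -/
theorem exists_stabilizer_character (m : LineModel F G X) (x : X) :
    ∃ χ : MulAction.stabilizer G x →* F, ∀ (g : MulAction.stabilizer G x) (M : SL(2, F)) (c : F),
      m.proj M = g → (M : Matrix (Fin 2) (Fin 2) F).mulVec (m.vec x) = c • m.vec x →
        χ g = c ^ 2 := by
  choose L hL using m.proj_surjective
  have he : ∀ g : MulAction.stabilizer G x, ∃ c : F,
      (L (g : G) : Matrix (Fin 2) (Fin 2) F).mulVec (m.vec x) = c • m.vec x := fun g =>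
    m.exists_eigenvalue (by rw [hL]; exact g.2)
  choose e he using he
  have key : ∀ (g : MulAction.stabilizer G x) (M : SL(2, F)) (c : F), m.proj M = g →
      (M : Matrix (Fin 2) (Fin 2) F).mulVec (m.vec x) = c • m.vec x → e g ^ 2 = c ^ 2 :=
    fun g M c hM hc => m.eigenvalue_sq_unique (by rw [hL, hM]) (he g) hc
  refine ⟨⟨⟨fun g => e g ^ 2, ?_⟩, ?_⟩, key⟩
  · simpa using key 1 1 1 (by simp) (by simp)
  · intro g h
    have := key (g * h) (L g * L h) (e g * e h) (by simp [hL]) (by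
      rw [Matrix.SpecialLinearGroup.coe_mul, ← Matrix.mulVec_mulVec, he, Matrix.mulVec_smul, he,
        smul_smul, mul_comm])
    simpa [mul_pow] using this

/-- The eigenvalue character of the stabiliser of `x`: the square of the eigenvalue on the line of
`x` of any preimage in `SL(2, F)`. Its values are taken in the multiplicative monoid of `F`. -/
noncomputable def chr (m : LineModel F G X) (x : X) : MulAction.stabilizer G x →* F :=
  (m.exists_stabilizer_character x).choose

theorem chr_eq (m : LineModel F G X) (x : X) (g : MulAction.stabilizer G x) (M : SL(2, F)) (c : F)
    (h1 : m.proj M = g) (h2 : (M : Matrix (Fin 2) (Fin 2) F).mulVec (m.vec x) = c • m.vec x) :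
    m.chr x g = c ^ 2 :=
  (m.exists_stabilizer_character x).choose_spec g M c h1 h2

/-- The kernel of the eigenvalue character consists of the transvections, up to sign. -/
theorem exists_transvection_of_chr_eq_one (m : LineModel F G X) {x : X}
    {g : MulAction.stabilizer G x} (hg : m.chr x g = 1) :
    ∃ (M : SL(2, F)) (c t : F), m.proj M = g ∧ c ≠ 0 ∧
      (M : Matrix (Fin 2) (Fin 2) F) = c • planeTransvection (m.vec x) t := by
  obtain ⟨M, hM⟩ := m.proj_surjective (g : G)
  obtain ⟨c, hc⟩ := m.exists_eigenvalue (M := M) (x := x) (by rw [hM]; exact g.2)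
  have hc2 : c ^ 2 = 1 := by rw [← hg, m.chr_eq x g M c hM hc]
  obtain ⟨t, ht⟩ := exists_eq_planeTransvection (m.vec_ne_zero x)
    (M := c • (M : Matrix (Fin 2) (Fin 2) F)) (by rw [Matrix.det_smul, M.2]; simpa using hc2)
    (by rw [Matrix.smul_mulVec, hc, smul_smul, ← sq, hc2, one_smul])
  refine ⟨M, c, t, hM, ?_, ?_⟩
  · rintro rfl; simp at hc2
  · rw [← ht, smul_smul, ← sq, hc2, one_smul]

theorem commute_of_chr_eq_one (m : LineModel F G X) {x : X} {g h : MulAction.stabilizer G x}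
    (hg : m.chr x g = 1) (hh : m.chr x h = 1) : (g : G) * h = h * g := by
  obtain ⟨M, c, t, hM, -, h1⟩ := m.exists_transvection_of_chr_eq_one hg
  obtain ⟨N, d, s, hN, -, h2⟩ := m.exists_transvection_of_chr_eq_one hh
  rw [← hM, ← hN, ← map_mul, ← map_mul]
  congr 1
  apply Subtype.ext
  rw [Matrix.SpecialLinearGroup.coe_mul, Matrix.SpecialLinearGroup.coe_mul, h1, h2]
  rw [smul_mul_smul_comm, smul_mul_smul_comm, planeTransvection_mul, planeTransvection_mul,
    add_comm t, mul_comm c]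

/-- Transvections in characteristic `p` have order dividing `p`. -/
theorem pow_char_eq_one_of_chr_eq_one (m : LineModel F G X) (p : ℕ) [CharP F p] {x : X}
    {g : MulAction.stabilizer G x} (hg : m.chr x g = 1) : (g : G) ^ p = 1 := by
  obtain ⟨M, c, t, hM, -, h1⟩ := m.exists_transvection_of_chr_eq_one hg
  rw [← hM, ← map_pow, m.proj_eq_one_iff]
  refine ⟨c ^ p, ?_⟩
  rw [Matrix.SpecialLinearGroup.coe_pow, h1, smul_pow, planeTransvection_pow, CharP.cast_eq_zero,
    zero_mul, planeTransvection_zero]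

theorem chr_eq_one_of_pow_char (m : LineModel F G X) (p : ℕ) [Fact p.Prime] [CharP F p] {x : X}
    {g : MulAction.stabilizer G x} (hg : (g : G) ^ p = 1) : m.chr x g = 1 := by
  have h : (m.chr x g) ^ p = 1 := by
    rw [← map_pow, show g ^ p = 1 from Subtype.ext (by simpa using hg), map_one]
  have : (m.chr x g - 1) ^ p = 0 := by rw [sub_pow_char, h, one_pow, sub_self]
  exact sub_eq_zero.1 (pow_eq_zero_iff (Fact.out : p.Prime).ne_zero |>.1 this)

/-- An element whose order divides the characteristic and which fixes two points is trivial. -/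
theorem eq_one_of_pow_char_of_two_fixed (m : LineModel F G X) (p : ℕ) [Fact p.Prime] [CharP F p]
    {g : G} (hg : g ^ p = 1) {x y : X} (hxy : x ≠ y) (hx : g • x = x) (hy : g • y = y) :
    g = 1 := by
  obtain ⟨M, c, t, hM, hc, h1⟩ := m.exists_transvection_of_chr_eq_one (x := x) (g := ⟨g, hx⟩)
    (m.chr_eq_one_of_pow_char p hg)
  change m.proj M = g at hM
  obtain ⟨b, hb⟩ := m.exists_eigenvalue (M := M) (x := y) (by rw [hM, hy])
  have hxM : (M : Matrix (Fin 2) (Fin 2) F).mulVec (m.vec x) = c • m.vec x := by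
    rw [h1, Matrix.smul_mulVec, planeTransvection_mulVec, planeCross_self]; simp
  have hdet := det_eq_mul_of_eigenvectors (m.cross_ne_zero _ _ hxy) hxM hb
  have hdet' : (M : Matrix (Fin 2) (Fin 2) F).det = c * c := by
    rw [h1, Matrix.det_smul, det_planeTransvection]; simp [sq]
  have hbc : b = c := mul_left_cancel₀ hc (hdet.symm.trans hdet')
  rw [← hM, m.proj_eq_one_iff]
  exact ⟨c, eq_smul_one_of_eigenvectors (m.cross_ne_zero _ _ hxy) hxM (hbc ▸ hb)⟩

end LineModel

/-! ### Orders of linear groups -/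

section Card

theorem card_GL_two (K : Type*) [Field K] [Finite K] :
    Nat.card (GL (Fin 2) K) = (Nat.card K ^ 2 - 1) * (Nat.card K ^ 2 - Nat.card K) := by
  have := Fintype.ofFinite K
  rw [Matrix.card_GL_field, Fin.prod_univ_two, Nat.card_eq_fintype_card]; simp

theorem card_SL_two (K : Type*) [Field K] [Finite K] :
    Nat.card SL(2, K) = Nat.card K * (Nat.card K ^ 2 - 1) := by
  have h1 := (Matrix.GeneralLinearGroup.det (n := Fin 2) (R := K)).ker.card_mul_index
  have hsurj : Function.Surjective (Matrix.GeneralLinearGroup.det (n := Fin 2) (R := K)) := by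
    intro u
    refine ⟨Matrix.GeneralLinearGroup.mkOfDetNeZero !![(u : K), 0; 0, 1] (by simp), ?_⟩
    ext; simp [Matrix.GeneralLinearGroup.mkOfDetNeZero]
  rw [Subgroup.index_ker, MonoidHom.range_eq_top.2 hsurj, Subgroup.card_top, Nat.card_units,
    card_GL_two] at h1
  have e : SL(2, K) ≃ (Matrix.GeneralLinearGroup.det (n := Fin 2) (R := K)).ker :=
    Equiv.ofBijective (fun M => ⟨Matrix.SpecialLinearGroup.toGL M, by
        rw [MonoidHom.mem_ker]; ext; simp⟩) ⟨by
      intro M N h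
      exact Matrix.SpecialLinearGroup.toGL_injective (Subtype.ext_iff.1 h), by
      rintro ⟨g, hg⟩
      refine ⟨⟨g, ?_⟩, ?_⟩
      · have := congrArg Units.val (MonoidHom.mem_ker.1 hg)
        simpa using this
      · apply Subtype.ext; ext; rfl⟩
  rw [← Nat.card_congr e] at h1
  have hq : 1 < Nat.card K := Finite.one_lt_card
  have hq0 : 0 < Nat.card K - 1 := by omega
  apply Nat.eq_of_mul_eq_mul_right hq0
  rw [h1, sq]
  zify [show Nat.card K ≤ Nat.card K * Nat.card K by nlinarith,
    show 1 ≤ Nat.card K * Nat.card K by nlinarith, hq.le]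
  ring

theorem exists_char_and_card_eq_pow (K : Type*) [Field K] [Finite K] :
    ∃ p n, p.Prime ∧ CharP K p ∧ n ≠ 0 ∧ Nat.card K = p ^ n := by
  have := Fintype.ofFinite K
  obtain ⟨p, hp, n, hpp, hn⟩ := FiniteField.card' K
  exact ⟨p, n, hpp, hp, n.ne_zero, by rw [Nat.card_eq_fintype_card, hn]⟩

theorem card_orbit_mul_card_stabilizer {G X : Type*} [Group G] [MulAction G X] (x : X) :
    (MulAction.orbit G x).ncard * Nat.card (MulAction.stabilizer G x) = Nat.card G := by
  rw [← (MulAction.stabilizer G x).card_mul_index, MulAction.index_stabilizer, mul_comm]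

end Card

/-! ### Recognising the projective line -/

section Existence

/-- The natural action of `SL(2, F)` on column vectors. -/
abbrev slVecAction (F : Type*) [Field F] : MulAction SL(2, F) (Fin 2 → F) where
  smul M v := (M : Matrix (Fin 2) (Fin 2) F).mulVec v
  one_smul v := by change (1 : Matrix (Fin 2) (Fin 2) F).mulVec v = v; simp
  mul_smul M N v := by
    change ((M * N : SL(2, F)) : Matrix (Fin 2) (Fin 2) F).mulVec v =
      (M : Matrix (Fin 2) (Fin 2) F).mulVec ((N : Matrix (Fin 2) (Fin 2) F).mulVec v)
    rw [Matrix.SpecialLinearGroup.coe_mul, Matrix.mulVec_mulVec]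

variable {F : Type*} [Field F] [Finite F]

/-- The elements of `SL(2, q)` fixing a nonzero vector are transvections, so there are at most `q`.
-/
theorem card_setOf_fixing_le {e : Fin 2 → F} (he : e ≠ 0) :
    {M : SL(2, F) | (M : Matrix (Fin 2) (Fin 2) F).mulVec e = e}.ncard ≤ Nat.card F := by
  let f : F → SL(2, F) := fun t => ⟨planeTransvection e t, det_planeTransvection e t⟩
  have hsub : {M : SL(2, F) | (M : Matrix (Fin 2) (Fin 2) F).mulVec e = e} ⊆ f '' Set.univ := by
    intro M hM
    obtain ⟨t, ht⟩ := exists_eq_planeTransvection he M.2 hM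
    exact ⟨t, trivial, Subtype.ext ht.symm⟩
  refine (Set.ncard_le_ncard hsub (Set.toFinite _)).trans ?_
  exact (Set.ncard_image_le (Set.toFinite _)).trans (by rw [Set.ncard_univ])

/-- A subgroup of `SL(2, q)` of order `q (q - 1)` is the stabiliser of a line: it contains a Sylow
subgroup for the characteristic, which is the full stabiliser of a vector `e`, and if some element
moved the line of `e` then `e` would have at least `q` images instead of `q - 1`. -/
theorem exists_line_of_card_subgroup (p n : ℕ) [Fact p.Prime] (hq : Nat.card F = p ^ n)
    (hn : n ≠ 0) (H : Subgroup SL(2, F)) (hH : Nat.card H = Nat.card F * (Nat.card F - 1)) :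
    ∃ e : Fin 2 → F, e ≠ 0 ∧ ∀ M : SL(2, F),
      M ∈ H ↔ ∃ c : F, (M : Matrix (Fin 2) (Fin 2) F).mulVec e = c • e := by
  let _ := slVecAction F
  have hsm : ∀ (M : SL(2, F)) (v : Fin 2 → F),
    M • v = (M : Matrix (Fin 2) (Fin 2) F).mulVec v := fun _ _ => rfl
  have hq1 : 1 < Nat.card F := Finite.one_lt_card
  obtain ⟨V, hV⟩ := Sylow.exists_subgroup_card_pow_prime (G := H) p (n := n)
    (by rw [hH, hq]; exact Dvd.intro _ rfl)
  have hVp : IsPGroup p V := IsPGroup.of_card hV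
  have hfix0 : (0 : Fin 2 → F) ∈ MulAction.fixedPoints V (Fin 2 → F) := by
    intro u
    change ((u : H) : SL(2, F)) • (0 : Fin 2 → F) = 0
    rw [hsm, Matrix.mulVec_zero]
  obtain ⟨e, hfix, he⟩ := hVp.exists_fixed_point_of_prime_dvd_card_of_fixed_point (Fin 2 → F)
    (by rw [Nat.card_fun, hq]
        exact dvd_pow (dvd_pow_self p hn) (by simp)) hfix0
  have he : e ≠ 0 := he.symm
  refine ⟨e, he, ?_⟩
  set U : Subgroup SL(2, F) := V.map H.subtype with hU
  have hUcard : (U : Set SL(2, F)).ncard = Nat.card F := by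
    change Nat.card U = _
    rw [hU, ← Nat.card_congr (V.equivMapOfInjective H.subtype H.subtype_injective).toEquiv, hV, hq]
  have hUH : U ≤ H := by rw [hU]; exact Subgroup.map_subtype_le V
  have hUset : (U : Set SL(2, F)) =
      {M : SL(2, F) | (M : Matrix (Fin 2) (Fin 2) F).mulVec e = e} := by
    apply Set.eq_of_subset_of_ncard_le _ _ (Set.toFinite _)
    · rintro M ⟨u, hu, rfl⟩
      exact hfix ⟨u, hu⟩
    · rw [hUcard]; exact card_setOf_fixing_le he
  have hUmem : ∀ M : SL(2, F), M ∈ U ↔ (M : Matrix (Fin 2) (Fin 2) F).mulVec e = e := by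
    intro M
    exact Set.ext_iff.1 hUset M
  -- the orbit of `e` under `H` has `q - 1` elements
  have horb : Nat.card (MulAction.orbit H e) = Nat.card F - 1 := by
    have h1 := card_orbit_mul_card_stabilizer (G := H) e
    have h2 : Nat.card (MulAction.stabilizer H e) = Nat.card F := by
      rw [← hUcard]
      change _ = Nat.card U
      refine Nat.card_congr (Equiv.ofBijective
        (fun s => ⟨((s : H) : SL(2, F)), (hUmem _).2 s.2⟩) ⟨?_, ?_⟩)
      · intro a b hab
        have hab' := congrArg Subtype.val hab
        exact Subtype.ext (Subtype.ext hab')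
      · rintro ⟨M, hM⟩
        exact ⟨⟨⟨M, hUH hM⟩, (hUmem M).1 hM⟩, rfl⟩
    rw [h2, hH, mul_comm] at h1
    change (MulAction.orbit H e).ncard = _
    exact Nat.eq_of_mul_eq_mul_left (by omega) h1
  have hline : ∀ h ∈ H, ∃ c : F, (h : Matrix (Fin 2) (Fin 2) F).mulVec e = c • e := by
    intro h hh
    by_contra hne
    have hcross : planeCross e ((h : Matrix (Fin 2) (Fin 2) F).mulVec e) ≠ 0 := fun h0 =>
      hne (exists_smul_of_planeCross_eq_zero he h0)
    have hinj : Function.Injective (fun u : U =>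
        (⟨(u : SL(2, F)) • (h • e), ⟨⟨(u : SL(2, F)) * h, H.mul_mem (hUH u.2) hh⟩, by
          change ((u : SL(2, F)) * h) • e = _
          rw [mul_smul]⟩⟩ : MulAction.orbit H e)) := by
      intro a b hab
      have hab' : ((a : SL(2, F)) : Matrix (Fin 2) (Fin 2) F).mulVec
          ((h : Matrix (Fin 2) (Fin 2) F).mulVec e) = ((b : SL(2, F)) :
            Matrix (Fin 2) (Fin 2) F).mulVec ((h : Matrix (Fin 2) (Fin 2) F).mulVec e) :=
        Subtype.ext_iff.1 hab
      apply Subtype.ext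
      apply Subtype.ext
      exact matrix_eq_of_mulVec_eq hcross
        (((hUmem _).1 a.2).trans ((hUmem _).1 b.2).symm) hab'
    have := Nat.card_le_card_of_injective _ hinj
    rw [horb] at this
    have h3 : Nat.card U = Nat.card F := hUcard
    omega
  intro M
  refine ⟨hline M, ?_⟩
  rintro ⟨c, hc⟩
  have hc0 : c ≠ 0 := LineModel.eigenvalue_ne_zero he hc
  have hset : MulAction.orbit H e = (fun c : F => c • e) '' {0}ᶜ := by
    apply Set.eq_of_subset_of_ncard_le _ _ (Set.toFinite _)
    · rintro _ ⟨h, rfl⟩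
      obtain ⟨c, hc⟩ := hline h h.2
      exact ⟨c, LineModel.eigenvalue_ne_zero he hc, hc.symm⟩
    · refine (Set.ncard_image_le (Set.toFinite _)).trans ?_
      rw [Set.ncard_compl, Set.ncard_singleton]
      exact horb.ge
  have hmem : c • e ∈ MulAction.orbit H e := by rw [hset]; exact ⟨c, hc0, rfl⟩
  obtain ⟨h, hh⟩ := hmem
  have hh' : ((h : SL(2, F)) : SL(2, F)) • e = M • e := by
    rw [hsm M, hc]; exact hh
  have : (h : SL(2, F))⁻¹ * M ∈ U := by
    rw [hUmem, ← hsm, mul_smul, ← hh', inv_smul_smul]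
  have := H.mul_mem h.2 (hUH this)
  simpa using this

/-- A transitive action of `PSL(2, q)` on `q + 1` points is the action on the projective line. -/
theorem LineModel.nonempty_of_isPretransitive {G X : Type*} [Group G] [MulAction G X] [Finite X]
    [MulAction.IsPretransitive G X] (hX : Nat.card X = Nat.card F + 1)
    (π : SL(2, F) →* G) (hsurj : Function.Surjective π)
    (hker : ∀ M : SL(2, F), π M = 1 ↔
      ∃ c : F, (M : Matrix (Fin 2) (Fin 2) F) = c • (1 : Matrix (Fin 2) (Fin 2) F)) :
    Nonempty (LineModel F G X) := by
  have : Nonempty X := Finite.card_pos_iff.1 (by omega)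
  obtain ⟨x₀⟩ := this
  obtain ⟨p, n, hp, -, hn, hq⟩ := exists_char_and_card_eq_pow F
  have : Fact p.Prime := ⟨hp⟩
  set H : Subgroup SL(2, F) := (MulAction.stabilizer G x₀).comap π with hHdef
  have hHmem : ∀ M, M ∈ H ↔ π M • x₀ = x₀ := fun M => Iff.rfl
  have hq1 : 1 < Nat.card F := Finite.one_lt_card
  have hidx : H.index = Nat.card F + 1 := by
    rw [hHdef, Subgroup.index_comap_of_surjective _ hsurj, MulAction.index_stabilizer_of_transitive,
      hX]
  have hcard : Nat.card H = Nat.card F * (Nat.card F - 1) := by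
    have h1 := H.card_mul_index
    rw [hidx, card_SL_two] at h1
    apply Nat.eq_of_mul_eq_mul_right (show 0 < Nat.card F + 1 by omega)
    rw [h1, mul_assoc, mul_comm (Nat.card F - 1), ← Nat.sq_sub_sq, one_pow]
  obtain ⟨e, he, hmem⟩ := exists_line_of_card_subgroup p n hq hn H hcard
  have htrans : ∀ x : X, ∃ M : SL(2, F), π M • x₀ = x := by
    intro x
    obtain ⟨g, hg⟩ := MulAction.exists_smul_eq G x₀ x
    obtain ⟨M, rfl⟩ := hsurj g
    exact ⟨M, hg⟩
  choose T hT using htrans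
  have hrel : ∀ (M : SL(2, F)) (x y : X), π M • x = y → ∃ c : F,
      (M : Matrix (Fin 2) (Fin 2) F).mulVec ((T x : Matrix (Fin 2) (Fin 2) F).mulVec e) =
        c • (T y : Matrix (Fin 2) (Fin 2) F).mulVec e := by
    intro M x y hxy
    have h1 : (T y)⁻¹ * (M * T x) ∈ H := by
      rw [hHmem, map_mul, map_mul, map_inv, mul_smul, mul_smul, hT, hxy, inv_smul_eq_iff, hT]
    obtain ⟨c, hc⟩ := (hmem _).1 h1
    refine ⟨c, ?_⟩
    rw [← Matrix.mulVec_smul, ← hc, Matrix.mulVec_mulVec, Matrix.mulVec_mulVec,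
      ← Matrix.SpecialLinearGroup.coe_mul, ← Matrix.SpecialLinearGroup.coe_mul,
      mul_inv_cancel_left]
  refine ⟨⟨π, hsurj, hker, fun x => (T x : Matrix (Fin 2) (Fin 2) F).mulVec e, ?_, ?_, ?_⟩⟩
  · intro x h0
    apply he
    have := congrArg ((T x)⁻¹ : Matrix (Fin 2) (Fin 2) F).mulVec h0
    rw [Matrix.mulVec_mulVec, Matrix.nonsing_inv_mul _ (by simp [(T x).2])] at this
    simpa using this
  · intro M x
    exact hrel M x _ rfl
  · intro x y hxy h0
    have hne : (T x : Matrix (Fin 2) (Fin 2) F).mulVec e ≠ 0 := by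
      intro h0
      apply he
      have := congrArg ((T x)⁻¹ : Matrix (Fin 2) (Fin 2) F).mulVec h0
      rw [Matrix.mulVec_mulVec, Matrix.nonsing_inv_mul _ (by simp [(T x).2])] at this
      simpa using this
    obtain ⟨c, hc⟩ := exists_smul_of_planeCross_eq_zero hne h0
    apply hxy
    have h1 : (T x)⁻¹ * T y ∈ H := by
      rw [hmem]
      refine ⟨c, ?_⟩
      rw [Matrix.SpecialLinearGroup.coe_mul, ← Matrix.mulVec_mulVec, hc, Matrix.mulVec_smul,
        Matrix.mulVec_mulVec, ← Matrix.SpecialLinearGroup.coe_mul, inv_mul_cancel]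
      simp
    rw [hHmem, map_mul, map_inv, mul_smul, hT, inv_smul_eq_iff, hT] at h1
    exact h1.symm

end Existence

/-! ### Point stabilisers in subfield subgroups -/

/-- A `2 × 2` matrix without eigenvectors commutes only with the polynomials in it. -/
theorem exists_eq_add_smul_of_commute {K : Type*} [Field K] {M N : Matrix (Fin 2) (Fin 2) K}
    (hM : ∀ (v : Fin 2 → K) (c : K), v ≠ 0 → M.mulVec v ≠ c • v) (h : N * M = M * N) :
    ∃ a b : K, N = a • (1 : Matrix (Fin 2) (Fin 2) K) + b • M := by
  set v : Fin 2 → K := ![1, 0] with hv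
  have hv0 : v ≠ 0 := fun h0 => by simpa [hv] using congrFun h0 0
  have hc : planeCross v (M.mulVec v) ≠ 0 := fun h0 => by
    obtain ⟨c, hc⟩ := exists_smul_of_planeCross_eq_zero hv0 h0
    exact hM v c hv0 hc
  have he := eq_add_of_planeCross_ne_zero hc (N.mulVec v)
  set a := planeCross (N.mulVec v) (M.mulVec v) / planeCross v (M.mulVec v)
  set b := planeCross v (N.mulVec v) / planeCross v (M.mulVec v)
  have e1 : N.mulVec v = (a • (1 : Matrix (Fin 2) (Fin 2) K) + b • M).mulVec v := by
    rw [Matrix.add_mulVec, Matrix.smul_mulVec, Matrix.smul_mulVec, Matrix.one_mulVec]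
    exact he
  refine ⟨a, b, matrix_eq_of_mulVec_eq hc e1 ?_⟩
  rw [Matrix.mulVec_mulVec, h, ← Matrix.mulVec_mulVec, e1, Matrix.mulVec_mulVec,
    Matrix.mulVec_mulVec]
  congr 1
  simp [Matrix.mul_add, Matrix.add_mul]

theorem planeTransvection_smul {K : Type*} [Field K] (v : Fin 2 → K) (c t : K) :
    planeTransvection (c • v) t = planeTransvection v (t * c ^ 2) := by
  ext i j; fin_cases i <;> fin_cases j <;> simp [planeTransvection] <;> ring

theorem planeTransvection_ne_smul_one {K : Type*} [Field K] {v : Fin 2 → K} (hv : v ≠ 0) (c : K) :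
    planeTransvection v 1 ≠ c • (1 : Matrix (Fin 2) (Fin 2) K) := by
  intro h
  obtain ⟨w, hw⟩ := exists_planeCross_eq_one hv
  have h1 := congrArg (fun M : Matrix (Fin 2) (Fin 2) K => planeCross w (M.mulVec w)) h
  simp only [planeTransvection_mulVec, Matrix.smul_mulVec, Matrix.one_mulVec,
    planeCross_smul_right, planeCross_self, mul_zero] at h1
  rw [hw] at h1
  have : planeCross w v = 0 := by
    simp only [planeCross, Pi.add_apply, Pi.smul_apply, smul_eq_mul] at h1 ⊢
    linear_combination h1
  rw [planeCross_swap, hw] at this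
  simp at this

/-- A group of plane matrices over `K` containing `SL(2, K)`, together with a homomorphism to `G`
whose kernel consists of the scalar matrices. -/
structure PlaneCover (K : Type*) [Field K] (Γ G : Type*) [Group Γ] [Group G] where
  /-- the underlying matrix -/
  mat : Γ →* Matrix (Fin 2) (Fin 2) K
  mat_injective : Function.Injective mat
  exists_mat_eq : ∀ A : Matrix (Fin 2) (Fin 2) K, A.det = 1 → ∃ γ, mat γ = A
  /-- the homomorphism modulo scalars -/
  hom : Γ →* G
  hom_eq_one_iff : ∀ γ, hom γ = 1 ↔ ∃ c : K, mat γ = c • (1 : Matrix (Fin 2) (Fin 2) K)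

theorem isPGroup_zpowers_of_pow {G : Type*} [Group G] {p n : ℕ} {g : G} (hg : g ^ p ^ n = 1) :
    IsPGroup p (Subgroup.zpowers g) := by
  rintro ⟨_, k, rfl⟩
  refine ⟨n, Subtype.ext ?_⟩
  change (g ^ k) ^ p ^ n = 1
  rw [← zpow_natCast, ← zpow_mul, mul_comm, zpow_mul, zpow_natCast, hg, one_zpow]

theorem exists_fixed_of_pow_prime {G X : Type*} [Group G] [MulAction G X] (p : ℕ) [Fact p.Prime]
    (hX : ¬ p ∣ Nat.card X) {g : G} (hg : g ^ p = 1) : ∃ x : X, g • x = x := by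
  have hp : IsPGroup p (Subgroup.zpowers g) :=
    isPGroup_zpowers_of_pow (n := 1) (by rw [pow_one, hg])
  obtain ⟨x, hx⟩ := hp.nonempty_fixed_point_of_prime_not_dvd_card X hX
  exact ⟨x, hx ⟨g, Subgroup.mem_zpowers g⟩⟩

namespace PlaneCover

variable {K : Type*} [Field K] {Γ G : Type*} [Group Γ] [Group G]

theorem det_mat_ne_zero (P : PlaneCover K Γ G) (γ : Γ) : (P.mat γ).det ≠ 0 := by
  intro h
  have := congrArg Matrix.det (P.mat.map_mul γ γ⁻¹)
  rw [mul_inv_cancel, map_one, Matrix.det_mul, h] at this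
  simp at this

theorem mat_mulVec_ne_zero (P : PlaneCover K Γ G) (γ : Γ) {v : Fin 2 → K} (hv : v ≠ 0) :
    (P.mat γ).mulVec v ≠ 0 := by
  intro h
  exact P.det_mat_ne_zero γ (Matrix.exists_mulVec_eq_zero_iff.1 ⟨v, hv, h⟩)

variable {F X : Type*} [Field F] [MulAction G X]

/-- Sending a direction to the fixed point of its transvections embeds the projective line over `K`
equivariantly into `X`. -/
theorem exists_fixedPointMap (P : PlaneCover K Γ G) (m : LineModel F G X) (p : ℕ) [Fact p.Prime]
    [CharP F p] [CharP K p] (hX : ¬ p ∣ Nat.card X) :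
    ∃ f : (Fin 2 → K) → X, (∀ γ v, v ≠ 0 → P.hom γ • f v = f ((P.mat γ).mulVec v)) ∧
      (∀ v w, planeCross v w ≠ 0 → f v ≠ f w) ∧ ∀ v (c : K), v ≠ 0 → c ≠ 0 → f (c • v) = f v := by
  have ht : ∀ (v : Fin 2 → K) (t : K), ∃ γ, P.mat γ = planeTransvection v t := fun v t =>
    P.exists_mat_eq _ (det_planeTransvection v t)
  choose τ hτ using ht
  have hpow : ∀ v t, P.hom (τ v t) ^ p = 1 := by
    intro v t
    rw [← map_pow, P.hom_eq_one_iff]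
    exact ⟨1, by rw [map_pow, hτ, planeTransvection_pow, CharP.cast_eq_zero, zero_mul,
      planeTransvection_zero, one_smul]⟩
  have hne : ∀ v, v ≠ 0 → P.hom (τ v 1) ≠ 1 := by
    intro v hv h
    obtain ⟨c, hc⟩ := (P.hom_eq_one_iff _).1 h
    rw [hτ] at hc
    exact planeTransvection_ne_smul_one hv c hc
  choose f hf using fun v => exists_fixed_of_pow_prime (X := X) p hX (hpow v 1)
  have huniq : ∀ v x, v ≠ 0 → P.hom (τ v 1) • x = x → x = f v := by
    intro v x hv hx
    by_contra hxf
    exact hne v hv (m.eq_one_of_pow_char_of_two_fixed p (hpow v 1) hxf hx (hf v))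
  have hall : ∀ v t, v ≠ 0 → P.hom (τ v t) • f v = f v := by
    intro v t hv
    apply huniq v _ hv
    have hcomm : τ v 1 * τ v t = τ v t * τ v 1 := by
      apply P.mat_injective
      rw [map_mul, map_mul, hτ, hτ, planeTransvection_mul, planeTransvection_mul, add_comm]
    rw [← mul_smul, ← map_mul, hcomm, map_mul, mul_smul, hf]
  refine ⟨f, ?_, ?_, ?_⟩
  · intro γ v hv
    apply huniq _ _ (P.mat_mulVec_ne_zero γ hv)
    have hconj : τ ((P.mat γ).mulVec v) 1 * γ = γ * τ v (1 * (P.mat γ).det) := by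
      apply P.mat_injective
      rw [map_mul, map_mul, hτ, hτ, mul_planeTransvection]
    rw [← mul_smul, ← map_mul, hconj, map_mul, mul_smul, hall _ _ hv]
  · intro v w hvw h
    have h1 : P.hom (τ w 1) • f v = f v := by rw [h]; exact hf w
    have hcomm := m.commute_of_chr_eq_one
      (m.chr_eq_one_of_pow_char p (g := ⟨_, hf v⟩) (hpow v 1))
      (m.chr_eq_one_of_pow_char p (g := ⟨_, h1⟩) (hpow w 1))
    change P.hom (τ v 1) * P.hom (τ w 1) = P.hom (τ w 1) * P.hom (τ v 1) at hcomm
    have h2 : P.hom ((τ w 1 * τ v 1)⁻¹ * (τ v 1 * τ w 1)) = 1 := by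
      rw [map_mul, map_inv, map_mul, map_mul, hcomm, inv_mul_cancel]
    obtain ⟨c, hc⟩ := (P.hom_eq_one_iff _).1 h2
    -- transvections in independent directions do not commute, not even modulo scalars
    have h3 : P.mat (τ v 1 * τ w 1) = c • P.mat (τ w 1 * τ v 1) := by
      have : τ v 1 * τ w 1 = (τ w 1 * τ v 1) * ((τ w 1 * τ v 1)⁻¹ * (τ v 1 * τ w 1)) := by group
      rw [this, map_mul _ (τ w 1 * τ v 1), hc]; simp
    have h4 := congrArg (fun M => M.mulVec v) h3
    simp only [map_mul, hτ, Matrix.smul_mulVec, ← Matrix.mulVec_mulVec, planeTransvection_mulVec,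
      planeCross_self, mul_zero, zero_smul, add_zero, one_mul] at h4
    -- the two components of `h4` in the basis `v`, `w`
    have h5 := congrArg (fun z => planeCross v z) h4
    have h6 := congrArg (fun z => planeCross z w) h4
    simp only [planeCross, Pi.add_apply, Pi.smul_apply, smul_eq_mul] at h5 h6 hvw
    set D := v 0 * w 1 - v 1 * w 0 with hD
    have h7 : D * D * (c - 1) = 0 := by rw [hD]; linear_combination h5
    have h8 : c = 1 := by
      rcases mul_eq_zero.1 h7 with h | h
      · exact absurd h (mul_ne_zero hvw hvw)
      · exact sub_eq_zero.1 h
    have h9 : D * D * D = 0 := by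
      rw [hD]; rw [h8] at h6; linear_combination -h6
    exact mul_ne_zero (mul_ne_zero hvw hvw) hvw h9
  · intro v c hv hc
    symm
    apply huniq _ _ (smul_ne_zero hc hv)
    have : τ (c • v) 1 = τ v (1 * c ^ 2) := by
      apply P.mat_injective
      rw [hτ, hτ, planeTransvection_smul]
    rw [this, hall _ _ hv]

/-- Let `f` embed the projective line over `K` equivariantly into `X`. An element with an
eigenvector over `K` that fixes a point outside the image of `f` acts trivially: if it is not a
transvection up to scalars, it has two eigenlines over `K` and hence three fixed points. -/
theorem hom_eq_one_of_eigenvector (P : PlaneCover K Γ G) (m : LineModel F G X) (p : ℕ)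
    [Fact p.Prime] [CharP F p] [CharP K p] {f : (Fin 2 → K) → X}
    (hf : ∀ γ v, v ≠ 0 → P.hom γ • f v = f ((P.mat γ).mulVec v))
    (hinj : ∀ v w, planeCross v w ≠ 0 → f v ≠ f w)
    (hsmul : ∀ v (c : K), v ≠ 0 → c ≠ 0 → f (c • v) = f v) {x : X} (hx : ∀ v, v ≠ 0 → x ≠ f v)
    {γ : Γ} (hγ : P.hom γ • x = x) {v : Fin 2 → K} {c : K} (hv : v ≠ 0)
    (hvc : (P.mat γ).mulVec v = c • v) : P.hom γ = 1 := by
  have hfix : ∀ (w : Fin 2 → K) (d : K), w ≠ 0 → (P.mat γ).mulVec w = d • w →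
      P.hom γ • f w = f w := by
    intro w d hw hd
    rw [hf γ w hw, hd, hsmul w d hw]
    rintro rfl
    exact P.mat_mulVec_ne_zero γ hw (by rw [hd, zero_smul])
  have hc0 : c ≠ 0 := by
    rintro rfl
    exact P.mat_mulVec_ne_zero γ hv (by rw [hvc, zero_smul])
  obtain ⟨w, hw⟩ := exists_planeCross_eq_one hv
  have he := eq_add_of_planeCross_ne_zero (by rw [hw]; exact one_ne_zero)
    ((P.mat γ).mulVec w)
  rw [hw, div_one, div_one] at he
  set r := planeCross ((P.mat γ).mulVec w) w
  set s := planeCross v ((P.mat γ).mulVec w)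
  by_cases hsc : s = c
  · have hM : P.mat γ = c • planeTransvection v (r / c) := by
      refine matrix_eq_of_mulVec_eq (v := v) (w := w) (by rw [hw]; exact one_ne_zero) ?_ ?_
      · rw [hvc, Matrix.smul_mulVec, planeTransvection_mulVec, planeCross_self]; simp
      · rw [he, Matrix.smul_mulVec, planeTransvection_mulVec, hw, mul_one, smul_add, smul_smul,
          mul_div_cancel₀ _ hc0, hsc, add_comm]
    refine m.eq_one_of_pow_char_of_two_fixed p ?_ (hx v hv) hγ (hfix v c hv hvc)
    rw [← map_pow, P.hom_eq_one_iff]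
    exact ⟨c ^ p, by rw [map_pow, hM, smul_pow, planeTransvection_pow, CharP.cast_eq_zero,
      zero_mul, planeTransvection_zero]⟩
  · have hsc' : s - c ≠ 0 := sub_ne_zero.2 hsc
    set w' := w + (r / (s - c)) • v with hw'
    have hcr : planeCross v w' = 1 := by
      rw [← hw, hw']; simp only [planeCross, Pi.add_apply, Pi.smul_apply, smul_eq_mul]; ring
    have hcr' : planeCross v w' ≠ 0 := by rw [hcr]; exact one_ne_zero
    have hw0 := planeCross_right_ne_zero hcr'
    have hws : (P.mat γ).mulVec w' = s • w' := by
      rw [hw', Matrix.mulVec_add, Matrix.mulVec_smul, he, hvc]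
      ext i
      simp only [Pi.add_apply, Pi.smul_apply, smul_eq_mul]
      field_simp; ring
    exact m.eq_one_of_three_fixed (hx v hv) (hinj v w' hcr') (hx w' hw0) hγ (hfix v c hv hvc)
      (hfix w' s hw0 hws)

/-- The image of the projective line over `K` in `X` is a single orbit. -/
theorem ncard_orbit_of_mem_line (P : PlaneCover K Γ G) [Finite K] {f : (Fin 2 → K) → X}
    (hf : ∀ γ v, v ≠ 0 → P.hom γ • f v = f ((P.mat γ).mulVec v))
    (hinj : ∀ v w, planeCross v w ≠ 0 → f v ≠ f w)
    (hsmul : ∀ v (c : K), v ≠ 0 → c ≠ 0 → f (c • v) = f v) {v : Fin 2 → K} (hv : v ≠ 0) :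
    (Set.range fun γ => P.hom γ • f v).ncard = Nat.card K + 1 := by
  have h1 : (Set.range fun γ => P.hom γ • f v) =
      (fun l : Projectivization K (Fin 2 → K) => f l.rep) '' Set.univ := by
    ext x
    constructor
    · rintro ⟨γ, rfl⟩
      have hne := P.mat_mulVec_ne_zero γ hv
      refine ⟨Projectivization.mk K _ hne, trivial, ?_⟩
      obtain ⟨a, ha⟩ := Projectivization.exists_smul_eq_mk_rep K _ hne
      simp only
      rw [hf γ v hv, ← ha]
      exact hsmul _ _ hne a.ne_zero
    · rintro ⟨l, -, rfl⟩
      obtain ⟨A, hA, hAv⟩ := exists_det_one_mulVec_eq hv l.rep_nonzero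
      obtain ⟨γ, hγ⟩ := P.exists_mat_eq A hA
      exact ⟨γ, by simp only; rw [hf γ v hv, hγ, hAv]⟩
  rw [h1, Set.ncard_image_of_injective, Set.ncard_univ, Projectivization.card_of_finrank_two]
  · simp
  · intro l l' hll
    by_contra hne
    refine hinj l.rep l'.rep (fun h0 => hne ?_) hll
    obtain ⟨c, hc⟩ := exists_smul_of_planeCross_eq_zero l.rep_nonzero h0
    rw [← l.mk_rep, ← l'.mk_rep, eq_comm]
    rw [Projectivization.mk_eq_mk_iff']
    exact ⟨c, hc.symm⟩

/-- The points of `X` are of three kinds for a subfield subgroup: those on the projective line over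
`K`, those in regular orbits, and those whose stabiliser is a maximal nonsplit torus, consisting of
the polynomials in a matrix without eigenvectors. -/
theorem stabilizer_trichotomy (P : PlaneCover K Γ G) (m : LineModel F G X) (p : ℕ) [Fact p.Prime]
    [CharP F p] [CharP K p] [Finite K] [Finite Γ] (hX : ¬ p ∣ Nat.card X) (x : X) :
    (Set.range fun γ => P.hom γ • x).ncard = Nat.card K + 1 ∨
    (∀ γ, P.hom γ • x = x → P.hom γ = 1) ∨
    ∃ γ₀, (∀ (v : Fin 2 → K) (c : K), v ≠ 0 → (P.mat γ₀).mulVec v ≠ c • v) ∧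
      ∀ γ, P.hom γ • x = x ↔
        ∃ a b : K, P.mat γ = a • (1 : Matrix (Fin 2) (Fin 2) K) + b • P.mat γ₀ := by
  obtain ⟨f, hf, hinj, hsmul⟩ := P.exists_fixedPointMap m p hX
  by_cases hx : ∃ v, v ≠ 0 ∧ x = f v
  · obtain ⟨v, hv, rfl⟩ := hx
    exact Or.inl (P.ncard_orbit_of_mem_line hf hinj hsmul hv)
  right
  push Not at hx
  have heig : ∀ γ, P.hom γ • x = x → ∀ (v : Fin 2 → K) (c : K), v ≠ 0 →
      (P.mat γ).mulVec v = c • v → P.hom γ = 1 := fun γ hγ v c hv hvc =>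
    P.hom_eq_one_of_eigenvector m p hf hinj hsmul hx hγ hv hvc
  -- an element of order `p` is a transvection up to scalars, since scalars have `p`-th roots in `K`
  have hppow : ∀ γ, P.hom γ • x = x → P.hom γ ^ p = 1 → P.hom γ = 1 := by
    intro γ hγ hp
    rw [← map_pow, P.hom_eq_one_iff, map_pow] at hp
    obtain ⟨s, hs⟩ := hp
    obtain ⟨r, hr⟩ : ∃ r : K, r ^ p = s := by
      have := bijective_frobenius K p
      exact this.2 s
    have hpow : (P.mat γ - r • (1 : Matrix (Fin 2) (Fin 2) K)) ^ p = 0 := by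
      rw [sub_pow_char_of_commute, hs, smul_pow, one_pow, hr, sub_self]
      exact (Commute.one_right _).smul_right r
    have hdet : (P.mat γ - r • (1 : Matrix (Fin 2) (Fin 2) K)).det = 0 := by
      have := congrArg Matrix.det hpow
      rw [Matrix.det_pow, Matrix.det_zero] at this
      exact pow_eq_zero_iff (Fact.out : p.Prime).ne_zero |>.1 this
    obtain ⟨v, hv, hv0⟩ := Matrix.exists_mulVec_eq_zero_iff.2 hdet
    refine heig γ hγ v r hv ?_
    rw [Matrix.sub_mulVec, Matrix.smul_mulVec, Matrix.one_mulVec, sub_eq_zero] at hv0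
    exact hv0
  set A : Subgroup (MulAction.stabilizer G x) := (P.hom.range).subgroupOf _ with hA
  have hfinR : Finite P.hom.range := Finite.of_surjective _ P.hom.rangeRestrict_surjective
  have hfinA : Finite A := Finite.of_injective
    (fun a : A => (⟨((a : MulAction.stabilizer G x) : G), a.2⟩ : P.hom.range)) (by
      intro a b hab
      have h := congrArg Subtype.val hab
      exact Subtype.ext (Subtype.ext h))
  -- the eigenvalue character embeds the stabiliser into the multiplicative group of `F`
  have hcyc : IsCyclic A := by
    refine isCyclic_of_injective_ringHom ((m.chr x).comp A.subtype) ?_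
    rw [injective_iff_map_eq_one]
    rintro ⟨⟨g, hg⟩, γ, hγ⟩ ha
    change P.hom γ = g at hγ
    subst hγ
    have h1 := m.pow_char_eq_one_of_chr_eq_one p (x := x) (g := ⟨P.hom γ, hg⟩) ha
    exact Subtype.ext (Subtype.ext (hppow γ hg h1))
  obtain ⟨⟨⟨g₀, hg₀⟩, γ₀, hγ₀⟩, hgen⟩ := hcyc.exists_generator
  change P.hom γ₀ = g₀ at hγ₀
  subst hγ₀
  have hgen' : ∀ γ, P.hom γ • x = x → ∃ i : ℤ, P.hom γ = P.hom γ₀ ^ i := by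
    intro γ hγ
    obtain ⟨i, hi⟩ := hgen ⟨⟨P.hom γ, hγ⟩, γ, rfl⟩
    have h := congrArg (fun a : A => ((a : MulAction.stabilizer G x) : G)) hi
    exact ⟨i, by simpa using h.symm⟩
  by_cases h1 : P.hom γ₀ = 1
  · left
    intro γ hγ
    obtain ⟨i, hi⟩ := hgen' γ hγ
    rw [hi, h1, one_zpow]
  right
  have hno : ∀ (v : Fin 2 → K) (c : K), v ≠ 0 → (P.mat γ₀).mulVec v ≠ c • v :=
    fun v c hv hvc => h1 (heig γ₀ hg₀ v c hv hvc)
  refine ⟨γ₀, hno, fun γ => ⟨fun hγ => ?_, ?_⟩⟩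
  · apply exists_eq_add_smul_of_commute hno
    obtain ⟨i, hi⟩ := hgen' γ hγ
    have h2 : P.hom ((γ₀ ^ i)⁻¹ * γ) = 1 := by
      rw [map_mul, map_inv, map_zpow, hi, inv_mul_cancel]
    obtain ⟨c, hc⟩ := (P.hom_eq_one_iff _).1 h2
    have h3 : P.mat γ = c • P.mat (γ₀ ^ i) := by
      rw [show γ = γ₀ ^ i * ((γ₀ ^ i)⁻¹ * γ) by group, map_mul, hc]
      simp
    rw [h3, Matrix.smul_mul, Matrix.mul_smul, ← map_mul, ← map_mul]
    congr 2
    exact ((Commute.refl γ₀).zpow_left i).eq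
  · rintro ⟨a, b, hab⟩
    by_contra hne
    -- `γ` commutes with `γ₀`, so it interchanges the two fixed points of `γ₀`
    have hcomm : γ₀ * γ = γ * γ₀ := by
      apply P.mat_injective
      rw [map_mul, map_mul, hab]
      simp [Matrix.mul_add, Matrix.add_mul]
    have hfix : ∀ y : X, P.hom γ₀ • y = y → P.hom γ₀ • (P.hom γ • y) = P.hom γ • y := by
      intro y hy
      rw [← mul_smul, ← map_mul, hcomm, map_mul, mul_smul, hy]
    have hy := hfix x hg₀
    have hz := hfix _ hy
    have hswap : P.hom γ • P.hom γ • x = x := by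
      by_contra hzx
      refine h1 (m.eq_one_of_three_fixed (Ne.symm hne) ?_ (Ne.symm hzx) hg₀ hy hz)
      intro h
      exact hne (smul_left_cancel _ h).symm
    have e1 := m.sq_eq_one_of_swap (Ne.symm hne) rfl hswap
    have e2 : P.hom (γ * γ₀) * P.hom (γ * γ₀) = 1 := by
      refine m.sq_eq_one_of_swap (Ne.symm hne) (y := P.hom γ • x) ?_ ?_
      · rw [map_mul, mul_smul, hg₀]
      · rw [map_mul, mul_smul, hy, hswap]
    have e3 : P.hom (γ₀ * γ₀) = 1 := by
      rw [← map_mul] at e1 e2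
      have : γ * γ₀ * (γ * γ₀) = (γ * γ) * (γ₀ * γ₀) := by
        rw [mul_assoc, ← mul_assoc γ₀, hcomm]; group
      rwa [this, map_mul, e1, one_mul] at e2
    -- now `γ ^ 2` and `γ₀ ^ 2` are scalar, which forces `2 * a * b = 0`
    rw [← map_mul] at e1
    obtain ⟨s, hs⟩ := (P.hom_eq_one_iff _).1 e1
    obtain ⟨t, ht⟩ := (P.hom_eq_one_iff _).1 e3
    rw [map_mul] at hs ht
    have hindep : ∀ r s : K, r • P.mat γ₀ = s • (1 : Matrix (Fin 2) (Fin 2) K) → r = 0 := by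
      intro r s hrs
      by_contra hr
      have hv : (![1, 0] : Fin 2 → K) ≠ 0 := fun h0 => by simpa using congrFun h0 0
      refine hno ![1, 0] (r⁻¹ * s) hv ?_
      have := congrArg (fun M => r⁻¹ • M.mulVec ![1, 0]) hrs
      simp only [Matrix.smul_mulVec, Matrix.one_mulVec, smul_smul, inv_mul_cancel₀ hr] at this
      rwa [one_smul] at this
    have hab2 : (2 * a * b) = 0 := by
      apply hindep (2 * a * b) (s - a ^ 2 - b ^ 2 * t)
      rw [hab] at hs
      simp only [Matrix.add_mul, Matrix.mul_add, Matrix.smul_mul, Matrix.mul_smul, one_mul,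
        mul_one, ht] at hs
      have : (s - a ^ 2 - b ^ 2 * t) • (1 : Matrix (Fin 2) (Fin 2) K) =
        s • (1 : Matrix (Fin 2) (Fin 2) K) - a ^ 2 • (1 : Matrix (Fin 2) (Fin 2) K)
          - (b ^ 2 * t) • (1 : Matrix (Fin 2) (Fin 2) K) := by simp [sub_smul]
      rw [this, ← hs]
      module
    have hb : b ≠ 0 := by
      rintro rfl
      apply hne
      rw [(P.hom_eq_one_iff γ).2 ⟨a, by rw [hab, zero_smul, add_zero]⟩, one_smul]
    have ha : a ≠ 0 := by
      rintro rfl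
      apply hne
      have h2 : P.hom (γ * γ₀) = 1 := by
        rw [P.hom_eq_one_iff]
        exact ⟨b * t, by rw [map_mul, hab, zero_smul, zero_add, Matrix.smul_mul, ht, smul_smul]⟩
      have h3 : P.hom γ • x = P.hom (γ * γ₀) • x := by rw [map_mul, mul_smul, hg₀]
      rw [h3, h2, one_smul]
    have h2 : (2 : K) = 0 := by
      rcases mul_eq_zero.1 hab2 with h | h
      · exact (mul_eq_zero.1 h).resolve_right ha
      · exact absurd h hb
    -- in characteristic two `γ₀` would be an involution, which is a transvection up to scalars
    have hp2 : p = 2 := by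
      have : p ∣ 2 := by
        rw [← CharP.cast_eq_zero_iff K p]; exact_mod_cast h2
      exact (Nat.prime_dvd_prime_iff_eq Fact.out Nat.prime_two).1 this
    apply h1
    apply hppow γ₀ hg₀
    rw [hp2, sq, ← map_mul, e3]

end PlaneCover

/-! ### Nonsplit tori and orbit lengths -/

section Torus

variable {K : Type*} [Field K] {M : Matrix (Fin 2) (Fin 2) K}

theorem det_add_smul (a b : K) (M : Matrix (Fin 2) (Fin 2) K) :
    (a • (1 : Matrix (Fin 2) (Fin 2) K) + b • M).det =
      a ^ 2 + a * b * M.trace + b ^ 2 * M.det := by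
  simp [Matrix.det_fin_two, Matrix.trace_fin_two]; ring

/-- The algebra `K[M]` generated by a matrix without eigenvectors is a field. -/
theorem det_add_smul_ne_zero (hM : ∀ (v : Fin 2 → K) (c : K), v ≠ 0 → M.mulVec v ≠ c • v)
    {a b : K} (hab : (a, b) ≠ 0) : (a • (1 : Matrix (Fin 2) (Fin 2) K) + b • M).det ≠ 0 := by
  intro h
  obtain ⟨v, hv, hv0⟩ := Matrix.exists_mulVec_eq_zero_iff.2 h
  rw [Matrix.add_mulVec, Matrix.smul_mulVec, Matrix.smul_mulVec, Matrix.one_mulVec] at hv0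
  by_cases hb : b = 0
  · rw [hb, zero_smul, add_zero] at hv0
    exact hab (by rw [hb, (smul_eq_zero.1 hv0).resolve_right hv]; rfl)
  · refine hM v (-(a / b)) hv ?_
    have : b • M.mulVec v = -(a • v) := by rw [eq_neg_iff_add_eq_zero, add_comm, hv0]
    rw [← one_smul K (M.mulVec v), ← inv_mul_cancel₀ hb, mul_smul, this, smul_neg, smul_smul,
      neg_smul, div_eq_inv_mul]

theorem add_smul_injective (hM : ∀ (v : Fin 2 → K) (c : K), v ≠ 0 → M.mulVec v ≠ c • v)
    {a b a' b' : K} (h : a • (1 : Matrix (Fin 2) (Fin 2) K) + b • M =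
      a' • (1 : Matrix (Fin 2) (Fin 2) K) + b' • M) : (a, b) = (a', b') := by
  by_contra hne
  have h0 : (a - a', b - b') ≠ 0 := by
    intro h0
    have h1 := congrArg Prod.fst h0
    have h2 := congrArg Prod.snd h0
    exact hne (Prod.ext (sub_eq_zero.1 h1) (sub_eq_zero.1 h2))
  apply det_add_smul_ne_zero hM h0
  have : (a - a') • (1 : Matrix (Fin 2) (Fin 2) K) + (b - b') • M = 0 := by
    rw [sub_smul, sub_smul, ← sub_eq_zero.2 h]; abel
  rw [this, Matrix.det_zero]

variable [Finite K]

/-- The norm form of the quadratic extension `K[M]` represents every element: it is a binary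
quadratic form over a finite field. -/
theorem exists_det_add_smul_eq (hM : ∀ (v : Fin 2 → K) (c : K), v ≠ 0 → M.mulVec v ≠ c • v)
    (c : K) : ∃ a b : K, (a • (1 : Matrix (Fin 2) (Fin 2) K) + b • M).det = c := by
  have := Fintype.ofFinite K
  by_cases h2 : ringChar K = 2
  · obtain ⟨a, ha⟩ := FiniteField.isSquare_of_char_two h2 c
    exact ⟨a, 0, by rw [det_add_smul, ha]; ring⟩
  · have h20 : (2 : K) ≠ 0 := Ring.two_ne_zero h2
    set δ : K := M.det - (M.trace / 2) ^ 2 with hδ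
    have hδ0 : δ ≠ 0 := by
      have := det_add_smul_ne_zero hM (a := -(M.trace / 2)) (b := 1)
        (fun h => one_ne_zero (congrArg Prod.snd h))
      rw [det_add_smul] at this
      intro h0
      apply this
      rw [← h0, hδ]; field_simp; ring
    obtain ⟨y, b, hyb⟩ := FiniteField.exists_root_sum_quadratic (R := K)
      (f := Polynomial.C 1 * Polynomial.X ^ 2 + Polynomial.C 0 * Polynomial.X + Polynomial.C (-c))
      (g := Polynomial.C δ * Polynomial.X ^ 2 + Polynomial.C 0 * Polynomial.X + Polynomial.C 0)
      (Polynomial.degree_quadratic one_ne_zero) (Polynomial.degree_quadratic hδ0)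
      (FiniteField.odd_card_of_char_ne_two h2)
    refine ⟨y - b * (M.trace / 2), b, ?_⟩
    rw [det_add_smul]
    simp only [Polynomial.eval_add, Polynomial.eval_mul, Polynomial.eval_C, Polynomial.eval_pow,
      Polynomial.eval_X, hδ] at hyb
    field_simp at hyb ⊢
    linear_combination hyb

theorem card_GL_torus (hM : ∀ (v : Fin 2 → K) (c : K), v ≠ 0 → M.mulVec v ≠ c • v) :
    Nat.card {g : GL (Fin 2) K // ∃ a b : K, (g : Matrix (Fin 2) (Fin 2) K) =
      a • (1 : Matrix (Fin 2) (Fin 2) K) + b • M} = Nat.card K ^ 2 - 1 := by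
  have h1 : Nat.card {ab : K × K // ab ≠ 0} = Nat.card K ^ 2 - 1 := by
    have : ({0}ᶜ : Set (K × K)).ncard = _ := Set.ncard_compl {0}
    rw [Set.ncard_singleton, Nat.card_prod, ← sq] at this
    exact this
  rw [← h1]
  refine (Nat.card_congr (Equiv.ofBijective (fun ab : {ab : K × K // ab ≠ 0} =>
    (⟨Matrix.GeneralLinearGroup.mkOfDetNeZero _ (det_add_smul_ne_zero hM ab.2), ab.1.1, ab.1.2,
      rfl⟩ : {g : GL (Fin 2) K // ∃ a b : K, (g : Matrix (Fin 2) (Fin 2) K) =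
      a • (1 : Matrix (Fin 2) (Fin 2) K) + b • M})) ⟨?_, ?_⟩)).symm
  · intro ab cd h
    have h' := congrArg (fun g => ((g.1 : GL (Fin 2) K) : Matrix (Fin 2) (Fin 2) K)) h
    exact Subtype.ext (add_smul_injective hM h')
  · rintro ⟨g, a, b, hg⟩
    refine ⟨⟨(a, b), fun h => ?_⟩, ?_⟩
    · have ha : a = 0 := congrArg Prod.fst h
      have hb : b = 0 := congrArg Prod.snd h
      have hdet : (g : Matrix (Fin 2) (Fin 2) K).det ≠ 0 := g.det_ne_zero
      rw [hg, ha, hb] at hdet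
      simp at hdet
    · apply Subtype.ext
      apply Units.ext
      exact hg.symm

/-- A maximal nonsplit torus of `SL(2, q)` is the kernel of the norm map on `K[M]ˣ`, which is onto.
-/
theorem card_SL_torus (hM : ∀ (v : Fin 2 → K) (c : K), v ≠ 0 → M.mulVec v ≠ c • v) :
    Nat.card {g : SL(2, K) // ∃ a b : K, (g : Matrix (Fin 2) (Fin 2) K) =
      a • (1 : Matrix (Fin 2) (Fin 2) K) + b • M} = Nat.card K + 1 := by
  have hdet : M.det ≠ 0 := by
    have := det_add_smul_ne_zero hM (a := 0) (b := 1)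
        (fun h => one_ne_zero (congrArg Prod.snd h))
    simpa using this
  set u : GL (Fin 2) K := Matrix.GeneralLinearGroup.mkOfDetNeZero M hdet with hu
  have huM : (u : Matrix (Fin 2) (Fin 2) K) = M := rfl
  set T : Subgroup (GL (Fin 2) K) := Subgroup.centralizer {u} with hT
  have hTmem : ∀ g : GL (Fin 2) K, g ∈ T ↔ ∃ a b : K, (g : Matrix (Fin 2) (Fin 2) K) =
      a • (1 : Matrix (Fin 2) (Fin 2) K) + b • M := by
    intro g
    rw [hT, Subgroup.mem_centralizer_singleton_iff]
    constructor
    · intro h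
      apply exists_eq_add_smul_of_commute hM
      have := congrArg (fun z : GL (Fin 2) K => (z : Matrix (Fin 2) (Fin 2) K)) h
      simpa [huM] using this
    · rintro ⟨a, b, hab⟩
      apply Units.ext
      rw [Units.val_mul, Units.val_mul, hab, huM]
      simp [Matrix.mul_add, Matrix.add_mul]
  set d : T →* Kˣ := Matrix.GeneralLinearGroup.det.comp T.subtype with hd
  have hsurj : Function.Surjective d := by
    intro c
    obtain ⟨a, b, hab⟩ := exists_det_add_smul_eq hM (c : K)
    have h0 : (a • (1 : Matrix (Fin 2) (Fin 2) K) + b • M).det ≠ 0 := by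
      rw [hab]; exact c.ne_zero
    refine ⟨⟨Matrix.GeneralLinearGroup.mkOfDetNeZero _ h0, (hTmem _).2 ⟨a, b, rfl⟩⟩, ?_⟩
    ext
    exact hab
  have h1 := d.ker.card_mul_index
  rw [Subgroup.index_ker, MonoidHom.range_eq_top.2 hsurj, Subgroup.card_top, Nat.card_units] at h1
  have h2 : Nat.card T = Nat.card K ^ 2 - 1 := by
    rw [← card_GL_torus hM]
    exact Nat.card_congr (Equiv.subtypeEquivRight hTmem)
  rw [h2] at h1
  have hq : 1 < Nat.card K := Finite.one_lt_card
  have h3 : Nat.card d.ker = Nat.card K + 1 := by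
    apply Nat.eq_of_mul_eq_mul_right (show 0 < Nat.card K - 1 by omega)
    rw [h1, ← Nat.sq_sub_sq, one_pow]
  rw [← h3]
  refine Nat.card_congr (Equiv.ofBijective (fun g => ⟨⟨Matrix.SpecialLinearGroup.toGL g.1,
    (hTmem _).2 g.2⟩, ?_⟩) ⟨?_, ?_⟩)
  · rw [MonoidHom.mem_ker]
    ext
    exact g.1.2
  · intro g h hgh
    have h' := congrArg (fun z : d.ker => ((z : T) : GL (Fin 2) K)) hgh
    exact Subtype.ext (Matrix.SpecialLinearGroup.toGL_injective h')
  · rintro ⟨⟨g, hg⟩, hk⟩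
    have hk' := congrArg Units.val (MonoidHom.mem_ker.1 hk)
    refine ⟨⟨⟨(g : Matrix (Fin 2) (Fin 2) K), hk'⟩, (hTmem g).1 hg⟩, ?_⟩
    apply Subtype.ext
    apply Subtype.ext
    ext
    rfl

end Torus

namespace PlaneCover

variable {K F : Type*} [Field K] [Field F] {Γ G X : Type*} [Group Γ] [Group G]
  [MulAction G X]

theorem ncard_orbit_mul_card (P : PlaneCover K Γ G) (x : X) :
    (Set.range fun γ => P.hom γ • x).ncard * Nat.card {γ // P.hom γ • x = x} = Nat.card Γ := by
  let _ : MulAction Γ X := MulAction.compHom X P.hom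
  exact card_orbit_mul_card_stabilizer (G := Γ) x

theorem ncard_orbit_of_stabilizer_trivial (P : PlaneCover K Γ G) (x : X)
    (h : ∀ γ, P.hom γ • x = x → P.hom γ = 1) :
    (Set.range fun γ => P.hom γ • x).ncard = Nat.card P.hom.range := by
  have h1 := card_orbit_mul_card_stabilizer (G := P.hom.range) x
  have h2 : MulAction.stabilizer P.hom.range x = ⊥ := by
    rw [eq_bot_iff]
    rintro ⟨_, γ, rfl⟩ hγ
    exact Subgroup.mem_bot.2 (Subtype.ext (h γ hγ))
  rw [h2, Subgroup.card_bot, mul_one] at h1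
  rw [← h1]
  congr 1
  ext y
  constructor
  · rintro ⟨γ, rfl⟩; exact ⟨⟨_, γ, rfl⟩, rfl⟩
  · rintro ⟨⟨_, γ, rfl⟩, rfl⟩; exact ⟨γ, rfl⟩

variable [Finite K]

/-- The orbit lengths of a subfield subgroup `PSL(2, K)` of `PSL(2, F)` on the projective line
over `F`. -/
theorem ncard_orbit_SL (P : PlaneCover K SL(2, K) G)
    (hP : ∀ γ, P.mat γ = (γ : Matrix (Fin 2) (Fin 2) K)) (m : LineModel F G X) (p : ℕ)
    [Fact p.Prime] [CharP F p] [CharP K p] (hX : ¬ p ∣ Nat.card X) (x : X) :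
    (Set.range fun γ => P.hom γ • x).ncard = Nat.card K + 1 ∨
    (Set.range fun γ => P.hom γ • x).ncard = Nat.card P.hom.range ∨
    (Set.range fun γ => P.hom γ • x).ncard * (Nat.card K + 1) = Nat.card SL(2, K) := by
  rcases P.stabilizer_trichotomy m p hX x with h | h | ⟨γ₀, h0, h⟩
  · exact Or.inl h
  · exact Or.inr (Or.inl (P.ncard_orbit_of_stabilizer_trivial x h))
  · right; right
    rw [← P.ncard_orbit_mul_card x, ← card_SL_torus h0]
    congr 1
    refine (Nat.card_congr (Equiv.subtypeEquivRight fun γ => ?_)).symm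
    rw [h γ, hP γ]

/-- The orbit lengths of a subfield subgroup `PGL(2, K)` of `PSL(2, F)` on the projective line
over `F`. -/
theorem ncard_orbit_GL (P : PlaneCover K (GL (Fin 2) K) G)
    (hP : ∀ γ, P.mat γ = (γ : Matrix (Fin 2) (Fin 2) K)) (m : LineModel F G X) (p : ℕ)
    [Fact p.Prime] [CharP F p] [CharP K p] (hX : ¬ p ∣ Nat.card X) (x : X) :
    (Set.range fun γ => P.hom γ • x).ncard = Nat.card K + 1 ∨
    (Set.range fun γ => P.hom γ • x).ncard = Nat.card P.hom.range ∨
    (Set.range fun γ => P.hom γ • x).ncard * (Nat.card K ^ 2 - 1) = Nat.card (GL (Fin 2) K) := by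
  rcases P.stabilizer_trichotomy m p hX x with h | h | ⟨γ₀, h0, h⟩
  · exact Or.inl h
  · exact Or.inr (Or.inl (P.ncard_orbit_of_stabilizer_trivial x h))
  · right; right
    rw [← P.ncard_orbit_mul_card x, ← card_GL_torus h0]
    congr 1
    refine (Nat.card_congr (Equiv.subtypeEquivRight fun γ => ?_)).symm
    rw [h γ, hP γ]

end PlaneCover

/-! ### Divisibility by `x ^ g - 2` -/

/-- `P` is not a multiple of `b` if, up to sign, it has a remainder strictly between `0` and `b`. -/
theorem mul_ne_of_remainder {L b P : ℤ} (s Q : ℤ) (h1 : 0 < s * (P - Q * b))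
    (h2 : s * (P - Q * b) < b) : L * b ≠ P := by
  intro h
  have : b ∣ s * (P - Q * b) := ⟨s * (L - Q), by rw [← h]; ring⟩
  exact absurd (Int.le_of_dvd h1 this) (not_le.2 h2)

theorem mul_ne_of_lt {L b c P : ℤ} (hL : 10 < L) (hc : 0 < c) (hcb : c ≤ b)
    (hP : P < 11 * c) : L * b ≠ P := by
  have h : 11 * c ≤ L * b := mul_le_mul (by omega) hcb (by omega) (by omega)
  omega

/-- The equation forced by a block of length `x ^ 2 - x` has no solution: for each small `g` the
polynomial leaves a small nonzero remainder modulo `x ^ g - 2`, and for large `g` it is too small.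
-/
theorem mul_ne_nonsplit_poly {x L : ℤ} {g : ℕ} (hx : 3 ≤ x) (hg : 2 ≤ g) (hL : 10 < L) :
    L * (x ^ g - 2) ≠ (x ^ 2 - x - 1) * (x ^ 2 - x - 3) * (x - 2) := by
  intro h
  rcases le_or_gt 5 g with hg' | hg'
  · have h1 : x ^ 5 ≤ x ^ g := pow_le_pow_right₀ (by omega) hg'
    obtain ⟨y, hy⟩ := Int.le.dest hx
    exact mul_ne_of_lt hL (by rw [← sub_pos, ← hy]; ring_nf; positivity) (sub_le_sub_right h1 2)
      (by rw [← sub_pos, ← hy]; ring_nf; positivity) h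
  interval_cases g
  · obtain ⟨y, hy⟩ := Int.le.dest hx
    exact mul_ne_of_remainder 1 (x ^ 3 - 4 * x ^ 2 + 3 * x + 2)
      (by rw [← hy]; ring_nf; positivity) (by rw [← sub_pos, ← hy]; ring_nf; positivity) h
  · rcases lt_or_ge x 11 with hx0 | hx0
    · interval_cases x <;> omega
    obtain ⟨y, hy⟩ := Int.le.dest hx0
    exact mul_ne_of_remainder 1 (x ^ 2 - 4 * x + 1)
      (by rw [← hy]; ring_nf; positivity) (by rw [← sub_pos, ← hy]; ring_nf; positivity) h
  · rcases lt_or_ge x 4 with hx0 | hx0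
    · interval_cases x; omega
    obtain ⟨y, hy⟩ := Int.le.dest hx0
    exact mul_ne_of_remainder 1 (x - 4)
      (by rw [← hy]; ring_nf; positivity) (by rw [← sub_pos, ← hy]; ring_nf; positivity) h

/-- The equation forced by a block of length `x ^ 3 - x` has no solution with `L > 10`; for `L = 10`
there is the solution `x = 2`, `g = 3`. -/
theorem mul_ne_regular_poly {x L : ℤ} {g : ℕ} (hx : 2 ≤ x) (hg : 3 ≤ g) (hL : 10 < L) :
    L * (x ^ g - 2) ≠ (x ^ 3 - x - 1) * (x ^ 3 - x - 2) * (x ^ 3 - x - 3) := by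
  intro h
  rcases le_or_gt 9 g with hg' | hg'
  · have h1 : x ^ 9 ≤ x ^ g := pow_le_pow_right₀ (by omega) hg'
    obtain ⟨y, hy⟩ := Int.le.dest hx
    exact mul_ne_of_lt hL (by rw [← sub_pos, ← hy]; ring_nf; positivity) (sub_le_sub_right h1 2)
      (by rw [← sub_pos, ← hy]; ring_nf; positivity) h
  interval_cases g
  · rcases lt_or_ge x 3 with hx0 | hx0
    · interval_cases x; omega
    obtain ⟨y, hy⟩ := Int.le.dest hx0
    exact mul_ne_of_remainder 1 (x ^ 6 - 3 * x ^ 4 - 4 * x ^ 3 + 3 * x ^ 2 + 6 * x + 2)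
      (by rw [← hy]; ring_nf; positivity) (by rw [← sub_pos, ← hy]; ring_nf; positivity) h
  · rcases lt_or_ge x 5 with hx0 | hx0
    · interval_cases x <;> omega
    obtain ⟨y, hy⟩ := Int.le.dest hx0
    exact mul_ne_of_remainder 1 (x ^ 5 - 3 * x ^ 3 - 6 * x ^ 2 + 5 * x + 12)
      (by rw [← hy]; ring_nf; positivity) (by rw [← sub_pos, ← hy]; ring_nf; positivity) h
  · rcases lt_or_ge x 15 with hx0 | hx0
    · interval_cases x <;> omega
    obtain ⟨y, hy⟩ := Int.le.dest hx0
    exact mul_ne_of_remainder 1 (x ^ 4 - 3 * x ^ 2 - 6 * x + 3)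
      (by rw [← hy]; ring_nf; positivity) (by rw [← sub_pos, ← hy]; ring_nf; positivity) h
  · rcases lt_or_ge x 6 with hx0 | hx0
    · interval_cases x <;> omega
    obtain ⟨y, hy⟩ := Int.le.dest hx0
    exact mul_ne_of_remainder 1 (x ^ 3 - 3 * x - 6)
      (by rw [← hy]; ring_nf; positivity) (by rw [← sub_pos, ← hy]; ring_nf; positivity) h
  · rcases lt_or_ge x 5 with hx0 | hx0
    · interval_cases x <;> omega
    obtain ⟨y, hy⟩ := Int.le.dest hx0
    exact mul_ne_of_remainder (-1) (x ^ 2 - 3)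
      (by rw [← hy]; ring_nf; positivity) (by rw [← sub_pos, ← hy]; ring_nf; positivity) h
  · rcases lt_or_ge x 5 with hx0 | hx0
    · interval_cases x <;> omega
    obtain ⟨y, hy⟩ := Int.le.dest hx0
    exact mul_ne_of_remainder (-1) (x)
      (by rw [← hy]; ring_nf; positivity) (by rw [← sub_pos, ← hy]; ring_nf; positivity) h

/-- The equation forced by a block of length `(x ^ 3 - x) / 2` has no solution. -/
theorem mul_ne_half_regular_poly {x L : ℤ} {g : ℕ} (hx : 3 ≤ x) (hg : 3 ≤ g) (hL : 10 < L) :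
    L * (x ^ g - 2) ≠ (x ^ 3 - x - 2) * (x ^ 3 - x - 4) * (x ^ 3 - x - 6) := by
  intro h
  rcases le_or_gt 9 g with hg' | hg'
  · have h1 : x ^ 9 ≤ x ^ g := pow_le_pow_right₀ (by omega) hg'
    obtain ⟨y, hy⟩ := Int.le.dest hx
    exact mul_ne_of_lt hL (by rw [← sub_pos, ← hy]; ring_nf; positivity) (sub_le_sub_right h1 2)
      (by rw [← sub_pos, ← hy]; ring_nf; positivity) h
  interval_cases g
  · rcases lt_or_ge x 8 with hx0 | hx0
    · interval_cases x <;> omega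
    obtain ⟨y, hy⟩ := Int.le.dest hx0
    exact mul_ne_of_remainder (-1) (x ^ 6 - 3 * x ^ 4 - 10 * x ^ 3 + 3 * x ^ 2 + 18 * x + 23)
      (by rw [← hy]; ring_nf; positivity) (by rw [← sub_pos, ← hy]; ring_nf; positivity) h
  · rcases lt_or_ge x 36 with hx0 | hx0
    · interval_cases x <;> omega
    obtain ⟨y, hy⟩ := Int.le.dest hx0
    exact mul_ne_of_remainder 1 (x ^ 5 - 3 * x ^ 3 - 12 * x ^ 2 + 5 * x + 24)
      (by rw [← hy]; ring_nf; positivity) (by rw [← sub_pos, ← hy]; ring_nf; positivity) h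
  · rcases lt_or_ge x 28 with hx0 | hx0
    · interval_cases x <;> omega
    obtain ⟨y, hy⟩ := Int.le.dest hx0
    exact mul_ne_of_remainder 1 (x ^ 4 - 3 * x ^ 2 - 12 * x + 3)
      (by rw [← hy]; ring_nf; positivity) (by rw [← sub_pos, ← hy]; ring_nf; positivity) h
  · rcases lt_or_ge x 8 with hx0 | hx0
    · interval_cases x <;> omega
    obtain ⟨y, hy⟩ := Int.le.dest hx0
    exact mul_ne_of_remainder 1 (x ^ 3 - 3 * x - 12)
      (by rw [← hy]; ring_nf; positivity) (by rw [← sub_pos, ← hy]; ring_nf; positivity) h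
  · rcases lt_or_ge x 12 with hx0 | hx0
    · interval_cases x <;> omega
    obtain ⟨y, hy⟩ := Int.le.dest hx0
    exact mul_ne_of_remainder (-1) (x ^ 2 - 3)
      (by rw [← hy]; ring_nf; positivity) (by rw [← sub_pos, ← hy]; ring_nf; positivity) h
  · rcases lt_or_ge x 6 with hx0 | hx0
    · interval_cases x <;> omega
    obtain ⟨y, hy⟩ := Int.le.dest hx0
    exact mul_ne_of_remainder (-1) (x)
      (by rw [← hy]; ring_nf; positivity) (by rw [← sub_pos, ← hy]; ring_nf; positivity) h

/-- No orbit length of a subfield subgroup is compatible with the parameters of a `4`-design. -/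
theorem subfield_block_false {x k L : ℤ} {g : ℕ} (hx : 2 ≤ x) (hg : 2 ≤ g) (hL : 10 < L)
    (hk : 4 < k) (hkq : k ≤ x ^ g)
    (h : L * (x ^ g - 2) * (x ^ 3 - x) = k * (k - 1) * (k - 2) * (k - 3))
    (hcases : k = x + 1 ∨ k = x ^ 2 - x ∨ k = x ^ 3 - x ∨ 2 * k = x ^ 3 - x) : False := by
  have hx2 : x ^ 2 ≤ x ^ g := pow_le_pow_right₀ (by omega) hg
  have hx3 : 3 ≤ x ∨ x = 2 := by omega
  have hg3 : x ^ 3 - x = k ∨ x ^ 3 - x = 2 * k → 3 ≤ g := by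
    intro hk3
    by_contra hg3
    have : g = 2 := by omega
    subst this
    rcases hx3 with hx3 | rfl
    · have : 2 * k ≥ x ^ 3 - x := by omega
      nlinarith
    · omega
  rcases hcases with rfl | rfl | rfl | h2
  · have h1 : (L * (x ^ g - 2)) * (x * (x + 1) * (x - 1)) = (x - 2) * (x * (x + 1) * (x - 1)) := by
      linear_combination h
    have h2 := mul_right_cancel₀ (by
      have : 0 < x * (x + 1) * (x - 1) := by
        have : 0 < x - 1 := by omega
        positivity
      exact this.ne') h1
    nlinarith
  · have h1 : (L * (x ^ g - 2)) * (x * (x + 1) * (x - 1)) =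
        ((x ^ 2 - x - 1) * (x ^ 2 - x - 3) * (x - 2)) * (x * (x + 1) * (x - 1)) := by
      linear_combination h
    have h2 := mul_right_cancel₀ (by
      have : 0 < x * (x + 1) * (x - 1) := by
        have : 0 < x - 1 := by omega
        positivity
      exact this.ne') h1
    rcases hx3 with hx3 | rfl
    · exact mul_ne_nonsplit_poly hx3 hg hL h2
    · omega
  · refine mul_ne_regular_poly hx (hg3 (Or.inl rfl)) hL (g := g) ?_
    apply mul_right_cancel₀ (show x ^ 3 - x ≠ 0 by omega)
    linear_combination h
  · rw [← h2] at h
    have h3 : (L * (x ^ g - 2)) * 2 = (k - 1) * (k - 2) * (k - 3) := by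
      apply mul_right_cancel₀ (show k ≠ 0 by omega)
      linear_combination h
    rcases hx3 with hx3 | rfl
    · refine mul_ne_half_regular_poly (L := 16 * L) hx3 (hg3 (Or.inr h2.symm)) (by omega)
        (g := g) ?_
      rw [← h2]
      linear_combination 8 * h3
    · omega

/-! ### Flag-transitive designs -/

namespace BlockDesign

variable {X : Type*} [Finite X] {t v k lam : ℕ}

/-- Double counting of the pairs consisting of a `t`-set and a block containing it. -/
theorem ncard_blocks_mul_choose (D : BlockDesign X t v k lam) :
    D.blocks.ncard * k.choose t = lam * v.choose t := by
  classical
  have := Fintype.ofFinite X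
  have hfin : D.blocks.Finite := Set.toFinite _
  have key := Finset.sum_card_bipartiteAbove_eq_sum_card_bipartiteBelow
    (fun (T : Finset X) (B : Set X) => (T : Set X) ⊆ B)
    (s := Finset.powersetCard t Finset.univ) (t := hfin.toFinset)
  have h1 : ∀ T ∈ Finset.powersetCard t (Finset.univ : Finset X),
      (Finset.bipartiteAbove (fun (T : Finset X) (B : Set X) => (T : Set X) ⊆ B)
        hfin.toFinset T).card = lam := by
    intro T hT
    refine Eq.trans ?_ (D.card_blocks_through T (by
      rw [Set.ncard_coe_finset]; exact (Finset.mem_powersetCard.1 hT).2))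
    rw [← Set.ncard_coe_finset]
    congr 1
    ext B
    simp [Finset.bipartiteAbove]
  have h2 : ∀ B ∈ hfin.toFinset,
      (Finset.bipartiteBelow (fun (T : Finset X) (B : Set X) => (T : Set X) ⊆ B)
        (Finset.powersetCard t Finset.univ) B).card = k.choose t := by
    intro B hB
    rw [← D.card_block B (by simpa using hB), Set.ncard_eq_toFinset_card' B,
      ← Finset.card_powersetCard]
    congr 1
    ext T
    simp only [Finset.bipartiteBelow, Finset.mem_filter, Finset.mem_powersetCard,
      Finset.subset_univ, true_and]
    rw [and_comm, ← Finset.coe_subset, Set.coe_toFinset]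
  rw [Finset.sum_congr rfl h1, Finset.sum_congr rfl h2, Finset.sum_const, Finset.sum_const,
    Finset.card_powersetCard, Finset.card_univ, ← Nat.card_eq_fintype_card, D.card_points,
    smul_eq_mul, smul_eq_mul, ← Set.ncard_eq_toFinset_card D.blocks hfin] at key
  rw [← key, mul_comm]

variable {D : BlockDesign X t v k lam} {G : Subgroup (Equiv.Perm X)}

theorem smul_mem_blocks_iff (hG : G ≤ D.autGroup) (g : G) (B : Set X) :
    g • B ∈ D.blocks ↔ B ∈ D.blocks :=
  (D.mem_autGroup g).1 (hG g.2) B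

theorem exists_block_through (D : BlockDesign X t v k lam) (hlam : 0 < lam) {T : Set X}
    (hT : T.ncard = t) : ∃ B ∈ D.blocks, T ⊆ B := by
  obtain ⟨B, hB⟩ := Set.nonempty_of_ncard_ne_zero
    (s := {B ∈ D.blocks | T ⊆ B}) (by rw [D.card_blocks_through T hT]; omega)
  exact ⟨B, hB⟩

/-- Every point lies on a block, so flag-transitivity implies point-transitivity. -/
theorem FlagTransitive.isPretransitive (h : D.FlagTransitive G) (hlam : 0 < lam) (ht : 0 < t)
    (htv : t ≤ v) : MulAction.IsPretransitive G X := by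
  have hex : ∀ x : X, ∃ B, D.IsFlag x B := by
    intro x
    obtain ⟨T, hT1, -, hT2⟩ := Set.exists_subsuperset_card_eq (s := {x}) (t := Set.univ)
      (n := t) (Set.subset_univ _) (by rw [Set.ncard_singleton]; omega)
      (by rw [Set.ncard_univ, D.card_points]; exact htv)
    obtain ⟨B, hB, hTB⟩ := D.exists_block_through hlam hT2
    exact ⟨B, hB, hTB (hT1 rfl)⟩
  refine ⟨fun x y => ?_⟩
  obtain ⟨B, hB⟩ := hex x
  obtain ⟨C, hC⟩ := hex y
  obtain ⟨g, hg, hgx, -⟩ := h x B y C hB hC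
  exact ⟨⟨g, hg⟩, hgx⟩

theorem FlagTransitive.exists_smul_eq (h : D.FlagTransitive G) (hk : 0 < k) {B C : Set X}
    (hB : B ∈ D.blocks) (hC : C ∈ D.blocks) : ∃ g : G, g • B = C := by
  obtain ⟨x, hx⟩ := Set.nonempty_of_ncard_ne_zero (s := B) (by rw [D.card_block B hB]; omega)
  obtain ⟨y, hy⟩ := Set.nonempty_of_ncard_ne_zero (s := C) (by rw [D.card_block C hC]; omega)
  obtain ⟨g, hg, -, hgB⟩ := h x B y C ⟨hB, hx⟩ ⟨hC, hy⟩
  exact ⟨⟨g, hg⟩, hgB⟩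

theorem FlagTransitive.blocks_eq_orbit (h : D.FlagTransitive G) (hG : G ≤ D.autGroup) (hk : 0 < k)
    {B : Set X} (hB : B ∈ D.blocks) : D.blocks = MulAction.orbit G B := by
  ext C
  constructor
  · intro hC
    obtain ⟨g, rfl⟩ := h.exists_smul_eq hk hB hC
    exact ⟨g, rfl⟩
  · rintro ⟨g, rfl⟩
    exact (smul_mem_blocks_iff hG g B).2 hB

theorem FlagTransitive.ncard_blocks_mul (h : D.FlagTransitive G) (hG : G ≤ D.autGroup)
    (hk : 0 < k) {B : Set X} (hB : B ∈ D.blocks) :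
    D.blocks.ncard * Nat.card (MulAction.stabilizer G B) = Nat.card G := by
  rw [h.blocks_eq_orbit hG hk hB]
  exact card_orbit_mul_card_stabilizer B

/-- A block is an orbit of its stabiliser. -/
theorem FlagTransitive.block_eq_orbit (h : D.FlagTransitive G) {B : Set X}
    (hB : B ∈ D.blocks) {x : X} (hx : x ∈ B) :
    B = MulAction.orbit (MulAction.stabilizer G B) x := by
  ext y
  constructor
  · intro hy
    obtain ⟨g, hg, hgx, hgB⟩ := h x B y B ⟨hB, hx⟩ ⟨hB, hy⟩
    exact ⟨⟨⟨g, hg⟩, hgB⟩, hgx⟩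
  · rintro ⟨⟨g, hg⟩, rfl⟩
    rw [MulAction.mem_stabilizer_iff] at hg
    change g • x ∈ B
    rw [← hg]
    exact Set.smul_mem_smul_set hx

theorem FlagTransitive.mul_card_point_stabilizer (h : D.FlagTransitive G) {B : Set X}
    (hB : B ∈ D.blocks) {x : X} (hx : x ∈ B) :
    k * Nat.card (MulAction.stabilizer (MulAction.stabilizer G B) x) =
      Nat.card (MulAction.stabilizer G B) := by
  rw [← card_orbit_mul_card_stabilizer (G := MulAction.stabilizer G B) x,
    ← h.block_eq_orbit hB hx, D.card_block B hB]

/-- All block stabilisers are isomorphic. -/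
theorem FlagTransitive.nonempty_stabilizer_mulEquiv (h : D.FlagTransitive G) (hk : 0 < k)
    {B C : Set X} (hB : B ∈ D.blocks) (hC : C ∈ D.blocks) :
    Nonempty (MulAction.stabilizer G C ≃* MulAction.stabilizer G B) := by
  obtain ⟨g, rfl⟩ := h.exists_smul_eq hk hB hC
  exact ⟨MulAction.stabilizerEquivStabilizer (g := g⁻¹) (by simp)⟩

/-- A `p`-group stabilising a `t`-set fixes one of the blocks through it, unless `p` divides
`lam`. -/
theorem exists_fixed_block (hG : G ≤ D.autGroup) (p : ℕ) [Fact p.Prime] (hlam : ¬ p ∣ lam)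
    {S : Subgroup G} (hS : IsPGroup p S) {T : Set X} (hT : T.ncard = t)
    (hST : ∀ s ∈ S, s • T = T) : ∃ C ∈ D.blocks, T ⊆ C ∧ ∀ s ∈ S, s • C = C := by
  let _ : MulAction S {C : Set X // C ∈ D.blocks ∧ T ⊆ C} :=
    { smul := fun s C => ⟨(s : G) • (C : Set X), (smul_mem_blocks_iff hG _ _).2 C.2.1, by
        exact (hST s s.2).ge.trans (Set.smul_set_mono C.2.2)⟩
      one_smul := fun C => Subtype.ext (one_smul G (C : Set X))
      mul_smul := fun a b C => Subtype.ext (mul_smul (a : G) (b : G) (C : Set X)) }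
  obtain ⟨C, hC⟩ := hS.nonempty_fixed_point_of_prime_not_dvd_card
    {C : Set X // C ∈ D.blocks ∧ T ⊆ C} (by
      have h1 : Nat.card {C : Set X // C ∈ D.blocks ∧ T ⊆ C} = lam := D.card_blocks_through T hT
      rwa [h1])
  exact ⟨C, C.2.1, C.2.2, fun s hs => congrArg Subtype.val (hC ⟨s, hs⟩)⟩

end BlockDesign

/-- The fundamental equation relating the parameters to the order of a block stabiliser; `d` is
the order of the centre of `SL(2, q)`, and all blocks are counted once by `4`-subsets and once as an
orbit of `G`. -/
theorem BlockDesign.FlagTransitive.parameter_eq {X : Type*} [Finite X] {q k lam d : ℕ}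
    {D : BlockDesign X 4 (q + 1) k lam} {G : Subgroup (Equiv.Perm X)} (h : D.FlagTransitive G)
    (hG : G ≤ D.autGroup) (hk : 4 < k) (hkq : k < q + 1) (hd : d * Nat.card G = q * (q ^ 2 - 1))
    {B : Set X} (hB : B ∈ D.blocks) :
    lam * (q - 2) * (d * Nat.card (setwiseStabilizer G B)) =
      k * (k - 1) * (k - 2) * (k - 3) := by
  have h1 := D.ncard_blocks_mul_choose
  have h2 := h.ncard_blocks_mul hG (by omega) hB
  change _ * Nat.card (setwiseStabilizer G B) = _ at h2
  set n := Nat.card (setwiseStabilizer G B)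
  have hdf : ∀ m, 4 ≤ m → m * (m - 1) * (m - 2) * (m - 3) = 24 * m.choose 4 := by
    intro m hm
    have := Nat.descFactorial_eq_factorial_mul_choose m 4
    simp only [Nat.descFactorial_succ, Nat.descFactorial_zero, Nat.factorial] at this
    rw [show 24 * m.choose 4 = (3 + 1) * ((2 + 1) * ((1 + 1) * ((0 + 1) * 1))) * m.choose 4 by ring,
      ← this]
    simp only [Nat.sub_zero, mul_one]; ring
  have hv := hdf (q + 1) (by omega)
  have hk' := hdf k (by omega)
  obtain ⟨r, rfl⟩ : ∃ r, q = r + 2 := ⟨q - 2, by omega⟩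
  simp only [show r + 2 + 1 - 1 = r + 2 by omega, show r + 2 + 1 - 2 = r + 1 by omega,
    show r + 2 + 1 - 3 = r by omega] at hv
  have hd' : d * Nat.card G = (r + 2) * ((r + 3) * (r + 1)) := by
    rw [hd]
    congr 1
    rw [show (r + 2) ^ 2 - 1 = (r + 2) ^ 2 - 1 ^ 2 by norm_num, Nat.sq_sub_sq]
    congr 1
  have hpos : 0 < (r + 2) * ((r + 3) * (r + 1)) := by positivity
  apply Nat.eq_of_mul_eq_mul_left hpos
  rw [hk', show r + 2 - 2 = r by omega]
  nth_rewrite 2 [← hd']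
  rw [← h2]
  calc (r + 2) * ((r + 3) * (r + 1)) * (lam * r * (d * n))
      = lam * ((r + 2 + 1) * (r + 2) * (r + 1) * r) * (d * n) := by ring
    _ = 24 * (lam * (r + 2 + 1).choose 4) * (d * n) := by rw [hv]; ring
    _ = d * (D.blocks.ncard * n) * (24 * k.choose 4) := by rw [← h1]; ring

/-! ### Commuting involutions -/

/-- Ordered pairs of distinct commuting involutions of a group. -/
def commutingInvolutions (H : Type*) [Group H] : Set (H × H) :=
  {z | z.1 * z.1 = 1 ∧ z.2 * z.2 = 1 ∧ z.1 ≠ 1 ∧ z.2 ≠ 1 ∧ z.1 ≠ z.2 ∧ z.1 * z.2 = z.2 * z.1}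

theorem ncard_commutingInvolutions_congr {H H' : Type*} [Group H] [Group H'] (e : H ≃* H') :
    (commutingInvolutions H).ncard = (commutingInvolutions H').ncard := by
  rw [← Set.ncard_image_of_injective _ (e.toEquiv.prodCongr e.toEquiv).injective]
  congr 1
  ext ⟨a, b⟩
  constructor
  · rintro ⟨⟨c, d⟩, ⟨h1, h2, h3, h4, h5, h6⟩, h⟩
    obtain ⟨rfl, rfl⟩ := Prod.mk.inj h
    refine ⟨?_, ?_, ?_, ?_, ?_, ?_⟩
    · exact (map_mul e c c).symm.trans (by rw [h1, map_one])
    · exact (map_mul e d d).symm.trans (by rw [h2, map_one])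
    · exact fun h => h3 ((map_eq_one_iff e e.injective).1 h)
    · exact fun h => h4 ((map_eq_one_iff e e.injective).1 h)
    · exact fun h => h5 (e.injective h)
    · exact (map_mul e c d).symm.trans (by rw [h6]; exact map_mul e d c)
  · rintro ⟨h1, h2, h3, h4, h5, h6⟩
    simp only at h1 h2 h3 h4 h5 h6
    refine ⟨(e.symm a, e.symm b), ⟨?_, ?_, ?_, ?_, ?_, ?_⟩, by ext <;> simp⟩
    · simp only; rw [← map_mul, h1, map_one]
    · simp only; rw [← map_mul, h2, map_one]
    · simpa using h3
    · simpa using h4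
    · simpa using h5
    · simp only; rw [← map_mul, h6, map_mul]

section Quaternion

variable {F : Type*} [Field F]

/-- The first generator of a quaternion group in `SL(2, F)`. -/
def quatI (F : Type*) [Field F] : Matrix (Fin 2) (Fin 2) F := !![0, 1; -1, 0]

/-- The second generator of a quaternion group in `SL(2, F)`, where `a ^ 2 + b ^ 2 = -1`. -/
def quatJ (a b : F) : Matrix (Fin 2) (Fin 2) F := !![a, b; b, -a]

theorem quatI_mul_self : quatI F * quatI F = -1 := by
  ext i j; fin_cases i <;> fin_cases j <;> simp [quatI]

theorem quatJ_mul_self {a b : F} (hab : a ^ 2 + b ^ 2 = -1) : quatJ a b * quatJ a b = -1 := by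
  have h : a * a + b * b = -1 := by rw [← hab]; ring
  have h' : b * b + a * a = -1 := by rw [← hab]; ring
  ext i j; fin_cases i <;> fin_cases j <;> simp [quatJ, h, h', mul_comm]

theorem quatI_mul_quatJ (a b : F) : quatI F * quatJ a b = -(quatJ a b * quatI F) := by
  ext i j; fin_cases i <;> fin_cases j <;> simp [quatI, quatJ]

theorem det_quatI : (quatI F).det = 1 := by simp [quatI]

theorem det_quatJ {a b : F} (hab : a ^ 2 + b ^ 2 = -1) : (quatJ a b).det = 1 := by
  simp [quatJ, Matrix.det_fin_two]; linear_combination -hab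

theorem eq_smul_one_of_commute_quat (h2 : (2 : F) ≠ 0) {a b : F} (hab : a ^ 2 + b ^ 2 = -1)
    {N : Matrix (Fin 2) (Fin 2) F} (hI : N * quatI F = quatI F * N)
    (hJ : N * quatJ a b = quatJ a b * N) : ∃ c : F, N = c • (1 : Matrix (Fin 2) (Fin 2) F) := by
  have e1 := congrFun (congrFun hI 0) 0
  have e2 := congrFun (congrFun hI 0) 1
  have e3 := congrFun (congrFun hJ 0) 0
  have e4 := congrFun (congrFun hJ 0) 1
  simp only [quatI, quatJ, Matrix.mul_apply, Fin.sum_univ_two, Matrix.of_apply,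
    Matrix.cons_val', Matrix.cons_val_zero, Matrix.cons_val_one, Matrix.cons_val_fin_one] at *
  have h10 : N 1 0 = -N 0 1 := by linear_combination -e1
  have h11 : N 1 1 = N 0 0 := by linear_combination -e2
  rw [h10] at e3
  rw [h11] at e4
  have h01 : N 0 1 = 0 := by
    have h3 : 2 * (b * N 0 1) = 0 := by linear_combination e3
    have h4 : 2 * (a * N 0 1) = 0 := by linear_combination -e4
    have h3' := (mul_eq_zero.1 h3).resolve_left h2
    have h4' := (mul_eq_zero.1 h4).resolve_left h2
    linear_combination (N 0 1) * hab - a * h4' - b * h3'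
  refine ⟨N 0 0, ?_⟩
  ext i j
  fin_cases i <;> fin_cases j <;> simp [h10, h11, h01]

/-- The matrices commuting or anticommuting with both generators are the multiples of the four
basis quaternions. -/
theorem exists_eq_smul_quat (h2 : (2 : F) ≠ 0) {a b : F} (hab : a ^ 2 + b ^ 2 = -1)
    {N : Matrix (Fin 2) (Fin 2) F} {r s : F} (hr : r ^ 2 = 1) (hs : s ^ 2 = 1)
    (hI : N * quatI F = r • (quatI F * N)) (hJ : N * quatJ a b = s • (quatJ a b * N)) :
    ∃ (c : F) (i : Fin 4),
      N = c • ![1, quatI F, quatJ a b, quatI F * quatJ a b] i := by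
  have hII := quatI_mul_self (F := F)
  have hJJ := quatJ_mul_self hab
  have hIJ := quatI_mul_quatJ a b
  have hJI : quatJ a b * quatI F = -(quatI F * quatJ a b) := by rw [hIJ, neg_neg]
  set I := quatI F
  set J := quatJ a b
  -- if `N * E` is scalar and `E * E = e`, then `N` is a multiple of `E`
  have key : ∀ (E : Matrix (Fin 2) (Fin 2) F) (e f g : F), e ≠ 0 →
      E * E = e • (1 : Matrix (Fin 2) (Fin 2) F) →
      E * I = f • (I * E) → E * J = g • (J * E) → r * f = 1 → s * g = 1 →
      ∃ c : F, N = c • E := by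
    intro E e f g he hEE hEI hEJ hf hg
    obtain ⟨c, hc⟩ := eq_smul_one_of_commute_quat h2 hab (N := N * E)
      (by rw [mul_assoc, hEI, Matrix.mul_smul, ← mul_assoc, hI, Matrix.smul_mul, smul_smul,
            mul_comm f, hf, one_smul, mul_assoc])
      (by rw [mul_assoc, hEJ, Matrix.mul_smul, ← mul_assoc, hJ, Matrix.smul_mul, smul_smul,
            mul_comm g, hg, one_smul, mul_assoc])
    refine ⟨e⁻¹ * c, ?_⟩
    have : N * E * E = c • E := by rw [hc, Matrix.smul_mul, one_mul]
    rw [mul_assoc, hEE, Matrix.mul_smul, mul_one] at this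
    rw [mul_smul, ← this, smul_smul, inv_mul_cancel₀ he, one_smul]
  have hIJIJ : (I * J) * (I * J) = -1 := by
    rw [mul_assoc, ← mul_assoc J, hJI, neg_mul, mul_neg, mul_assoc, hJJ, mul_neg, mul_neg, mul_one,
      neg_neg, hII]
  rw [sq] at hr hs
  rcases mul_self_eq_one_iff.1 hr with rfl | rfl <;> rcases mul_self_eq_one_iff.1 hs with rfl | rfl
  · obtain ⟨c, hc⟩ := key 1 1 1 1 one_ne_zero (by simp) (by simp) (by simp) (by simp) (by simp)
    exact ⟨c, 0, hc⟩
  · obtain ⟨c, hc⟩ := key I (-1) 1 (-1) (by simp) (by rw [hII]; simp) (by simp)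
      (by rw [hIJ]; simp) (by simp) (by simp)
    exact ⟨c, 1, hc⟩
  · obtain ⟨c, hc⟩ := key J (-1) (-1) 1 (by simp) (by rw [hJJ]; simp) (by rw [hJI]; simp)
      (by simp) (by simp) (by simp)
    exact ⟨c, 2, hc⟩
  · obtain ⟨c, hc⟩ := key (I * J) (-1) (-1) (-1) (by simp) (by rw [hIJIJ]; simp)
      (by rw [mul_assoc, hJI]; simp) (by rw [← mul_assoc J, hJI]; simp) (by simp) (by simp)
    exact ⟨c, 3, hc⟩

theorem exists_sq_add_sq_eq_neg_one [Finite F] : ∃ a b : F, a ^ 2 + b ^ 2 = -1 := by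
  have := Fintype.ofFinite F
  by_cases h2 : ringChar F = 2
  · obtain ⟨a, ha⟩ := FiniteField.isSquare_of_char_two h2 (-1 : F)
    exact ⟨a, 0, by rw [ha]; ring⟩
  · obtain ⟨a, b, hab⟩ := FiniteField.exists_root_sum_quadratic (R := F)
      (f := Polynomial.C 1 * Polynomial.X ^ 2 + Polynomial.C 0 * Polynomial.X + Polynomial.C 1)
      (g := Polynomial.C 1 * Polynomial.X ^ 2 + Polynomial.C 0 * Polynomial.X + Polynomial.C 0)
      (Polynomial.degree_quadratic one_ne_zero) (Polynomial.degree_quadratic one_ne_zero)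
      (FiniteField.odd_card_of_char_ne_two h2)
    refine ⟨a, b, ?_⟩
    simp at hab
    linear_combination hab

/-- The group `PSL(2, q)`, `q` odd, has at least `q (q ^ 2 - 1) / 4` ordered pairs of distinct
commuting involutions: these are obtained by conjugating under `GL(2, q)` the images of two
quaternion generators, whose common centraliser modulo scalars has order `4`. -/
theorem le_ncard_commutingInvolutions [Finite F] (h2 : (2 : F) ≠ 0) {G : Type*} [Group G] [Finite G]
    (π : SL(2, F) →* G)
    (hker : ∀ M : SL(2, F), π M = 1 ↔
      ∃ c : F, (M : Matrix (Fin 2) (Fin 2) F) = c • (1 : Matrix (Fin 2) (Fin 2) F)) :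
    Nat.card F * (Nat.card F ^ 2 - 1) ≤ 4 * (commutingInvolutions G).ncard := by
  classical
  have := Fintype.ofFinite F
  have := Fintype.ofFinite G
  have := Fintype.ofFinite (GL (Fin 2) F)
  obtain ⟨a, b, hab⟩ := exists_sq_add_sq_eq_neg_one (F := F)
  -- conjugation as a map to `SL(2, F)`
  let I : SL(2, F) := ⟨quatI F, det_quatI⟩
  let J : SL(2, F) := ⟨quatJ a b, det_quatJ hab⟩
  let cj : GL (Fin 2) F → SL(2, F) → SL(2, F) := fun M A =>
    ⟨(M : Matrix (Fin 2) (Fin 2) F) * A * ((M⁻¹ : GL (Fin 2) F) : Matrix (Fin 2) (Fin 2) F), by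
      rw [Matrix.det_mul, Matrix.det_mul, A.2, mul_one, ← Matrix.det_mul, ← Units.val_mul,
        mul_inv_cancel]; simp⟩
  have hcj : ∀ M A, (cj M A : Matrix (Fin 2) (Fin 2) F) * (M : Matrix (Fin 2) (Fin 2) F) =
      (M : Matrix (Fin 2) (Fin 2) F) * A := by
    intro M A
    change (M : Matrix (Fin 2) (Fin 2) F) * A * ((M⁻¹ : GL (Fin 2) F) : Matrix (Fin 2) (Fin 2) F) *
      (M : Matrix (Fin 2) (Fin 2) F) = _
    rw [mul_assoc, ← Units.val_mul, inv_mul_cancel, Units.val_one, mul_one]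
  have hcjm : ∀ M A B, cj M A * cj M B = cj M (A * B) := by
    intro M A B
    apply Subtype.ext
    change (M : Matrix (Fin 2) (Fin 2) F) * A * ((M⁻¹ : GL (Fin 2) F) : Matrix (Fin 2) (Fin 2) F) *
      ((M : Matrix (Fin 2) (Fin 2) F) * B * ((M⁻¹ : GL (Fin 2) F) : Matrix (Fin 2) (Fin 2) F)) =
      (M : Matrix (Fin 2) (Fin 2) F) * (A * B : SL(2, F)) *
        ((M⁻¹ : GL (Fin 2) F) : Matrix (Fin 2) (Fin 2) F)
    rw [Matrix.SpecialLinearGroup.coe_mul]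
    simp only [mul_assoc]
    rw [← mul_assoc ((M⁻¹ : GL (Fin 2) F) : Matrix (Fin 2) (Fin 2) F), ← Units.val_mul,
      inv_mul_cancel, Units.val_one, one_mul]
  have hcj1 : ∀ M A, π (cj M A) = 1 ↔ π A = 1 := by
    intro M A
    rw [hker, hker]
    have hinv : ∀ c : F, (cj M A : Matrix (Fin 2) (Fin 2) F) = c • 1 ↔
        (A : Matrix (Fin 2) (Fin 2) F) = c • 1 := by
      intro c
      have hM : IsUnit (M : Matrix (Fin 2) (Fin 2) F) := M.isUnit
      rw [← hM.mul_left_inj, hcj, ← hM.mul_right_inj (b := (A : Matrix (Fin 2) (Fin 2) F))]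
      simp
    simp only [hinv]
  have hprod : ∀ A B : SL(2, F), π A = π B → ∃ r : F, r ^ 2 = 1 ∧
      (A : Matrix (Fin 2) (Fin 2) F) = r • (B : Matrix (Fin 2) (Fin 2) F) := by
    intro A B h
    obtain ⟨r, hr⟩ := (hker (A * B⁻¹)).1 (by rw [map_mul, map_inv, h, mul_inv_cancel])
    refine ⟨r, ?_, ?_⟩
    · have := (A * B⁻¹).2
      rw [hr, Matrix.det_smul] at this
      simpa using this
    · rw [show A = A * B⁻¹ * B by group, Matrix.SpecialLinearGroup.coe_mul (A * B⁻¹), hr]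
      simp
  have hII : π (I * I) = 1 := (hker _).2 ⟨-1, by
    rw [Matrix.SpecialLinearGroup.coe_mul]; change quatI F * quatI F = _
    rw [quatI_mul_self]; simp⟩
  have hJJ : π (J * J) = 1 := (hker _).2 ⟨-1, by
    rw [Matrix.SpecialLinearGroup.coe_mul]; change quatJ a b * quatJ a b = _
    rw [quatJ_mul_self hab]; simp⟩
  have hnI : π I ≠ 1 := by
    intro h
    obtain ⟨c, hc⟩ := (hker _).1 h
    have := congrFun (congrFun hc 0) 1
    simp [I, quatI] at this
  have hnJ : π J ≠ 1 := by
    intro h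
    obtain ⟨c, hc⟩ := (hker _).1 h
    have h0 := congrFun (congrFun hc 0) 1
    have h1 := congrFun (congrFun hc 0) 0
    have h2' := congrFun (congrFun hc 1) 1
    simp [J, quatJ] at h0 h1 h2'
    have h3 : 2 * a = 0 := by linear_combination h1 - h2'
    have h4 := (mul_eq_zero.1 h3).resolve_left h2
    rw [h0, h4] at hab
    simp at hab
  have hIJcomm : ∃ z : SL(2, F), π z = 1 ∧ I * J = z * (J * I) := by
    refine ⟨-1, (hker _).2 ⟨-1, by simp⟩, ?_⟩
    apply Subtype.ext
    change quatI F * quatJ a b = ((-1 * (J * I) : SL(2, F)) : Matrix (Fin 2) (Fin 2) F)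
    rw [quatI_mul_quatJ]
    simp [I, J]
    rfl
  obtain ⟨z, hz, hzIJ⟩ := hIJcomm
  have hnIJ : π I ≠ π J := by
    intro h
    obtain ⟨r, -, hr⟩ := hprod _ _ h
    have h0 := congrFun (congrFun hr 0) 1
    have h1 := congrFun (congrFun hr 1) 0
    simp [I, J, quatI, quatJ] at h0 h1
    have : (2 : F) = 0 := by linear_combination h0 - h1
    exact h2 this
  let φ : GL (Fin 2) F → G × G := fun M => (π (cj M I), π (cj M J))
  have hmaps : ∀ M, φ M ∈ commutingInvolutions G := by
    intro M
    refine ⟨?_, ?_, ?_, ?_, ?_, ?_⟩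
    · change π (cj M I) * π (cj M I) = 1
      rw [← map_mul, hcjm, hcj1, hII]
    · change π (cj M J) * π (cj M J) = 1
      rw [← map_mul, hcjm, hcj1, hJJ]
    · exact fun h => hnI ((hcj1 M I).1 h)
    · exact fun h => hnJ ((hcj1 M J).1 h)
    · intro h
      change π (cj M I) = π (cj M J) at h
      have h1 : π (cj M I * cj M J) = 1 := by
        rw [map_mul, h, ← map_mul, hcjm, hcj1, hJJ]
      rw [hcjm, hcj1, map_mul] at h1
      apply hnIJ
      rw [map_mul] at hJJ
      exact mul_right_cancel (h1.trans hJJ.symm)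
    · change π (cj M I) * π (cj M J) = π (cj M J) * π (cj M I)
      rw [← map_mul, ← map_mul, hcjm, hcjm, hzIJ, ← hcjm M z, map_mul, (hcj1 M z).2 hz, one_mul]
  have hfib : ∀ y : G × G, (Finset.univ.filter fun M => φ M = y).card ≤
      4 * (Nat.card F - 1) := by
    intro y
    by_cases hy : ∃ M₀, φ M₀ = y
    · obtain ⟨M₀, rfl⟩ := hy
      have hsub : ((Finset.univ.filter fun M => φ M = φ M₀).image
          (fun M : GL (Fin 2) F => (M : Matrix (Fin 2) (Fin 2) F))) ⊆
          (Finset.univ : Finset (Fˣ × Fin 4)).image (fun ci =>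
            (M₀ : Matrix (Fin 2) (Fin 2) F) * ((ci.1 : F) •
              ![1, quatI F, quatJ a b, quatI F * quatJ a b] ci.2)) := by
        intro A hA
        obtain ⟨M, hM, rfl⟩ := Finset.mem_image.1 hA
        have hM' := (Finset.mem_filter.1 hM).2
        obtain ⟨hM1, hM2⟩ := Prod.mk.inj hM'
        obtain ⟨r, hr, hr'⟩ := hprod _ _ hM1
        obtain ⟨s, hs, hs'⟩ := hprod _ _ hM2
        set N : Matrix (Fin 2) (Fin 2) F := ((M₀⁻¹ * M : GL (Fin 2) F) : Matrix (Fin 2) (Fin 2) F)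
          with hN
        have hMN : (M : Matrix (Fin 2) (Fin 2) F) = M₀ * N := by
          rw [hN, ← Units.val_mul, mul_inv_cancel_left]
        have hcommN : ∀ (A : SL(2, F)) (r : F), (cj M A : Matrix (Fin 2) (Fin 2) F) =
            r • (cj M₀ A : Matrix (Fin 2) (Fin 2) F) → N * (A : Matrix (Fin 2) (Fin 2) F) =
              r • ((A : Matrix (Fin 2) (Fin 2) F) * N) := by
          intro A r h
          have hM0 : IsUnit (M₀ : Matrix (Fin 2) (Fin 2) F) := M₀.isUnit
          apply hM0.mul_right_inj.1
          rw [← mul_assoc, ← hMN, ← hcj M A, h, hMN, Matrix.smul_mul, ← mul_assoc, hcj M₀ A,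
            Matrix.mul_smul, mul_assoc]
        obtain ⟨c, i, hci⟩ := exists_eq_smul_quat h2 hab hr hs (hcommN I r hr') (hcommN J s hs')
        have hc : c ≠ 0 := by
          rintro rfl
          rw [zero_smul] at hci
          have : (M₀⁻¹ * M : GL (Fin 2) F).val.det ≠ 0 := Matrix.GeneralLinearGroup.det_ne_zero _
          rw [← hN, hci] at this
          simp at this
        refine Finset.mem_image.2 ⟨(Units.mk0 c hc, i), Finset.mem_univ _, ?_⟩
        rw [hMN, hci]; rfl
      have h1 := Finset.card_le_card hsub
      rw [Finset.card_image_of_injective _ Units.val_injective] at h1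
      refine h1.trans (Finset.card_image_le.trans ?_)
      rw [Finset.card_univ, Fintype.card_prod, Fintype.card_fin, ← Nat.card_eq_fintype_card,
        Nat.card_units, mul_comm]
    · rw [Finset.filter_false_of_mem (fun M _ h => hy ⟨M, h⟩)]
      simp
  have hmain := Finset.card_le_mul_card_image_of_maps_to (s := Finset.univ)
    (t := (commutingInvolutions G).toFinset) (f := φ)
    (fun M _ => Set.mem_toFinset.2 (hmaps M)) (4 * (Nat.card F - 1)) (fun y _ => hfib y)
  rw [Finset.card_univ, ← Nat.card_eq_fintype_card, card_GL_two, ← Set.ncard_eq_toFinset_card']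
    at hmain
  have hq : 1 < Nat.card F := Finite.one_lt_card
  apply Nat.le_of_mul_le_mul_left _ (show 0 < Nat.card F - 1 by omega)
  calc (Nat.card F - 1) * (Nat.card F * (Nat.card F ^ 2 - 1))
      = (Nat.card F ^ 2 - 1) * (Nat.card F ^ 2 - Nat.card F) := by
        rw [show Nat.card F ^ 2 - Nat.card F = Nat.card F * (Nat.card F - 1) by
          rw [Nat.mul_sub, mul_one, sq]]
        ring
    _ ≤ _ := hmain
    _ = _ := by ring

end Quaternion

/-! ### Involutions and blocks -/

theorem Set.ncard_four {X : Type*} {a b c d : X} (hab : a ≠ b) (hac : a ≠ c) (had : a ≠ d)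
    (hbc : b ≠ c) (hbd : b ≠ d) (hcd : c ≠ d) : ({a, b, c, d} : Set X).ncard = 4 := by
  classical
  have : ({a, b, c, d} : Set X) = (({a, b, c, d} : Finset X) : Set X) := by simp
  rw [this, Set.ncard_coe_finset, Finset.card_insert_of_notMem, Finset.card_insert_of_notMem,
    Finset.card_insert_of_notMem, Finset.card_singleton] <;> simp [*]

theorem smul_set_eq_of_mem_zpowers {G X : Type*} [Group G] [MulAction G X] {g : G} {T : Set X}
    (hT : g • T = T) : ∀ s ∈ Subgroup.zpowers g, s • T = T := by
  intro s hs
  have : Subgroup.zpowers g ≤ MulAction.stabilizer G T := by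
    rw [Subgroup.zpowers_le]; exact hT
  exact this hs

/-- The four-group generated by two commuting involutions. -/
def kleinSubgroup {G : Type*} [Group G] {s t : G} (hs : s * s = 1) (ht : t * t = 1)
    (hst : s * t = t * s) : Subgroup G where
  carrier := {1, s, t, s * t}
  one_mem' := by simp
  mul_mem' := by
    have h1 : ∀ x, s * (s * x) = x := fun x => by rw [← mul_assoc, hs, one_mul]
    have h3 : ∀ x, t * (s * x) = s * (t * x) := fun x => by rw [← mul_assoc, ← hst, mul_assoc]
    rintro a b (rfl | rfl | rfl | rfl) (rfl | rfl | rfl | rfl) <;>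
      simp [mul_assoc, hs, ht, ← hst, h1, h3]
  inv_mem' := by
    have hs' : s⁻¹ = s := inv_eq_of_mul_eq_one_left hs
    have ht' : t⁻¹ = t := inv_eq_of_mul_eq_one_left ht
    rintro a (rfl | rfl | rfl | rfl) <;> simp [hs', ht', ← hst]

theorem isPGroup_kleinSubgroup {G : Type*} [Group G] {s t : G} (hs : s * s = 1) (ht : t * t = 1)
    (hst : s * t = t * s) : IsPGroup 2 (kleinSubgroup hs ht hst) := by
  rintro ⟨a, ha⟩
  refine ⟨1, Subtype.ext ?_⟩
  change a ^ 2 ^ 1 = 1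
  rw [pow_one, sq]
  rcases ha with rfl | rfl | rfl | rfl
  · simp
  · exact hs
  · exact ht
  · rw [mul_assoc, ← mul_assoc t, ← hst, mul_assoc s t t, ht, mul_one, hs]

theorem exists_moved_point {X : Type*} {G : Subgroup (Equiv.Perm X)} {g : G} (hg : g ≠ 1) :
    ∃ x : X, g • x ≠ x := by
  by_contra! h
  exact hg (Subtype.ext (Equiv.ext h))

namespace BlockDesign

variable {X : Type*} [Finite X] {v k lam : ℕ} {D : BlockDesign X 4 v k lam}
  {G : Subgroup (Equiv.Perm X)}

/-- If `lam` is odd and the number of points even, then an involution with a fixed point also fixes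
a block through that point: it stabilises two of its fixed points together with a `2`-cycle. -/
theorem exists_block_of_involution (hG : G ≤ D.autGroup) (hlam : ¬ 2 ∣ lam) (hv : 2 ∣ v) {t : G}
    (ht : t * t = 1) (ht1 : t ≠ 1) {a : X} (ha : t • a = a) :
    ∃ C ∈ D.blocks, a ∈ C ∧ t • C = C := by
  have hS : IsPGroup 2 (Subgroup.zpowers t) := isPGroup_zpowers_of_pow (n := 1) (by
    rw [pow_one, sq, ht])
  obtain ⟨b, hb, hab⟩ := hS.exists_fixed_point_of_prime_dvd_card_of_fixed_point X (a := a)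
    (by rw [D.card_points]; exact hv) (by
      rintro ⟨s, hs⟩
      have : Subgroup.zpowers t ≤ MulAction.stabilizer G a := by
        rw [Subgroup.zpowers_le]; exact ha
      exact this hs)
  have hb' : t • b = b := hb ⟨t, Subgroup.mem_zpowers t⟩
  obtain ⟨y, hy⟩ := exists_moved_point ht1
  have hty : t • t • y = y := by rw [← mul_smul, ht, one_smul]
  have hay : a ≠ y := by rintro rfl; exact hy ha
  have hby : b ≠ y := by rintro rfl; exact hy hb'
  have hat : a ≠ t • y := fun h => hay (by
    rw [← ha] at h; exact smul_left_cancel t h)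
  have hbt : b ≠ t • y := fun h => hby (by
    rw [← hb'] at h; exact smul_left_cancel t h)
  obtain ⟨C, hC, hTC, hfix⟩ := exists_fixed_block hG 2 hlam hS (T := {a, b, y, t • y})
    (Set.ncard_four hab hay hat hby hbt hy.symm) (smul_set_eq_of_mem_zpowers (by
      rw [Set.smul_set_insert, Set.smul_set_insert, Set.smul_set_insert, Set.smul_set_singleton,
        ha, hb', hty, Set.pair_comm (t • y)]))
  exact ⟨C, hC, hTC (by simp), hfix t (Subgroup.mem_zpowers t)⟩

/-- If `lam` is odd, a regular four-group fixes a block through each point. -/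
theorem exists_block_of_commuting_involutions (hG : G ≤ D.autGroup) (hlam : ¬ 2 ∣ lam) {s t : G}
    (hs : s * s = 1) (ht : t * t = 1) (hst : s * t = t * s) (x : X) (hsx : s • x ≠ x)
    (htx : t • x ≠ x) (hstx : (s * t) • x ≠ x) :
    ∃ C ∈ D.blocks, x ∈ C ∧ s • C = C ∧ t • C = C := by
  have e1 : s • t • x ≠ x := by rwa [← mul_smul]
  have e2 : s • s • x = x := by rw [← mul_smul, hs, one_smul]
  have e3 : s • s • t • x = t • x := by rw [← mul_smul, hs, one_smul]
  have e4 : t • t • x = x := by rw [← mul_smul, ht, one_smul]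
  have e5 : t • s • x = s • t • x := by rw [← mul_smul, ← hst, mul_smul]
  have e6 : t • s • t • x = s • x := by
    rw [← mul_smul, ← hst, mul_smul, e4]
  have hT : ({x, s • x, t • x, s • t • x} : Set X).ncard = 4 := by
    refine Set.ncard_four hsx.symm htx.symm e1.symm ?_ ?_ ?_
    · intro h
      apply e1
      rw [← h, e2]
    · intro h
      exact htx (smul_left_cancel s h).symm
    · intro h
      have h' := congrArg (fun z => t • z) h
      simp only [e4, e6] at h'
      exact hsx h'.symm
  have hsT : s • ({x, s • x, t • x, s • t • x} : Set X) = {x, s • x, t • x, s • t • x} := by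
    simp only [Set.smul_set_insert, Set.smul_set_singleton, e2, e3]
    ext z; simp only [Set.mem_insert_iff, Set.mem_singleton_iff]; tauto
  have htT : t • ({x, s • x, t • x, s • t • x} : Set X) = {x, s • x, t • x, s • t • x} := by
    simp only [Set.smul_set_insert, Set.smul_set_singleton, e4, e5, e6]
    ext z; simp only [Set.mem_insert_iff, Set.mem_singleton_iff]; tauto
  obtain ⟨C, hC, hTC, hfix⟩ := exists_fixed_block hG 2 hlam (isPGroup_kleinSubgroup hs ht hst) hT
    (by
      rintro g (rfl | rfl | rfl | rfl)
      · exact one_smul _ _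
      · exact hsT
      · exact htT
      · rw [mul_smul, htT, hsT])
  exact ⟨C, hC, hTC (by simp), hfix s (by simp [kleinSubgroup, ← SetLike.mem_coe]),
    hfix t (by simp [kleinSubgroup, ← SetLike.mem_coe])⟩

/-- If `lam` is odd, every element of order four fixes a block. -/
theorem exists_block_of_order_four (hG : G ≤ D.autGroup) (hlam : ¬ 2 ∣ lam) {g : G}
    (hg4 : g ^ 4 = 1) (hg2 : g ^ 2 ≠ 1) : ∃ C ∈ D.blocks, g • C = C := by
  obtain ⟨y, hy⟩ := exists_moved_point hg2
  rw [sq, mul_smul] at hy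
  have h4 : g • g • g • g • y = y := by
    rw [← mul_smul, ← mul_smul, ← mul_smul]
    have : g * g * g * g = 1 := by rw [← hg4]; simp [pow_succ]
    rw [this, one_smul]
  have h1 : g • y ≠ y := fun h => hy (by rw [h, h])
  have h3 : g • g • g • y ≠ y := by
    intro h
    rw [h] at h4
    exact h1 h4
  obtain ⟨C, hC, -, hfix⟩ := exists_fixed_block hG 2 hlam
    (isPGroup_zpowers_of_pow (g := g) (p := 2) (n := 2) hg4)
    (T := {y, g • y, g • g • y, g • g • g • y})
    (Set.ncard_four h1.symm hy.symm h3.symm (fun h => h1 (smul_left_cancel g h).symm)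
      (fun h => hy (smul_left_cancel g h).symm)
      (fun h => h1 (smul_left_cancel g (smul_left_cancel g h)).symm))
    (smul_set_eq_of_mem_zpowers (by
      simp only [Set.smul_set_insert, Set.smul_set_singleton, h4]
      ext z; simp only [Set.mem_insert_iff, Set.mem_singleton_iff]; tauto))
  exact ⟨C, hC, hfix g (Subgroup.mem_zpowers g)⟩

/-- If `lam` is odd and involutions are fixed-point free, every pair of commuting involutions fixes
at least `v / k` blocks; counting these pairs block by block bounds their number. -/
theorem FlagTransitive.mul_ncard_commutingInvolutions_le (h : D.FlagTransitive G)
    (hG : G ≤ D.autGroup) (hk : 0 < k) (hlam : ¬ 2 ∣ lam)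
    (hfpf : ∀ t : G, t * t = 1 → t ≠ 1 → ∀ x : X, t • x ≠ x) {B : Set X} (hB : B ∈ D.blocks) :
    v * (commutingInvolutions G).ncard ≤
      k * (D.blocks.ncard * (commutingInvolutions (MulAction.stabilizer G B)).ncard) := by
  classical
  have := Fintype.ofFinite X
  have := Fintype.ofFinite G
  set P := (commutingInvolutions G).toFinset
  set 𝓑 := D.blocks.toFinset
  have hdc := Finset.sum_card_bipartiteAbove_eq_sum_card_bipartiteBelow
    (fun (z : G × G) (C : Set X) => z.1 • C = C ∧ z.2 • C = C) (s := P) (t := 𝓑)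
  have hbelow : ∀ C ∈ 𝓑, (Finset.bipartiteBelow
      (fun (z : G × G) (C : Set X) => z.1 • C = C ∧ z.2 • C = C) P C).card =
      (commutingInvolutions (MulAction.stabilizer G B)).ncard := by
    intro C hC
    obtain ⟨e⟩ := h.nonempty_stabilizer_mulEquiv hk hB (Set.mem_toFinset.1 hC)
    rw [← ncard_commutingInvolutions_congr e, ← Set.ncard_coe_finset,
      ← Set.ncard_image_of_injective (commutingInvolutions (MulAction.stabilizer G C))
        (f := Prod.map Subtype.val Subtype.val)
        (Subtype.val_injective.prodMap Subtype.val_injective)]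
    congr 1
    ext ⟨s, t⟩
    simp only [Finset.bipartiteBelow, Finset.coe_filter, Set.mem_ofPred_eq, Set.mem_image,
      Prod.exists, P, Set.mem_toFinset]
    constructor
    · rintro ⟨⟨h1, h2, h3, h4, h5, h6⟩, hs, ht⟩
      refine ⟨⟨s, hs⟩, ⟨t, ht⟩, ⟨Subtype.ext h1, Subtype.ext h2, ?_, ?_, ?_, Subtype.ext h6⟩, rfl⟩
      · exact fun h => h3 (congrArg Subtype.val h)
      · exact fun h => h4 (congrArg Subtype.val h)
      · exact fun h => h5 (congrArg Subtype.val h)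
    · rintro ⟨⟨s', hs⟩, ⟨t', ht⟩, ⟨h1, h2, h3, h4, h5, h6⟩, hst⟩
      obtain ⟨rfl, rfl⟩ := Prod.mk.inj hst
      refine ⟨⟨congrArg Subtype.val h1, congrArg Subtype.val h2, ?_, ?_, ?_,
        congrArg Subtype.val h6⟩, hs, ht⟩
      · exact fun h => h3 (Subtype.ext h)
      · exact fun h => h4 (Subtype.ext h)
      · exact fun h => h5 (Subtype.ext h)
  have habove : ∀ z ∈ P, v ≤ k * (Finset.bipartiteAbove
      (fun (z : G × G) (C : Set X) => z.1 • C = C ∧ z.2 • C = C) 𝓑 z).card := by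
    intro z hz
    obtain ⟨h1, h2, h3, h4, h5, h6⟩ := Set.mem_toFinset.1 hz
    set A := Finset.bipartiteAbove
      (fun (z : G × G) (C : Set X) => z.1 • C = C ∧ z.2 • C = C) 𝓑 z with hA
    have hst1 : z.1 * z.2 * (z.1 * z.2) = 1 := by
      rw [mul_assoc, ← mul_assoc z.2, ← h6, mul_assoc z.1 z.2 z.2, h2, mul_one, h1]
    have hst2 : z.1 * z.2 ≠ 1 := fun h => h5 (by
      rw [← h2] at h; exact mul_right_cancel h)
    have hcover : (Finset.univ : Finset X) ⊆ A.biUnion fun C => C.toFinset := by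
      intro x _
      obtain ⟨C, hC, hxC, hs, ht⟩ := exists_block_of_commuting_involutions hG hlam h1 h2 h6 x
        (hfpf _ h1 h3 x) (hfpf _ h2 h4 x) (hfpf _ hst1 hst2 x)
      exact Finset.mem_biUnion.2 ⟨C, Finset.mem_filter.2 ⟨Set.mem_toFinset.2 hC, hs, ht⟩,
        Set.mem_toFinset.2 hxC⟩
    have h7 := Finset.card_le_card hcover
    rw [Finset.card_univ, ← Nat.card_eq_fintype_card, D.card_points] at h7
    refine h7.trans ?_
    rw [mul_comm]
    refine Finset.card_biUnion_le_card_mul _ _ _ fun C hC => ?_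
    rw [← Set.ncard_eq_toFinset_card', D.card_block C
      (Set.mem_toFinset.1 (Finset.mem_filter.1 hC).1)]
  rw [Finset.sum_congr rfl hbelow, Finset.sum_const, smul_eq_mul,
    ← Set.ncard_eq_toFinset_card'] at hdc
  rw [← hdc, Finset.mul_sum, Set.ncard_eq_toFinset_card', mul_comm, ← smul_eq_mul,
    ← Finset.sum_const]
  exact Finset.sum_le_sum habove

end BlockDesign

/-! ### Projective linear groups -/

section Projective

variable {K : Type*} [Field K]

theorem SL_two_mem_center_iff (A : SL(2, K)) : A ∈ Subgroup.center SL(2, K) ↔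
    ∃ c : K, (A : Matrix (Fin 2) (Fin 2) K) = c • (1 : Matrix (Fin 2) (Fin 2) K) := by
  rw [Matrix.SpecialLinearGroup.mem_center_iff]
  constructor
  · rintro ⟨r, -, hr⟩
    exact ⟨r, by rw [← hr, Matrix.smul_one_eq_diagonal]; rfl⟩
  · rintro ⟨c, hc⟩
    refine ⟨c, ?_, ?_⟩
    · have := A.2
      rwa [hc, Matrix.det_smul, Matrix.det_one, mul_one] at this
    · rw [hc, Matrix.smul_one_eq_diagonal]; rfl

theorem GL_two_mem_center_iff (A : GL (Fin 2) K) : A ∈ Subgroup.center (GL (Fin 2) K) ↔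
    ∃ c : K, (A : Matrix (Fin 2) (Fin 2) K) = c • (1 : Matrix (Fin 2) (Fin 2) K) := by
  rw [Matrix.GeneralLinearGroup.center_eq_range_scalar]
  constructor
  · rintro ⟨r, rfl⟩
    exact ⟨r, by rw [Matrix.smul_one_eq_diagonal]; rfl⟩
  · rintro ⟨c, hc⟩
    have hc0 : c ≠ 0 := by
      rintro rfl
      have : (A : Matrix (Fin 2) (Fin 2) K).det ≠ 0 := A.det_ne_zero
      rw [hc] at this
      simp at this
    refine ⟨Units.mk0 c hc0, ?_⟩
    ext1
    rw [hc, Matrix.smul_one_eq_diagonal]; rfl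

/-- The cover `SL(2, K) → G` of the copy of `PSL(2, K)` in `G` that is given by an embedded group
`H` isomorphic to `PSL(2, K)`. -/
noncomputable def PlaneCover.ofPSL {H G : Type*} [Group H] [Group G]
    (e : H ≃* Matrix.ProjectiveSpecialLinearGroup (Fin 2) K) (i : H →* G)
    (hi : Function.Injective i) : PlaneCover K SL(2, K) G where
  mat := (Units.coeHom _).comp Matrix.SpecialLinearGroup.toGL
  mat_injective := Units.val_injective.comp Matrix.SpecialLinearGroup.toGL_injective
  exists_mat_eq A hA := ⟨⟨A, hA⟩, rfl⟩
  hom := i.comp (e.symm.toMonoidHom.comp (QuotientGroup.mk' _))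
  hom_eq_one_iff A := by
    refine Iff.trans ?_ (SL_two_mem_center_iff A)
    rw [← QuotientGroup.eq_one_iff, MonoidHom.comp_apply, map_eq_one_iff i hi]
    exact map_eq_one_iff e.symm e.symm.injective

/-- The cover `GL(2, K) → G` of the copy of `PGL(2, K)` in `G` that is given by an embedded group
`H` isomorphic to `PGL(2, K)`. -/
noncomputable def PlaneCover.ofPGL {H G : Type*} [Group H] [Group G]
    (e : H ≃* Matrix.ProjGenLinGroup (Fin 2) K) (i : H →* G)
    (hi : Function.Injective i) : PlaneCover K (GL (Fin 2) K) G where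
  mat := Units.coeHom _
  mat_injective := Units.val_injective
  exists_mat_eq A hA := ⟨Matrix.GeneralLinearGroup.mkOfDetNeZero A (by simp [hA]), rfl⟩
  hom := i.comp (e.symm.toMonoidHom.comp Matrix.ProjGenLinGroup.mk)
  hom_eq_one_iff A := by
    rw [Units.coeHom_apply, ← GL_two_mem_center_iff, ← Matrix.ProjGenLinGroup.mk_eq_one,
      MonoidHom.comp_apply, map_eq_one_iff i hi]
    exact map_eq_one_iff e.symm e.symm.injective

theorem PlaneCover.range_ofPSL {H G : Type*} [Group H] [Group G]
    (e : H ≃* Matrix.ProjectiveSpecialLinearGroup (Fin 2) K) (i : H →* G)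
    (hi : Function.Injective i) : (PlaneCover.ofPSL e i hi).hom.range = i.range := by
  apply le_antisymm
  · rintro _ ⟨A, rfl⟩; exact ⟨_, rfl⟩
  · rintro _ ⟨h, rfl⟩
    obtain ⟨A, hA⟩ := QuotientGroup.mk'_surjective (Subgroup.center SL(2, K)) (e h)
    refine ⟨A, ?_⟩
    change i (e.symm (QuotientGroup.mk' _ A)) = i h
    rw [hA, e.symm_apply_apply]

theorem PlaneCover.range_ofPGL {H G : Type*} [Group H] [Group G]
    (e : H ≃* Matrix.ProjGenLinGroup (Fin 2) K) (i : H →* G)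
    (hi : Function.Injective i) : (PlaneCover.ofPGL e i hi).hom.range = i.range := by
  apply le_antisymm
  · rintro _ ⟨A, rfl⟩; exact ⟨_, rfl⟩
  · rintro _ ⟨h, rfl⟩
    obtain ⟨A, hA⟩ := Matrix.ProjGenLinGroup.mk_surjective (e h)
    refine ⟨A, ?_⟩
    change i (e.symm (Matrix.ProjGenLinGroup.mk A)) = i h
    rw [hA, e.symm_apply_apply]

/-- The order of the centre of `SL(2, q)`, as a function of the prime power `q`. -/
def slCenterOrder (q : ℕ) : ℕ := if Even q then 1 else 2

theorem two_ne_zero_iff_not_even_card [Finite K] : (2 : K) ≠ 0 ↔ ¬ Even (Nat.card K) := by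
  have := Fintype.ofFinite K
  rw [Nat.card_eq_fintype_card, not_iff_not, Nat.even_iff]
  constructor
  · intro h
    apply FiniteField.even_card_of_char_two
    by_contra h2
    exact Ring.two_ne_zero h2 h
  · intro h
    by_contra h2
    have h3 : ringChar K ≠ 2 := by
      intro h3
      apply h2
      have := CharP.cast_eq_zero K (ringChar K)
      rw [h3] at this
      exact_mod_cast this
    have := FiniteField.odd_card_of_char_ne_two h3
    omega

theorem card_center_SL_two [Finite K] :
    Nat.card (Subgroup.center SL(2, K)) = slCenterOrder (Nat.card K) := by
  have h1 : ((fun A : SL(2, K) => (A : Matrix (Fin 2) (Fin 2) K)) ''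
      (Subgroup.center SL(2, K) : Set SL(2, K))) = {1, -1} := by
    ext A
    simp only [Set.mem_image, SetLike.mem_coe, SL_two_mem_center_iff, Set.mem_insert_iff,
      Set.mem_singleton_iff]
    constructor
    · rintro ⟨B, ⟨c, hc⟩, rfl⟩
      have hc2 : c * c = 1 := by
        have := B.2
        rw [hc, Matrix.det_smul] at this
        simpa [sq] using this
      rcases mul_self_eq_one_iff.1 hc2 with rfl | rfl
      · left; simpa using hc
      · right; simpa using hc
    · rintro (rfl | rfl)
      · exact ⟨1, ⟨1, by simp⟩, rfl⟩
      · exact ⟨-1, ⟨-1, by simp⟩, by simp⟩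
  have hinj : Function.Injective (fun A : SL(2, K) => (A : Matrix (Fin 2) (Fin 2) K)) :=
    fun A B h => Subtype.ext h
  refine ((Set.ncard_image_of_injective _ hinj).symm.trans (congrArg Set.ncard h1)).trans ?_
  unfold slCenterOrder
  have h3 : (1 : Matrix (Fin 2) (Fin 2) K) = -1 ↔ (2 : K) = 0 := by
    constructor
    · intro h
      have := congrFun (congrFun h 0) 0
      simp at this
      linear_combination this
    · intro h
      have h' : (1 : K) = -1 := by linear_combination h
      simpa using congrArg (fun c : K => c • (1 : Matrix (Fin 2) (Fin 2) K)) h'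
  split_ifs with he
  · rw [← h3.2 (by by_contra h; exact two_ne_zero_iff_not_even_card.1 h he), Set.pair_eq_singleton,
      Set.ncard_singleton]
  · rw [Set.ncard_pair]
    exact fun h => two_ne_zero_iff_not_even_card.2 he (h3.1 h)

theorem card_PSL_two [Finite K] :
    slCenterOrder (Nat.card K) * Nat.card (Matrix.ProjectiveSpecialLinearGroup (Fin 2) K) =
      Nat.card K * (Nat.card K ^ 2 - 1) := by
  rw [← card_center_SL_two, ← card_SL_two, mul_comm]
  exact (Subgroup.card_eq_card_quotient_mul_card_subgroup _).symm

theorem card_PGL_two [Finite K] :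
    Nat.card (Matrix.ProjGenLinGroup (Fin 2) K) = Nat.card K * (Nat.card K ^ 2 - 1) := by
  have h1 : Nat.card (GL (Fin 2) K) = Nat.card (Matrix.ProjGenLinGroup (Fin 2) K) *
      Nat.card (Subgroup.center (GL (Fin 2) K)) :=
    Subgroup.card_eq_card_quotient_mul_card_subgroup _
  have h2 : Nat.card (Subgroup.center (GL (Fin 2) K)) = Nat.card K - 1 := by
    rw [Matrix.GeneralLinearGroup.center_eq_range_scalar, ← Nat.card_units]
    refine (Nat.card_congr (MonoidHom.ofInjective ?_).toEquiv).symm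
    intro a b hab
    have := congrArg (fun A : GL (Fin 2) K => (A : Matrix (Fin 2) (Fin 2) K) 0 0) hab
    ext
    simpa using this
  have hq : 1 < Nat.card K := Finite.one_lt_card
  rw [h2, card_GL_two] at h1
  apply Nat.eq_of_mul_eq_mul_right (show 0 < Nat.card K - 1 by omega)
  rw [← h1, show Nat.card K ^ 2 - Nat.card K = Nat.card K * (Nat.card K - 1) by
    rw [Nat.mul_sub, mul_one, sq]]
  ring

theorem slCenterOrder_pow (x : ℕ) {g : ℕ} (hg : g ≠ 0) :
    slCenterOrder (x ^ g) = slCenterOrder x := by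
  simp [slCenterOrder, Nat.even_pow, hg]

theorem charP_of_card_pow {F : Type*} [Field F] [Finite F] [Finite K] {p g : ℕ}
    [hF : CharP F p] (hg : g ≠ 0) (h : Nat.card K ^ g = Nat.card F) : CharP K p := by
  obtain ⟨p', n, hp', hc, hn, hcard⟩ := exists_char_and_card_eq_pow K
  obtain ⟨p'', m, hp'', hc', hm, hcard'⟩ := exists_char_and_card_eq_pow F
  have h1 : p = p'' := CharP.eq F hF hc'
  have h2 : p' ∣ p'' ^ m := by
    rw [← hcard', ← h, hcard, ← pow_mul]
    exact dvd_pow_self _ (Nat.mul_ne_zero hn hg)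
  have h3 : p' = p'' := (Nat.prime_dvd_prime_iff_eq hp' hp'').1 (hp'.dvd_of_dvd_pow h2)
  rw [h1, ← h3]
  exact hc

end Projective

/-! ### Blocks stabilised by a subfield subgroup -/

/-- The form of `subfield_block_false` for natural numbers, with the order `x * (x ^ 2 - 1)` of
`PGL(2, x)`. -/
theorem subfield_block_false_nat {x k L g : ℕ} (hx : 2 ≤ x) (hg : 2 ≤ g) (hL : 10 < L)
    (hk : 4 < k) (hkq : k ≤ x ^ g)
    (h : L * (x ^ g - 2) * (x * (x ^ 2 - 1)) = k * (k - 1) * (k - 2) * (k - 3))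
    (hcases : k = x + 1 ∨ k * (x + 1) = x * (x ^ 2 - 1) ∨ k = x * (x ^ 2 - 1) ∨
      2 * k = x * (x ^ 2 - 1)) : False := by
  have hx1 : 1 ≤ x ^ 2 := Nat.one_le_pow _ _ (by omega)
  have hxg : 2 ≤ x ^ g := by omega
  zify [hx1, hxg, show 1 ≤ k by omega, show 2 ≤ k by omega, show 3 ≤ k by omega] at h hcases hkq
  refine subfield_block_false (x := x) (k := k) (L := L) (g := g) (by omega) hg (by omega)
    (by omega) hkq (by linear_combination h) ?_
  rcases hcases with h1 | h1 | h1 | h1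
  · exact Or.inl h1
  · refine Or.inr (Or.inl ?_)
    apply mul_right_cancel₀ (show (x : ℤ) + 1 ≠ 0 by omega)
    linear_combination h1
  · exact Or.inr (Or.inr (Or.inl (by linear_combination h1)))
  · exact Or.inr (Or.inr (Or.inr (by linear_combination h1)))

theorem two_dvd_natCard_of_involution {H : Type*} [Group H] {t : H} (ht : t * t = 1)
    (ht1 : t ≠ 1) : 2 ∣ Nat.card H := by
  rw [← orderOf_eq_prime (p := 2) (by rw [sq, ht]) ht1]
  exact orderOf_dvd_natCard t

theorem exists_involution_of_two_dvd {H : Type*} [Group H] [Finite H] (h : 2 ∣ Nat.card H) :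
    ∃ t : H, t * t = 1 ∧ t ≠ 1 := by
  obtain ⟨t, ht⟩ := exists_prime_orderOf_dvd_card' 2 h
  refine ⟨t, ?_, ?_⟩
  · rw [← sq, ← ht, pow_orderOf_eq_one]
  · rintro rfl; simp at ht

theorem slCenterOrder_eq (q : ℕ) : slCenterOrder q = 1 ∨ slCenterOrder q = 2 := by
  unfold slCenterOrder; split_ifs <;> simp

theorem slCenterOrder_mul_card {F G : Type*} [Field F] [Finite F] [Group G]
    (e : G ≃* Matrix.ProjectiveSpecialLinearGroup (Fin 2) F) :
    slCenterOrder (Nat.card F) * Nat.card G = Nat.card F * (Nat.card F ^ 2 - 1) := by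
  rw [Nat.card_congr e.toEquiv, card_PSL_two]

/-- In characteristic two an involution `t` has at most one fixed point. An element `g` for which
`t` commutes with its conjugate `g * t * g⁻¹` therefore fixes that point. -/
theorem LineModel.smul_eq_of_commute_conj {F G X : Type*} [Field F] [CharP F 2] [Group G]
    [MulAction G X] (M : LineModel F G X) {t g : G} (ht : t * t = 1)
    (ht1 : t ≠ 1) {x : X} (hx : t • x = x) (hc : g * t * g⁻¹ * t = t * (g * t * g⁻¹)) :
    g • x = x := by
  have : Fact (Nat.Prime 2) := ⟨Nat.prime_two⟩
  by_contra hne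
  have huniq : ∀ y, t • y = y → y = x := by
    intro y hy
    by_contra hyx
    exact ht1 (M.eq_one_of_pow_char_of_two_fixed 2 (by rw [sq, ht]) hyx hy hx)
  have h1 : (g * t * g⁻¹) • x = x := by
    apply huniq
    rw [← mul_smul, ← hc, mul_smul, hx]
  have h2 : (g * t * g⁻¹) • g • x = g • x := by
    rw [← mul_smul, inv_mul_cancel_right, mul_smul, hx]
  have h3 : (g * t * g⁻¹) ^ 2 = 1 := by
    rw [sq, show g * t * g⁻¹ * (g * t * g⁻¹) = g * (t * t) * g⁻¹ by group, ht]; group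
  have h4 := M.eq_one_of_pow_char_of_two_fixed 2 h3 hne h2 h1
  apply ht1
  rw [show t = g⁻¹ * (g * t * g⁻¹) * g by group, h4]; group

namespace BlockDesign

variable {X : Type*} [Finite X] {t v k lam : ℕ}

theorem exists_mem_block (D : BlockDesign X t v k lam) {B : Set X} (hk : 0 < k)
    (hB : B ∈ D.blocks) : ∃ x, x ∈ B :=
  Set.nonempty_of_ncard_ne_zero (by rw [D.card_block B hB]; omega)

/-- A block is an orbit of any cover of its stabiliser. -/
theorem FlagTransitive.range_smul_eq_block {K Γ : Type*} [Field K] [Group Γ]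
    {D : BlockDesign X t v k lam} {G : Subgroup (Equiv.Perm X)} (h : D.FlagTransitive G)
    {B : Set X} (hB : B ∈ D.blocks) {x : X} (hx : x ∈ B) (P : PlaneCover K Γ G)
    (hP : P.hom.range = MulAction.stabilizer G B) : (Set.range fun γ => P.hom γ • x) = B := by
  conv_rhs => rw [h.block_eq_orbit hB hx]
  ext y
  constructor
  · rintro ⟨γ, rfl⟩
    exact ⟨⟨P.hom γ, by rw [← hP]; exact ⟨γ, rfl⟩⟩, rfl⟩
  · rintro ⟨⟨g, hg⟩, rfl⟩
    rw [← hP] at hg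
    obtain ⟨γ, rfl⟩ := hg
    exact ⟨γ, rfl⟩

theorem FlagTransitive.exists_mul_eq_card_stabilizer {D : BlockDesign X t v k lam}
    {G : Subgroup (Equiv.Perm X)} (h : D.FlagTransitive G)
    (hk : 0 < k) {B : Set X}
    (hB : B ∈ D.blocks) : ∃ m, k * m = Nat.card (setwiseStabilizer G B) := by
  obtain ⟨x, hx⟩ := exists_mem_block D hk hB
  exact ⟨_, h.mul_card_point_stabilizer hB hx⟩

end BlockDesign

namespace BlockDesign.FlagTransitive

variable {F : Type*} [Field F] [Finite F] {X : Type*} [Finite X] {k lam : ℕ}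
  {D : BlockDesign X 4 (Nat.card F + 1) k lam} {G : Subgroup (Equiv.Perm X)}

theorem nonempty_lineModel (h : D.FlagTransitive G) (hlam : 0 < lam) (hk : 4 < k)
    (hkq : k < Nat.card F + 1) (e : G ≃* Matrix.ProjectiveSpecialLinearGroup (Fin 2) F) :
    Nonempty (LineModel F G X) := by
  have := h.isPretransitive hlam (by omega) (by omega)
  refine LineModel.nonempty_of_isPretransitive D.card_points
    (PlaneCover.ofPSL e (MonoidHom.id G) Function.injective_id).hom ?_
    (PlaneCover.ofPSL e (MonoidHom.id G) Function.injective_id).hom_eq_one_iff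
  rw [← MonoidHom.range_eq_top, PlaneCover.range_ofPSL]
  exact MonoidHom.range_eq_top.2 Function.surjective_id

theorem not_dvd_card_points (D : BlockDesign X 4 (Nat.card F + 1) k lam) (p : ℕ) [Fact p.Prime]
    [CharP F p] : ¬ p ∣ Nat.card X := by
  obtain ⟨p', n, hp, hc, hn, hcard⟩ := exists_char_and_card_eq_pow F
  have hpp : p = p' := CharP.eq F ‹CharP F p› hc
  subst hpp
  rw [D.card_points, hcard]
  intro h
  have := (Nat.dvd_add_right (dvd_pow_self p hn)).1 h
  exact hp.one_lt.ne' (Nat.dvd_one.1 this)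

/-- The block is an orbit of a subfield subgroup, so its length is known, and the parameter equation
has no solution with that length. -/
theorem stabilizer_ne_PSL (h : D.FlagTransitive G) (hlam : 10 < lam) (hk : 4 < k)
    (hkq : k < Nat.card F + 1) (hG : G ≤ D.autGroup)
    (e : G ≃* Matrix.ProjectiveSpecialLinearGroup (Fin 2) F) {B : Set X} (hB : B ∈ D.blocks)
    {K : Type*} [Field K] [Finite K] {g : ℕ} (hg : 1 ≤ g) (hK : Nat.card K ^ g = Nat.card F) :
    ¬ Nonempty (setwiseStabilizer G B ≃* Matrix.ProjectiveSpecialLinearGroup (Fin 2) K) := by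
  rintro ⟨eB⟩
  obtain ⟨x, hx⟩ := exists_mem_block D (by omega) hB
  have hn : slCenterOrder (Nat.card F) * Nat.card (setwiseStabilizer G B) =
      Nat.card K * (Nat.card K ^ 2 - 1) := by
    rw [Nat.card_congr eB.toEquiv, ← hK, slCenterOrder_pow _ (by omega), card_PSL_two]
  rcases hg.eq_or_lt with rfl | hg2
  · -- for `g = 1` the block is invariant under the whole group, hence consists of all points
    rw [pow_one] at hK
    have h1 : Nat.card (setwiseStabilizer G B) = Nat.card G := by
      apply Nat.eq_of_mul_eq_mul_left (show 0 < slCenterOrder (Nat.card F) by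
        rcases slCenterOrder_eq (Nat.card F) with h | h <;> omega)
      rw [hn, slCenterOrder_mul_card e, hK]
    have h2 : MulAction.stabilizer G B = ⊤ := Subgroup.eq_top_of_card_eq _ h1
    have := h.isPretransitive (by omega) (by omega) (by omega)
    have h3 : B = Set.univ := by
      ext y
      refine ⟨fun _ => trivial, fun _ => ?_⟩
      obtain ⟨g, rfl⟩ := MulAction.exists_smul_eq G x y
      have hgB : g • B = B := by
        rw [← MulAction.mem_stabilizer_iff, h2]; trivial
      rw [← hgB]
      exact Set.smul_mem_smul_set hx
    have h4 := D.card_block B hB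
    rw [h3, Set.ncard_univ, D.card_points] at h4
    omega
  obtain ⟨m⟩ := h.nonempty_lineModel (by omega) hk hkq e
  obtain ⟨p, j, hp, hc, hj, hcard⟩ := exists_char_and_card_eq_pow F
  have : Fact p.Prime := ⟨hp⟩
  have hcK : CharP K p := charP_of_card_pow (F := F) (by omega) hK
  set P : PlaneCover K SL(2, K) G := PlaneCover.ofPSL eB (Subgroup.subtype _)
    (Subgroup.subtype_injective _)
  have hP : P.hom.range = MulAction.stabilizer G B := by
    rw [PlaneCover.range_ofPSL, Subgroup.range_subtype]; rfl
  have horb := P.ncard_orbit_SL (fun _ => rfl) m p (not_dvd_card_points D p) x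
  rw [h.range_smul_eq_block hB hx P hP, D.card_block B hB, hP, card_SL_two] at horb
  have heq := h.parameter_eq hG hk hkq (slCenterOrder_mul_card e) hB
  rw [hn, ← hK] at heq
  refine subfield_block_false_nat (x := Nat.card K) (k := k) (L := lam) (g := g)
    Finite.one_lt_card hg2 hlam hk (by omega) heq ?_
  rcases horb with h1 | h1 | h1
  · exact Or.inl h1
  · change k = Nat.card (setwiseStabilizer G B) at h1
    rw [← h1] at hn
    rcases slCenterOrder_eq (Nat.card F) with hd | hd
    · right; right; left
      rw [← hn, hd, one_mul]
    · right; right; right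
      rw [← hn, hd]
  · exact Or.inr (Or.inl h1)

theorem stabilizer_ne_PGL (h : D.FlagTransitive G) (hlam : 10 < lam) (hk : 4 < k)
    (hkq : k < Nat.card F + 1) (hG : G ≤ D.autGroup)
    (e : G ≃* Matrix.ProjectiveSpecialLinearGroup (Fin 2) F) {B : Set X} (hB : B ∈ D.blocks)
    {K : Type*} [Field K] [Finite K] {g : ℕ} (hg : 1 < g) (hK : Nat.card K ^ g = Nat.card F) :
    ¬ Nonempty (setwiseStabilizer G B ≃* Matrix.ProjGenLinGroup (Fin 2) K) := by
  rintro ⟨eB⟩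
  obtain ⟨x, hx⟩ := exists_mem_block D (by omega) hB
  have hn : Nat.card (setwiseStabilizer G B) = Nat.card K * (Nat.card K ^ 2 - 1) := by
    rw [Nat.card_congr eB.toEquiv, card_PGL_two]
  obtain ⟨m⟩ := h.nonempty_lineModel (by omega) hk hkq e
  obtain ⟨p, j, hp, hc, hj, hcard⟩ := exists_char_and_card_eq_pow F
  have : Fact p.Prime := ⟨hp⟩
  have hcK : CharP K p := charP_of_card_pow (F := F) (by omega) hK
  set P : PlaneCover K (GL (Fin 2) K) G := PlaneCover.ofPGL eB (Subgroup.subtype _)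
    (Subgroup.subtype_injective _)
  have hP : P.hom.range = MulAction.stabilizer G B := by
    rw [PlaneCover.range_ofPGL, Subgroup.range_subtype]; rfl
  have horb := P.ncard_orbit_GL (fun _ => rfl) m p (not_dvd_card_points D p) x
  rw [h.range_smul_eq_block hB hx P hP, D.card_block B hB, hP, card_GL_two] at horb
  have heq := h.parameter_eq hG hk hkq (slCenterOrder_mul_card e) hB
  rw [hn, ← hK] at heq
  have hx1 : 1 < Nat.card K := Finite.one_lt_card
  refine subfield_block_false_nat (x := Nat.card K) (k := k)
    (L := lam * slCenterOrder (Nat.card K ^ g)) (g := g) hx1 hg ?_ hk (by omega)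
    (by rw [← heq]; ring) ?_
  · rcases slCenterOrder_eq (Nat.card K ^ g) with hd | hd <;> rw [hd] <;> omega
  rcases horb with h1 | h1 | h1
  · exact Or.inl h1
  · change k = Nat.card (setwiseStabilizer G B) at h1
    rw [hn] at h1
    exact Or.inr (Or.inr (Or.inl h1))
  · right; left
    have hpos : 0 < Nat.card K ^ 2 - 1 := by
      have : 1 < Nat.card K ^ 2 := Nat.one_lt_pow (by omega) hx1
      omega
    have h2 : k = Nat.card K * (Nat.card K - 1) := by
      apply Nat.eq_of_mul_eq_mul_right hpos
      rw [h1, show Nat.card K ^ 2 - Nat.card K = Nat.card K * (Nat.card K - 1) by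
        rw [Nat.mul_sub, mul_one, sq], mul_comm]
    rw [h2, mul_assoc, mul_comm (Nat.card K - 1), ← Nat.sq_sub_sq, one_pow]

/-! ### Point stabilisers, involutions and elements of order four -/

theorem slCenterOrder_mul_card_point_stabilizer (h : D.FlagTransitive G) (hlam : 0 < lam)
    (hk : 4 < k) (hkq : k < Nat.card F + 1)
    (e : G ≃* Matrix.ProjectiveSpecialLinearGroup (Fin 2) F) (x : X) :
    slCenterOrder (Nat.card F) * Nat.card (MulAction.stabilizer G x) =
      Nat.card F * (Nat.card F - 1) := by
  have := h.isPretransitive hlam (by omega) (by omega)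
  have h1 := (MulAction.stabilizer G x).card_mul_index
  rw [MulAction.index_stabilizer_of_transitive, D.card_points] at h1
  have h2 := slCenterOrder_mul_card e
  rw [← h1] at h2
  apply Nat.eq_of_mul_eq_mul_right (show 0 < Nat.card F + 1 by omega)
  rw [mul_assoc, h2, mul_assoc, mul_comm (Nat.card F - 1), ← Nat.sq_sub_sq, one_pow]

theorem card_point_stabilizer_of_odd (h : D.FlagTransitive G) (hlam : 0 < lam)
    (hk : 4 < k) (hkq : k < Nat.card F + 1)
    (e : G ≃* Matrix.ProjectiveSpecialLinearGroup (Fin 2) F) (x : X)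
    (hodd : Nat.card F % 2 = 1) :
    Nat.card (MulAction.stabilizer G x) = Nat.card F * ((Nat.card F - 1) / 2) := by
  have h1 := h.slCenterOrder_mul_card_point_stabilizer hlam hk hkq e x
  have hd : slCenterOrder (Nat.card F) = 2 := by
    unfold slCenterOrder; rw [if_neg]; rw [Nat.even_iff]; omega
  rw [hd] at h1
  apply Nat.eq_of_mul_eq_mul_left two_pos
  rw [h1, mul_left_comm]
  congr 1
  omega

/-- If `q ≡ 1` modulo `4`, involutions have fixed points, and if `lam` is odd they then lie in flag
stabilisers; here `m` is the order of a flag stabiliser. -/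
theorem even_of_mod_four_eq_one (h : D.FlagTransitive G) (hlam : 0 < lam) (hk : 4 < k)
    (hkq : k < Nat.card F + 1) (hG : G ≤ D.autGroup)
    (e : G ≃* Matrix.ProjectiveSpecialLinearGroup (Fin 2) F) {B : Set X} (hB : B ∈ D.blocks)
    {m : ℕ} (hm : k * m = Nat.card (setwiseStabilizer G B)) (hq : Nat.card F % 4 = 1)
    (hlo : ¬ 2 ∣ lam) : 2 ∣ m := by
  obtain ⟨x, hx⟩ := exists_mem_block D (by omega) hB
  have h1 := h.card_point_stabilizer_of_odd hlam hk hkq e x (by omega)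
  obtain ⟨⟨t, htx⟩, ht, ht1⟩ := exists_involution_of_two_dvd
    (H := MulAction.stabilizer G x) (by
      rw [h1]; exact Dvd.dvd.mul_left (by omega) _)
  have ht' : t * t = 1 := congrArg Subtype.val ht
  have ht1' : t ≠ 1 := fun h => ht1 (Subtype.ext h)
  obtain ⟨C, hC, hxC, htC⟩ := exists_block_of_involution hG hlo (by omega) ht' ht1' htx
  have h2 := h.mul_card_point_stabilizer hC hxC
  obtain ⟨eC⟩ := h.nonempty_stabilizer_mulEquiv (by omega) hB hC
  rw [Nat.card_congr eC.toEquiv] at h2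
  have h3 : m = Nat.card (MulAction.stabilizer (MulAction.stabilizer G C) x) :=
    Nat.eq_of_mul_eq_mul_left (show 0 < k by omega) (hm.trans h2.symm)
  rw [h3]
  exact two_dvd_natCard_of_involution (t := ⟨⟨t, htC⟩, htx⟩) (Subtype.ext (Subtype.ext ht'))
    (fun h => ht1' (Subtype.ext_iff.1 (Subtype.ext_iff.1 h)))

theorem smul_ne_of_mod_four_eq_three (h : D.FlagTransitive G) (hlam : 0 < lam) (hk : 4 < k)
    (hkq : k < Nat.card F + 1)
    (e : G ≃* Matrix.ProjectiveSpecialLinearGroup (Fin 2) F) (hq : Nat.card F % 4 = 3)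
    {t : G} (ht : t * t = 1) (ht1 : t ≠ 1) (x : X) : t • x ≠ x := by
  intro hx
  have h1 := h.card_point_stabilizer_of_odd hlam hk hkq e x (by omega)
  have h2 := two_dvd_natCard_of_involution (H := MulAction.stabilizer G x) (t := ⟨t, hx⟩)
    (Subtype.ext ht) (fun h => ht1 (congrArg Subtype.val h))
  rw [h1] at h2
  rcases Nat.prime_two.dvd_mul.1 h2 with h3 | h3 <;> omega

/-- If `q ≡ 3` modulo `4`, involutions have no fixed points, so flag stabilisers have odd order `m`.
-/
theorem odd_of_mod_four_eq_three (h : D.FlagTransitive G) (hlam : 0 < lam) (hk : 4 < k)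
    (hkq : k < Nat.card F + 1)
    (e : G ≃* Matrix.ProjectiveSpecialLinearGroup (Fin 2) F) {B : Set X} (hB : B ∈ D.blocks)
    {m : ℕ} (hm : k * m = Nat.card (setwiseStabilizer G B)) (hq : Nat.card F % 4 = 3) :
    ¬ 2 ∣ m := by
  intro h2
  obtain ⟨x, hx⟩ := exists_mem_block D (by omega) hB
  have h3 : m = Nat.card (MulAction.stabilizer (MulAction.stabilizer G B) x) :=
    Nat.eq_of_mul_eq_mul_left (show 0 < k by omega)
      (hm.trans (h.mul_card_point_stabilizer hB hx).symm)
  rw [h3] at h2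
  obtain ⟨⟨⟨t, htB⟩, htx⟩, ht, ht1⟩ := exists_involution_of_two_dvd h2
  exact h.smul_ne_of_mod_four_eq_three hlam hk hkq e hq
    (Subtype.ext_iff.1 (Subtype.ext_iff.1 ht))
    (fun h => ht1 (Subtype.ext (Subtype.ext h))) x htx

/-- If `q ≡ 3` modulo `4` and `lam` is odd, each four-group of `PSL(2, q)` is regular on its orbits
and fixes a block through every point. Comparing the number of four-groups in `PSL(2, q)` with the
number in all block stabilisers bounds `q`. -/
theorem le_commutingInvolutions_of_mod_four_eq_three (h : D.FlagTransitive G) (hlam : 0 < lam)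
    (hk : 4 < k) (hkq : k < Nat.card F + 1) (hG : G ≤ D.autGroup)
    (e : G ≃* Matrix.ProjectiveSpecialLinearGroup (Fin 2) F) {B : Set X} (hB : B ∈ D.blocks)
    (hq : Nat.card F % 4 = 3) (hlo : ¬ 2 ∣ lam) :
    (Nat.card F + 1) * Nat.card (setwiseStabilizer G B) ≤
      2 * (k * (commutingInvolutions (setwiseStabilizer G B)).ncard) := by
  have h1 := h.mul_ncard_commutingInvolutions_le hG (by omega) hlo
    (fun t ht ht1 x => h.smul_ne_of_mod_four_eq_three hlam hk hkq e hq ht ht1 x) hB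
  have h2 := le_ncard_commutingInvolutions (F := F) (G := G)
    (two_ne_zero_iff_not_even_card.2 (by rw [Nat.even_iff]; omega)) _
    (PlaneCover.ofPSL e (MonoidHom.id G) Function.injective_id).hom_eq_one_iff
  have hd : slCenterOrder (Nat.card F) = 2 := by
    unfold slCenterOrder; rw [if_neg]; rw [Nat.even_iff]; omega
  rw [← slCenterOrder_mul_card e, hd] at h2
  have h3 := h.ncard_blocks_mul hG (by omega) hB
  rw [← h3] at h2
  have hb : 0 < D.blocks.ncard := (Set.ncard_pos (Set.toFinite _)).2 ⟨B, hB⟩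
  apply Nat.le_of_mul_le_mul_left _ hb
  change (Nat.card F + 1) * _ ≤ k * (_ * (commutingInvolutions (setwiseStabilizer G B)).ncard)
    at h1
  change 2 * (_ * Nat.card (setwiseStabilizer G B)) ≤ _ at h2
  nlinarith [Nat.mul_le_mul_left (Nat.card F + 1) h2]

/-- If `q ≡ 1` modulo `8` and `lam` is odd, block stabilisers contain elements of order four: a
point stabiliser has order `q (q - 1) / 2` with cyclic Sylow `2`-subgroups, so it contains such an
element, which fixes a block as `lam` is odd. -/
theorem exists_order_four (h : D.FlagTransitive G) (hlam : 0 < lam) (hk : 4 < k)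
    (hkq : k < Nat.card F + 1) (hG : G ≤ D.autGroup)
    (e : G ≃* Matrix.ProjectiveSpecialLinearGroup (Fin 2) F) {B : Set X} (hB : B ∈ D.blocks)
    (hq : Nat.card F % 8 = 1) (hlo : ¬ 2 ∣ lam) :
    ∃ g : setwiseStabilizer G B, g ^ 4 = 1 ∧ g ^ 2 ≠ 1 := by
  obtain ⟨x, hx⟩ := exists_mem_block D (by omega) hB
  obtain ⟨M⟩ := h.nonempty_lineModel (by omega) hk hkq e
  obtain ⟨p, j, hp, hc, hj, hcard⟩ := exists_char_and_card_eq_pow F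
  have hpo : ¬ 2 ∣ p := by
    intro h2
    have := h2.trans (dvd_pow_self p hj)
    rw [← hcard] at this
    omega
  have : Fact (Nat.Prime 2) := ⟨Nat.prime_two⟩
  have h1 := h.card_point_stabilizer_of_odd hlam hk hkq e x (by omega)
  obtain ⟨S, hS⟩ := Sylow.exists_subgroup_card_pow_prime (G := MulAction.stabilizer G x) 2 (n := 2)
    (by rw [h1]; exact Dvd.dvd.mul_left (by omega) _)
  -- the eigenvalue character is faithful on subgroups of order prime to `p`
  have hcyc : IsCyclic S := by
    refine isCyclic_of_injective_ringHom ((M.chr x).comp S.subtype) ?_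
    rw [injective_iff_map_eq_one]
    intro s hs
    have h2 : s ^ p = 1 := Subtype.ext (Subtype.ext (M.pow_char_eq_one_of_chr_eq_one p hs))
    have h3 : s ^ Nat.card S = 1 := pow_card_eq_one'
    have hcop : Nat.Coprime p (Nat.card S) := by
      rw [hS]
      exact Nat.Coprime.pow_right 2 ((Nat.coprime_primes hp Nat.prime_two).2 (by
        rintro rfl; exact hpo dvd_rfl))
    have := Nat.dvd_gcd (orderOf_dvd_of_pow_eq_one h2) (orderOf_dvd_of_pow_eq_one h3)
    rw [hcop] at this
    exact orderOf_eq_one_iff.1 (Nat.dvd_one.1 this)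
  obtain ⟨s, hs⟩ := hcyc.exists_generator
  have hord : orderOf s = 4 := by
    rw [orderOf_eq_card_of_forall_mem_zpowers hs, hS]; norm_num
  have hord' : orderOf ((s : MulAction.stabilizer G x) : G) = 4 := by
    rw [← hord, Subgroup.orderOf_coe, Subgroup.orderOf_coe]
  set g : G := ((s : MulAction.stabilizer G x) : G)
  have hg4 : g ^ 4 = 1 := by rw [← hord', pow_orderOf_eq_one]
  have hg2 : g ^ 2 ≠ 1 := by
    intro h2
    have := orderOf_dvd_of_pow_eq_one h2
    rw [hord'] at this
    omega
  obtain ⟨C, hC, hgC⟩ := exists_block_of_order_four hG hlo hg4 hg2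
  obtain ⟨eC⟩ := h.nonempty_stabilizer_mulEquiv (by omega) hB hC
  let z : MulAction.stabilizer G C := ⟨g, hgC⟩
  refine ⟨eC z, (map_pow eC z 4).symm.trans ?_, fun h2 => hg2 ?_⟩
  · rw [show z ^ 4 = 1 from Subtype.ext hg4]
    exact map_one eC
  · have h3 : eC (z ^ 2) = 1 := (map_pow eC z 2).trans h2
    exact congrArg Subtype.val (eC.injective (h3.trans (map_one eC).symm))

end BlockDesign.FlagTransitive

/-! ### The groups `A₄`, `S₄` and `A₅` -/

/-- A form suited to kernel computation: only pairs of involutions are tested for commutation. -/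
theorem ncard_commutingInvolutions_eq_card {H : Type*} [Group H] [Fintype H] [DecidableEq H] :
    (commutingInvolutions H).ncard =
      (((Finset.univ.filter fun t : H => t * t = 1 ∧ t ≠ 1) ×ˢ
        (Finset.univ.filter fun t : H => t * t = 1 ∧ t ≠ 1)).filter
          fun z => z.1 ≠ z.2 ∧ z.1 * z.2 = z.2 * z.1).card := by
  rw [← Set.ncard_coe_finset]
  congr 1
  ext z
  simp only [commutingInvolutions, Set.mem_ofPred_eq, Finset.coe_filter, Finset.mem_product,
    Finset.mem_filter, Finset.mem_univ, true_and]
  tauto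

set_option maxRecDepth 100000 in
theorem ncard_commutingInvolutions_A4 :
    (commutingInvolutions (alternatingGroup (Fin 4))).ncard = 6 := by
  rw [ncard_commutingInvolutions_eq_card]
  decide +kernel

set_option maxRecDepth 100000 in
theorem ncard_commutingInvolutions_S4 :
    (commutingInvolutions (Equiv.Perm (Fin 4))).ncard = 24 := by
  rw [ncard_commutingInvolutions_eq_card]
  decide +kernel

set_option maxRecDepth 100000 in
theorem ncard_commutingInvolutions_A5 :
    (commutingInvolutions (alternatingGroup (Fin 5))).ncard = 30 := by
  rw [ncard_commutingInvolutions_eq_card]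
  decide +kernel

theorem card_A4 : Nat.card (alternatingGroup (Fin 4)) = 12 := by
  rw [nat_card_alternatingGroup]; simp [Nat.factorial]

theorem card_S4 : Nat.card (Equiv.Perm (Fin 4)) = 24 := by
  rw [Nat.card_perm]; simp [Nat.factorial]

theorem card_A5 : Nat.card (alternatingGroup (Fin 5)) = 60 := by
  rw [nat_card_alternatingGroup]; simp [Nat.factorial]

set_option maxRecDepth 100000 in
/-- The involutions of `A₄` lie in its normal four-group. -/
theorem A4_conj_mul_comm : ∀ t h : alternatingGroup (Fin 4), t * t = 1 →
    h * t * h⁻¹ * t = t * (h * t * h⁻¹) := by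
  decide +kernel

set_option maxRecDepth 100000 in
/-- The centraliser of an involution of `A₅` is a four-group, which is normalised by elements of
order three. -/
theorem A5_exists_conj_mul_comm : ∀ t : alternatingGroup (Fin 5), t * t = 1 → t ≠ 1 →
    ∃ h : alternatingGroup (Fin 5), h ≠ 1 ∧ h * h * h = 1 ∧
      h * t * h⁻¹ * t = t * (h * t * h⁻¹) := by
  decide +kernel

set_option maxRecDepth 100000 in
theorem A5_sq_eq_one_of_pow_four : ∀ t : alternatingGroup (Fin 5), t ^ 4 = 1 → t ^ 2 = 1 := by
  decide +kernel

/-! ### Numerical elimination -/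

theorem not_prime_pow_of_two_primes {p j a b : ℕ} (hp : p.Prime) (ha : a.Prime) (hb : b.Prime)
    (hab : a ≠ b) (h1 : a ∣ p ^ j) (h2 : b ∣ p ^ j) : False :=
  hab (((Nat.prime_dvd_prime_iff_eq ha hp).1 (ha.dvd_of_dvd_pow h1)).trans
    ((Nat.prime_dvd_prime_iff_eq hb hp).1 (hb.dvd_of_dvd_pow h2)).symm)

theorem odd_factor_of_mul_eq {a b c : ℕ} (h : a * b = c) (hc : c % 2 = 1) : ¬ 2 ∣ a := by
  intro h2
  have h3 : 2 ∣ c := h ▸ h2.mul_right b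
  omega

theorem block_size_of_order_twelve {k m : ℕ} (hk : 4 < k) (h : k * m = 12) :
    k = 6 ∧ m = 2 ∨ k = 12 ∧ m = 1 := by
  have h1 : k ≤ 12 := Nat.le_of_dvd (by norm_num) ⟨m, h.symm⟩
  interval_cases k <;> omega

theorem block_size_of_order_twentyfour {k m : ℕ} (hk : 4 < k) (h : k * m = 24) :
    k = 6 ∧ m = 4 ∨ k = 8 ∧ m = 3 ∨ k = 12 ∧ m = 2 ∨ k = 24 ∧ m = 1 := by
  have h1 : k ≤ 24 := Nat.le_of_dvd (by norm_num) ⟨m, h.symm⟩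
  interval_cases k <;> omega

theorem block_size_of_order_sixty {k m : ℕ} (hk : 4 < k) (h : k * m = 60) :
    k = 5 ∧ m = 12 ∨ k = 6 ∧ m = 10 ∨ k = 10 ∧ m = 6 ∨ k = 12 ∧ m = 5 ∨
      k = 15 ∧ m = 4 ∨ k = 20 ∧ m = 3 ∨ k = 30 ∧ m = 2 ∨ k = 60 ∧ m = 1 := by
  have h1 : k ≤ 60 := Nat.le_of_dvd (by norm_num) ⟨m, h.symm⟩
  interval_cases k <;> omega

/-- The exponent of `q = 2 ^ j` is bounded by the value `c` of `lam * (q - 2)`, as `lam` is at least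
`11`. -/
theorem exponent_le {j c a : ℕ} (h : 11 * (2 ^ j - 2) ≤ c) (hc : c < 11 * (2 ^ (a + 1) - 2)) :
    j ≤ a := by
  by_contra! hj
  have := Nat.pow_le_pow_right two_pos (show a + 1 ≤ j by omega)
  omega

/-- For `q = 2 ^ j` and block stabilisers of order `12` only `q = 32` survives, with `lam = 33`. -/
theorem even_order_twelve {k m lam j : ℕ} (hlam : 10 < lam) (hk : 4 < k) (hkq : k ≤ 2 ^ j)
    (hkm : k * m = 12) (h : lam * (2 ^ j - 2) * m = (k - 1) * (k - 2) * (k - 3)) :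
    j = 5 := by
  have hb : 11 * (2 ^ j - 2) * m ≤ (k - 1) * (k - 2) * (k - 3) := by
    rw [← h]; gcongr; omega
  rcases block_size_of_order_twelve hk hkm with
    ⟨rfl, rfl⟩ | ⟨rfl, rfl⟩ <;>
    try omega
  · have hj : j ≤ 6 := exponent_le (c := 990) (by omega) (by norm_num)
    interval_cases j <;> omega

theorem even_order_twentyfour {k m lam j : ℕ} (hlam : 10 < lam) (hk : 4 < k) (hkq : k ≤ 2 ^ j)
    (hkm : k * m = 24) (h : lam * (2 ^ j - 2) * m = (k - 1) * (k - 2) * (k - 3)) : False := by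
  have hb : 11 * (2 ^ j - 2) * m ≤ (k - 1) * (k - 2) * (k - 3) := by
    rw [← h]; gcongr; omega
  rcases block_size_of_order_twentyfour hk hkm with
    ⟨rfl, rfl⟩ | ⟨rfl, rfl⟩ | ⟨rfl, rfl⟩ | ⟨rfl, rfl⟩ <;>
    try omega
  · have hj : j ≤ 3 := exponent_le (c := 70) (by omega) (by norm_num)
    interval_cases j <;> omega
  · have hj : j ≤ 5 := exponent_le (c := 495) (by omega) (by norm_num)
    interval_cases j <;> omega
  · have hj : j ≤ 9 := exponent_le (c := 10626) (by omega) (by norm_num)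
    interval_cases j <;> omega

/-- For `q = 2 ^ j` and block stabilisers of order `60` only `q = 16`, `m = 4` and `q = 128`, `m =
2` survive. -/
theorem even_order_sixty {k m lam j : ℕ} (hlam : 10 < lam) (hk : 4 < k) (hkq : k ≤ 2 ^ j)
    (hkm : k * m = 60) (h : lam * (2 ^ j - 2) * m = (k - 1) * (k - 2) * (k - 3)) :
    2 ∣ m ∧ ¬ 3 ∣ m := by
  have hb : 11 * (2 ^ j - 2) * m ≤ (k - 1) * (k - 2) * (k - 3) := by
    rw [← h]; gcongr; omega
  rcases block_size_of_order_sixty hk hkm with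
    ⟨rfl, rfl⟩ | ⟨rfl, rfl⟩ | ⟨rfl, rfl⟩ | ⟨rfl, rfl⟩ | ⟨rfl, rfl⟩ |
      ⟨rfl, rfl⟩ | ⟨rfl, rfl⟩ | ⟨rfl, rfl⟩ <;>
    try omega
  · have hj : j ≤ 4 := exponent_le (c := 198) (by omega) (by norm_num)
    interval_cases j <;> omega
  · have hj : j ≤ 7 := exponent_le (c := 1938) (by omega) (by norm_num)
    interval_cases j <;> omega
  · have hj : j ≤ 14 := exponent_le (c := 195054) (by omega) (by norm_num)
    interval_cases j <;> omega

/-- The restrictions on an odd prime power `q` that come from the involutions of `PSL(2, q)` when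
`lam` is odd. Here `k` is the block size, `m` the order of a flag stabiliser, `n` the order of a
block stabiliser, and `P` the number of ordered pairs of distinct commuting involutions in it. -/
def InvolutionConditions (q k m n P : ℕ) : Prop :=
  (q % 4 = 1 ∧ 2 ∣ m) ∨ (q % 4 = 3 ∧ ¬ 2 ∣ m ∧ (q + 1) * n ≤ 2 * (k * P))

theorem odd_order_twelve {q k m lam : ℕ} (hlam : 10 < lam) (hk : 4 < k) (hkq : k ≤ q)
    (hkm : k * m = 12) (h : lam * (q - 2) * (2 * m) = (k - 1) * (k - 2) * (k - 3))
    (hinv : ¬ 2 ∣ lam → InvolutionConditions q k m 12 6) : False := by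
  have hb : 11 * (q - 2) * (2 * m) ≤ (k - 1) * (k - 2) * (k - 3) := by
    rw [← h]; gcongr; omega
  rcases block_size_of_order_twelve hk hkm with
    ⟨rfl, rfl⟩ | ⟨rfl, rfl⟩ <;>
    try omega
  · have h1 : lam * (q - 2) = 495 := by omega
    rcases hinv (odd_factor_of_mul_eq h1 (by norm_num)) with h2 | h2 <;> omega

theorem odd_order_twentyfour {q k m lam p j : ℕ} (hp : p.Prime) (hq : q = p ^ j)
    (hlam : 10 < lam) (hk : 4 < k) (hkq : k ≤ q)
    (hkm : k * m = 24) (h : lam * (q - 2) * (2 * m) = (k - 1) * (k - 2) * (k - 3))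
    (hinv : ¬ 2 ∣ lam → InvolutionConditions q k m 24 24) : False := by
  have hb : 11 * (q - 2) * (2 * m) ≤ (k - 1) * (k - 2) * (k - 3) := by
    rw [← h]; gcongr; omega
  rcases block_size_of_order_twentyfour hk hkm with
    ⟨rfl, rfl⟩ | ⟨rfl, rfl⟩ | ⟨rfl, rfl⟩ | ⟨rfl, rfl⟩ <;>
    try omega
  · have h1 : lam * (q - 2) = 5313 := by omega
    rcases hinv (odd_factor_of_mul_eq h1 (by norm_num)) with h2 | ⟨h2, h3, h4⟩
    · omega
    · have h5 : q ≤ 47 := by omega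
      have h6 : q = 35 := by clear hq; interval_cases q <;> omega
      exact not_prime_pow_of_two_primes hp (a := 5) (b := 7) (by norm_num) (by norm_num)
        (by norm_num) (by rw [← hq, h6]; norm_num) (by rw [← hq, h6]; norm_num)

/-- For `q` odd and block stabilisers of order `60` only `q = 89` survives, with `lam = 63`. -/
theorem odd_order_sixty {q k m lam p j : ℕ} (hp : p.Prime) (hq : q = p ^ j)
    (hlam : 10 < lam) (hk : 4 < k) (hkq : k ≤ q)
    (hkm : k * m = 60) (h : lam * (q - 2) * (2 * m) = (k - 1) * (k - 2) * (k - 3))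
    (hinv : ¬ 2 ∣ lam → InvolutionConditions q k m 60 30) : q = 89 ∧ ¬ 2 ∣ lam := by
  have hb : 11 * (q - 2) * (2 * m) ≤ (k - 1) * (k - 2) * (k - 3) := by
    rw [← h]; gcongr; omega
  rcases block_size_of_order_sixty hk hkm with
    ⟨rfl, rfl⟩ | ⟨rfl, rfl⟩ | ⟨rfl, rfl⟩ | ⟨rfl, rfl⟩ | ⟨rfl, rfl⟩ |
      ⟨rfl, rfl⟩ | ⟨rfl, rfl⟩ | ⟨rfl, rfl⟩ <;>
    try omega
  · have h1 : lam * (q - 2) = 273 := by omega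
    exfalso
    have h2 : q ≤ 26 := by omega
    have h6 : q = 15 ∨ q = 23 := by clear hq hinv; interval_cases q <;> omega
    -- `15` is not a prime power, and `23` is excluded as `m` is even
    rcases h6 with h6 | h6
    · exact not_prime_pow_of_two_primes hp (a := 3) (b := 5) (by norm_num) (by norm_num)
        (by norm_num) (by rw [← hq, h6]; norm_num) (by rw [← hq, h6]; norm_num)
    · rcases hinv (odd_factor_of_mul_eq h1 (by norm_num)) with h2 | h2 <;> omega
  · have h1 : lam * (q - 2) = 969 := by omega
    rcases hinv (odd_factor_of_mul_eq h1 (by norm_num)) with h2 | h2 <;> omega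
  · have h1 : lam * (q - 2) = 5481 := by omega
    have hlo := odd_factor_of_mul_eq h1 (by norm_num)
    refine ⟨?_, hlo⟩
    rcases hinv hlo with h2 | h2
    · have h5 : lam ≤ 195 := by
        by_contra! h5
        have := Nat.mul_le_mul h5 (show 28 ≤ q - 2 by omega)
        omega
      have h6 : q = 65 ∨ q = 89 ∨ q = 205 := by
        clear hq hinv hb hlo hkm h; interval_cases lam <;> omega
      rcases h6 with h6 | h6 | h6
      · exact (not_prime_pow_of_two_primes hp (a := 5) (b := 13) (by norm_num) (by norm_num)
          (by norm_num) (by rw [← hq, h6]; norm_num) (by rw [← hq, h6]; norm_num)).elim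
      · exact h6
      · exact (not_prime_pow_of_two_primes hp (a := 5) (b := 41) (by norm_num) (by norm_num)
          (by norm_num) (by rw [← hq, h6]; norm_num) (by rw [← hq, h6]; norm_num)).elim
    · omega
  · have h1 : lam * (q - 2) = 97527 := by omega
    rcases hinv (odd_factor_of_mul_eq h1 (by norm_num)) with h2 | h2 <;> omega

/-! ### Blocks stabilised by `A₄`, `S₄` and `A₅` -/

namespace BlockDesign.FlagTransitive

variable {F : Type*} [Field F] [Finite F] {X : Type*} [Finite X] {k lam : ℕ}
  {D : BlockDesign X 4 (Nat.card F + 1) k lam} {G : Subgroup (Equiv.Perm X)}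

/-- The parameter equation divided by the block size `k`; here `m` is the order of the stabiliser of
a flag. -/
theorem flag_parameter_eq (h : D.FlagTransitive G) (hk : 4 < k) (hkq : k < Nat.card F + 1)
    (hG : G ≤ D.autGroup) (e : G ≃* Matrix.ProjectiveSpecialLinearGroup (Fin 2) F) {B : Set X}
    (hB : B ∈ D.blocks) {m : ℕ} (hm : k * m = Nat.card (setwiseStabilizer G B)) :
    lam * (Nat.card F - 2) * (slCenterOrder (Nat.card F) * m) = (k - 1) * (k - 2) * (k - 3) := by
  have h1 := h.parameter_eq hG hk hkq (slCenterOrder_mul_card e) hB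
  rw [← hm] at h1
  apply Nat.eq_of_mul_eq_mul_left (show 0 < k by omega)
  linarith

theorem flag_parameter_eq_of_even (h : D.FlagTransitive G) (hk : 4 < k) (hkq : k < Nat.card F + 1)
    (hG : G ≤ D.autGroup) (e : G ≃* Matrix.ProjectiveSpecialLinearGroup (Fin 2) F) {B : Set X}
    (hB : B ∈ D.blocks) {m : ℕ} (hm : k * m = Nat.card (setwiseStabilizer G B))
    (hq : Even (Nat.card F)) :
    ∃ j, Nat.card F = 2 ^ j ∧ CharP F 2 ∧
      lam * (2 ^ j - 2) * m = (k - 1) * (k - 2) * (k - 3) := by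
  obtain ⟨p, j, hp, hc, hj, hcard⟩ := exists_char_and_card_eq_pow F
  have h1 := h.flag_parameter_eq hk hkq hG e hB hm
  obtain rfl : 2 = p := (Nat.prime_dvd_prime_iff_eq Nat.prime_two hp).1
    (Nat.prime_two.dvd_of_dvd_pow (hcard ▸ hq.two_dvd))
  rw [slCenterOrder, if_pos hq, one_mul, hcard] at h1
  exact ⟨j, hcard, hc, h1⟩

theorem flag_parameter_eq_of_odd (h : D.FlagTransitive G) (hk : 4 < k) (hkq : k < Nat.card F + 1)
    (hG : G ≤ D.autGroup) (e : G ≃* Matrix.ProjectiveSpecialLinearGroup (Fin 2) F) {B : Set X}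
    (hB : B ∈ D.blocks) {m : ℕ} (hm : k * m = Nat.card (setwiseStabilizer G B))
    (hq : ¬ Even (Nat.card F)) :
    lam * (Nat.card F - 2) * (2 * m) = (k - 1) * (k - 2) * (k - 3) := by
  have h1 := h.flag_parameter_eq hk hkq hG e hB hm
  rwa [slCenterOrder, if_neg hq] at h1

theorem involutionConditions (h : D.FlagTransitive G) (hlam : 0 < lam) (hk : 4 < k)
    (hkq : k < Nat.card F + 1) (hG : G ≤ D.autGroup)
    (e : G ≃* Matrix.ProjectiveSpecialLinearGroup (Fin 2) F) {B : Set X} (hB : B ∈ D.blocks)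
    {m : ℕ} (hm : k * m = Nat.card (setwiseStabilizer G B)) (hq : ¬ Even (Nat.card F))
    (hlo : ¬ 2 ∣ lam) :
    InvolutionConditions (Nat.card F) k m (Nat.card (setwiseStabilizer G B))
      (commutingInvolutions (setwiseStabilizer G B)).ncard := by
  rw [Nat.even_iff] at hq
  rcases (show Nat.card F % 4 = 1 ∨ Nat.card F % 4 = 3 by omega) with h1 | h3
  · exact Or.inl ⟨h1, h.even_of_mod_four_eq_one hlam hk hkq hG e hB hm h1 hlo⟩
  · exact Or.inr ⟨h3, h.odd_of_mod_four_eq_three hlam hk hkq e hB hm h3,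
      h.le_commutingInvolutions_of_mod_four_eq_three hlam hk hkq hG e hB h3 hlo⟩

theorem stabilizer_ne_S4 (h : D.FlagTransitive G) (hlam : 10 < lam) (hk : 4 < k)
    (hkq : k < Nat.card F + 1) (hG : G ≤ D.autGroup)
    (e : G ≃* Matrix.ProjectiveSpecialLinearGroup (Fin 2) F) {B : Set X} (hB : B ∈ D.blocks) :
    ¬ Nonempty (setwiseStabilizer G B ≃* Equiv.Perm (Fin 4)) := by
  rintro ⟨eB⟩
  have hn : Nat.card (setwiseStabilizer G B) = 24 := (Nat.card_congr eB.toEquiv).trans card_S4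
  obtain ⟨m, hm⟩ := h.exists_mul_eq_card_stabilizer (by omega) hB
  by_cases hq : Even (Nat.card F)
  · obtain ⟨j, hj, -, h1⟩ := h.flag_parameter_eq_of_even hk hkq hG e hB hm hq
    exact even_order_twentyfour hlam hk (by omega) (hm.trans hn) h1
  · obtain ⟨p, j, hp, -, -, hcard⟩ := exists_char_and_card_eq_pow F
    refine odd_order_twentyfour hp hcard hlam hk (by omega) (hm.trans hn)
      (h.flag_parameter_eq_of_odd hk hkq hG e hB hm hq) fun hlo => ?_
    have := h.involutionConditions (by omega) hk hkq hG e hB hm hq hlo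
    rwa [hn, (ncard_commutingInvolutions_congr eB).trans ncard_commutingInvolutions_S4] at this

theorem stabilizer_ne_A4 (h : D.FlagTransitive G) (hlam : 10 < lam) (hk : 4 < k)
    (hkq : k < Nat.card F + 1) (hG : G ≤ D.autGroup)
    (e : G ≃* Matrix.ProjectiveSpecialLinearGroup (Fin 2) F) {B : Set X} (hB : B ∈ D.blocks) :
    ¬ Nonempty (setwiseStabilizer G B ≃* alternatingGroup (Fin 4)) := by
  rintro ⟨eB⟩
  have hn : Nat.card (setwiseStabilizer G B) = 12 := (Nat.card_congr eB.toEquiv).trans card_A4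
  obtain ⟨m, hm⟩ := h.exists_mul_eq_card_stabilizer (by omega) hB
  by_cases hq : Even (Nat.card F)
  · obtain ⟨j, hj, hc, h1⟩ := h.flag_parameter_eq_of_even hk hkq hG e hB hm hq
    obtain rfl := even_order_twelve hlam hk (by omega) (hm.trans hn) h1
    obtain ⟨M⟩ := h.nonempty_lineModel (by omega) hk hkq e
    obtain ⟨t, ht, ht1⟩ := exists_involution_of_two_dvd (H := setwiseStabilizer G B)
      (by rw [hn]; norm_num)
    have htG : (t : G) * t = 1 := congrArg Subtype.val ht
    -- an involution fixes one of the `33` points, and so does every element of `A₄` with it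
    have hS : IsPGroup 2 (Subgroup.zpowers (t : G)) := isPGroup_zpowers_of_pow (n := 1) (by
      rw [pow_one, sq, htG])
    obtain ⟨x, hx⟩ := hS.nonempty_fixed_point_of_prime_not_dvd_card X (by
      rw [D.card_points, hj]; norm_num)
    have hle : setwiseStabilizer G B ≤ MulAction.stabilizer G x := by
      intro g hg
      refine M.smul_eq_of_commute_conj htG (fun h => ht1 (Subtype.ext h))
        (hx ⟨t, Subgroup.mem_zpowers _⟩) ?_
      have h2 : (⟨g, hg⟩ : setwiseStabilizer G B) * t * ⟨g, hg⟩⁻¹ * t =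
          t * (⟨g, hg⟩ * t * ⟨g, hg⟩⁻¹) := by
        apply eB.injective
        simp only [map_mul, map_inv]
        exact A4_conj_mul_comm _ _ (by rw [← map_mul, ht, map_one])
      exact congrArg Subtype.val h2
    have h3 := Subgroup.card_dvd_of_le hle
    have h4 := h.slCenterOrder_mul_card_point_stabilizer (by omega) hk hkq e x
    rw [slCenterOrder, if_pos hq, one_mul] at h4
    rw [h4, hn, hj] at h3
    norm_num at h3
  · refine odd_order_twelve hlam hk (by omega) (hm.trans hn)
      (h.flag_parameter_eq_of_odd hk hkq hG e hB hm hq) fun hlo => ?_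
    have := h.involutionConditions (by omega) hk hkq hG e hB hm hq hlo
    rwa [hn, (ncard_commutingInvolutions_congr eB).trans ncard_commutingInvolutions_A4] at this

theorem stabilizer_ne_A5 (h : D.FlagTransitive G) (hlam : 10 < lam) (hk : 4 < k)
    (hkq : k < Nat.card F + 1) (hG : G ≤ D.autGroup)
    (e : G ≃* Matrix.ProjectiveSpecialLinearGroup (Fin 2) F) {B : Set X} (hB : B ∈ D.blocks) :
    ¬ Nonempty (setwiseStabilizer G B ≃* alternatingGroup (Fin 5)) := by
  rintro ⟨eB⟩
  have hn : Nat.card (setwiseStabilizer G B) = 60 := (Nat.card_congr eB.toEquiv).trans card_A5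
  obtain ⟨x, hx⟩ := exists_mem_block D (by omega) hB
  obtain ⟨m, hm⟩ := h.exists_mul_eq_card_stabilizer (by omega) hB
  by_cases hq : Even (Nat.card F)
  · obtain ⟨j, hj, hc, h1⟩ := h.flag_parameter_eq_of_even hk hkq hG e hB hm hq
    obtain ⟨h2, h3⟩ := even_order_sixty hlam hk (by omega) (hm.trans hn) h1
    obtain ⟨M⟩ := h.nonempty_lineModel (by omega) hk hkq e
    -- a flag stabiliser of even order also contains an element of order three
    have hmx : m = Nat.card (MulAction.stabilizer (setwiseStabilizer G B) x) :=
      Nat.eq_of_mul_eq_mul_left (show 0 < k by omega)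
        (hm.trans (h.mul_card_point_stabilizer hB hx).symm)
    rw [hmx] at h2 h3
    obtain ⟨⟨t, htx⟩, ht, ht1⟩ := exists_involution_of_two_dvd h2
    have ht' : t * t = 1 := Subtype.ext_iff.1 ht
    have ht1' : t ≠ 1 := fun h => ht1 (Subtype.ext h)
    obtain ⟨a, ha1, ha3, hat⟩ := A5_exists_conj_mul_comm (eB t)
      ((map_mul eB t t).symm.trans (by rw [ht']; exact map_one eB))
      (fun h => ht1' (eB.injective (h.trans (map_one eB).symm)))
    obtain ⟨b, rfl⟩ := eB.surjective a
    have hb1 : b ≠ 1 := by rintro rfl; exact ha1 (map_one eB)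
    have hb3 : b * b * b = 1 := eB.injective (by rw [map_mul, map_mul, ha3, map_one])
    have hbt : b * t * b⁻¹ * t = t * (b * t * b⁻¹) :=
      eB.injective (by
        simp only [map_mul, map_inv]; exact hat)
    have hbx : b • x = x := M.smul_eq_of_commute_conj (t := (t : G)) (g := (b : G))
      (congrArg Subtype.val ht') (fun h => ht1' (Subtype.ext h)) htx (congrArg Subtype.val hbt)
    have hord : orderOf (⟨b, hbx⟩ : MulAction.stabilizer (setwiseStabilizer G B) x) = 3 :=
      orderOf_eq_prime (Subtype.ext (show b ^ 3 = 1 by rw [pow_succ, sq, hb3]))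
        (fun h => hb1 (congrArg Subtype.val h))
    exact h3 (hord ▸ orderOf_dvd_natCard _)
  · obtain ⟨p, j, hp, -, -, hcard⟩ := exists_char_and_card_eq_pow F
    obtain ⟨h89, hlo⟩ := odd_order_sixty hp hcard hlam hk (by omega) (hm.trans hn)
      (h.flag_parameter_eq_of_odd hk hkq hG e hB hm hq) (fun hlo => by
        have := h.involutionConditions (by omega) hk hkq hG e hB hm hq hlo
        rwa [hn, (ncard_commutingInvolutions_congr eB).trans ncard_commutingInvolutions_A5]
          at this)
    obtain ⟨g, hg4, hg2⟩ := h.exists_order_four (by omega) hk hkq hG e hB (by rw [h89]) hlo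
    apply hg2
    apply eB.injective
    rw [map_pow, map_one]
    exact A5_sq_eq_one_of_pow_four _ (by rw [← map_pow, hg4, map_one])

end BlockDesign.FlagTransitive

theorem theorem1p2 {F : Type*} [Field F] [Finite F] (q : ℕ) (hq : Nat.card F = q)
    {X : Type*} [Finite X] (k lam : ℕ) (D : BlockDesign X 4 (q + 1) k lam)
    (hlam : 10 < lam) (hk : 4 < k) (hkq : k < q + 1)
    (G : Subgroup (Equiv.Perm X)) (hG : G ≤ D.autGroup)
    (hPSL : Nonempty (G ≃* Matrix.ProjectiveSpecialLinearGroup (Fin 2) F))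
    (hflag : D.FlagTransitive G) (B : Set X) (hB : B ∈ D.blocks) :
    ¬ Nonempty (setwiseStabilizer G B ≃* alternatingGroup (Fin 4)) ∧
    ¬ Nonempty (setwiseStabilizer G B ≃* Equiv.Perm (Fin 4)) ∧
    ¬ Nonempty (setwiseStabilizer G B ≃* alternatingGroup (Fin 5)) ∧
    (∀ (K : Type*) [Field K] [Finite K] (g : ℕ), 1 < g → Even g → Nat.card K ^ g = q →
      ¬ Nonempty (setwiseStabilizer G B ≃* Matrix.ProjGenLinGroup (Fin 2) K)) ∧
    (∀ (K : Type*) [Field K] [Finite K] (g : ℕ), 1 ≤ g → Nat.card K ^ g = q →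
      ¬ Nonempty (setwiseStabilizer G B ≃* Matrix.ProjectiveSpecialLinearGroup (Fin 2) K)) := by
  subst hq
  obtain ⟨e⟩ := hPSL
  exact ⟨hflag.stabilizer_ne_A4 hlam hk hkq hG e hB, hflag.stabilizer_ne_S4 hlam hk hkq hG e hB,
    hflag.stabilizer_ne_A5 hlam hk hkq hG e hB,
    fun K _ _ g hg _ hK => hflag.stabilizer_ne_PGL hlam hk hkq hG e hB hg hK,
    fun K _ _ g hg hK => hflag.stabilizer_ne_PSL hlam hk hkq hG e hB hg hK⟩
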